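/- Let $\mathbb T^2=\mathbb R^2/2\pi\mathbb Z^2$ be the standard flat torus, let $x_0\in\mathbb T^2$ and $\phi\in(-\pi,\pi)$. For $z\in\mathbb C\setminus\{|\xi|^2:\xi\in\mathbb Z^2\}$ let $$G_z(x)=G_z(x;x_0)=\sum_{\xi\in\mathbb Z^2}\frac{e^{i\langle x-x_0,\xi\rangle}}{|\xi|^2-z}\quad\text{(convergent in }L^2(\mathbb T^2)\text{)}$$ be Green's function. Let $-\Delta_{x_0,\phi}$ be the point scatterer, that is, the self-adjoint extension of $-\Delta|_{C_c^\infty(\mathbb T^2\setminus\{x_0\})}$ whose domain is the domain of the closure of this operator plus the line spanned by $G_{i}+e^{i\phi}G_{-i}$, on which $-\Delta_{x_0,\phi}(G_{i}+e^{i\phi}G_{-i})=iG_{i}-ie^{i\phi}G_{-i}$. Let $\Lambda_\phi\subset\mathbb R$ be the set of its new eigenvalues, i.e. the eigenvalues of $-\Delta_{x_0,\phi}$ that are not eigenvalues $|\xi|^2$, $\xi\in\mathbb Z^2$, of $-\Delta$; equivalently, the real solutions $\lambda$ of $$\sum_{\xi\in\mathbb Z^2}\left(\frac1{|\xi|^2-\lambda}-\frac{|\xi|^2}{|\xi|^4+1}\right)=\tan\frac{\phi}{2}\,\sum_{\xi\in\mathbb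 Z^2}\frac1{|\xi|^4+1}.$$ For $\lambda\in\Lambda_\phi$ put $g_\lambda=G_\lambda/\|G_\lambda\|_2$, where the $L^2$-norm is taken with respect to the normalized volume $dy/(4\pi^2)$. Then there is a subset $\Lambda'\subseteq\Lambda_\phi$ of density one, i.e. with $$\lim_{X\to\infty}\frac{\#\{\lambda\in\Lambda':\lambda\le X\}}{\#\{\lambda\in\Lambda_\phi:\lambda\le X\}}=1,$$ such that for every $\varepsilon>0$ $$\sup_{\substack{x\in\mathbb T^2\\ \lambda^{-1/2+\varepsilon}<r\le\pi}}\left|\frac{\int_{B_r(x)}|g_\lambda(y)|^2\,dy}{\pi r^2}-1\right|\longrightarrow0$$ as $\lambda\to\infty$ along $\Lambda'$, where $B_r(x)$ is the geodesic ball of radius $r$ centred at $x$ and $dy$ is Lebesgue measure (a supremum over an empty set of radii being $0$). -/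

import Mathlib

namespace PointScatterer

open MeasureTheory Filter Topology

noncomputable section

instance factTwoPiPos : Fact (0 < 2 * Real.pi) := ⟨Real.two_pi_pos⟩

/-- The standard flat torus `ℝ² / 2πℤ²`.  Its `volume` is the Riemannian (Lebesgue) measure `dy`,
of total mass `4π²`. -/
abbrev Torus : Type := Fin 2 → AddCircle (2 * Real.pi)

/-- The covering map `ℝ² → ℝ² / 2πℤ²`. -/
def proj (y : EuclideanSpace ℝ (Fin 2)) : Torus := fun j => (y j : AddCircle (2 * Real.pi))

/-- The open geodesic ball `B_r(x)` of the flat torus (for `r > 0`).  The norm of a point of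
`AddCircle (2π)` is its distance to `0`, so the square root is the flat Riemannian distance from
`y` to `x`; the distance of the product type `Torus` itself is the sup distance. -/
def geodesicBall (x : Torus) (r : ℝ) : Set Torus :=
  {y | √(∑ j, ‖y j - x j‖ ^ 2) < r}

/-- The normalized volume `dy / (4π²)` on the torus. -/
def normalizedVolume : Measure Torus :=
  Measure.pi fun _ => (AddCircle.haarAddCircle : Measure (AddCircle (2 * Real.pi)))

instance : IsProbabilityMeasure normalizedVolume := by
  unfold normalizedVolume; infer_instance

/-- The Hilbert space `L²` of the torus, with the norm given by the normalized volume. -/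
abbrev L2Torus : Type := Lp ℂ 2 normalizedVolume

/-- `|ξ|²` for a lattice point `ξ ∈ ℤ²`. -/
def normSq (ξ : Fin 2 → ℤ) : ℤ := ∑ j, ξ j ^ 2

/-- The function `x ↦ exp (i ⟨x - x₀, ξ⟩)` on the torus. -/
def expWave (x₀ : Torus) (ξ : Fin 2 → ℤ) : C(Torus, ℂ) where
  toFun x := ∏ j, fourier (ξ j) (x j - x₀ j)
  continuous_toFun := by fun_prop

/-- Green's function, `G_z(x; x₀) = ∑_ξ exp (i ⟨x - x₀, ξ⟩) / (|ξ|² - z)`, a series in `L²`;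
up to a constant factor it is `(Δ + z)⁻¹ δ_{x₀}`. -/
def green (x₀ : Torus) (z : ℂ) : L2Torus :=
  ∑' ξ : Fin 2 → ℤ, (1 / ((normSq ξ : ℂ) - z)) •
    ContinuousMap.toLp (E := ℂ) 2 normalizedVolume ℂ (expWave x₀ ξ)

/-- The `L²`-normalized Green's function `g_λ = G_λ / ‖G_λ‖₂`. -/
def normalizedGreen (x₀ : Torus) (lam : ℝ) : L2Torus :=
  ((‖green x₀ (lam : ℂ)‖ : ℂ)⁻¹) • green x₀ (lam : ℂ)

/-- The graph of the symmetric operator `-Δ` on the smooth functions `U` on the torus that vanish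
in a neighbourhood of `x₀`: pairs `(U, V)` with `V = -Δ U`, as elements of `L² × L²`. -/
def minimalGraph (x₀ : Torus) : Submodule ℂ (L2Torus × L2Torus) where
  carrier := {p | ∃ U V : Torus → ℂ,
    ContDiff ℝ ((⊤ : ℕ∞) : WithTop ℕ∞) (fun y => U (proj y)) ∧
    (∀ᶠ x in 𝓝 x₀, U x = 0) ∧
    (∀ y, V (proj y) = - Laplacian.laplacian (fun y => U (proj y)) y) ∧
    p.1 =ᵐ[normalizedVolume] U ∧ p.2 =ᵐ[normalizedVolume] V}
  zero_mem' := by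
    refine ⟨0, 0, contDiff_const, Eventually.of_forall fun _ => rfl, fun y => ?_,
      Lp.coeFn_zero _ _ _, Lp.coeFn_zero _ _ _⟩
    simp only [Pi.zero_apply]
    rw [InnerProductSpace.laplacian_const]
    simp
  add_mem' := by
    rintro p q ⟨U, V, hU, hU0, hV, hp1, hp2⟩ ⟨U', V', hU', hU0', hV', hq1, hq2⟩
    refine ⟨U + U', V + V', hU.add hU', ?_, fun y => ?_,
      (Lp.coeFn_add _ _).trans (hp1.add hq1), (Lp.coeFn_add _ _).trans (hp2.add hq2)⟩
    · filter_upwards [hU0, hU0'] with x hx hx'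
      simp [hx, hx']
    · have h := ContDiffAt.laplacian_add (x := y)
        (hU.contDiffAt.of_le (WithTop.coe_le_coe.2 (le_top : (2 : ℕ∞) ≤ ⊤)))
        (hU'.contDiffAt.of_le (WithTop.coe_le_coe.2 (le_top : (2 : ℕ∞) ≤ ⊤)))
      rw [Pi.add_apply, hV y, hV' y, ← neg_add, ← h]
      rfl
  smul_mem' := by
    rintro c p ⟨U, V, hU, hU0, hV, hp1, hp2⟩
    refine ⟨c • U, c • V, contDiff_const.smul hU, ?_, fun y => ?_,
      (Lp.coeFn_smul _ _).trans (hp1.const_smul c), (Lp.coeFn_smul _ _).trans (hp2.const_smul c)⟩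
    · filter_upwards [hU0] with x hx
      simp [hx]
    · have h := ContDiffAt.laplacian_CLM_comp_left (x := y)
        (l := (ContinuousLinearMap.mul ℝ ℂ c))
        (hU.contDiffAt.of_le (WithTop.coe_le_coe.2 (le_top : (2 : ℕ∞) ≤ ⊤)))
      rw [Pi.smul_apply, hV y, smul_neg, smul_eq_mul]
      exact congrArg Neg.neg h.symm

/-- The vector `G_i + e^{iφ} G_{-i}`, where `G_{±i}` span the deficiency spaces at `x₀`. -/
def deficiencyVector (x₀ : Torus) (φ : ℝ) : L2Torus :=
  green x₀ Complex.I + Complex.exp (φ * Complex.I) • green x₀ (-Complex.I)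

/-- The image `i G_i - i e^{iφ} G_{-i}` of `deficiencyVector x₀ φ` under the adjoint of the
operator with graph `minimalGraph x₀`. -/
def deficiencyImage (x₀ : Torus) (φ : ℝ) : L2Torus :=
  Complex.I • green x₀ Complex.I -
    (Complex.I * Complex.exp (φ * Complex.I)) • green x₀ (-Complex.I)

/-- The graph of the point scatterer `-Δ_{x₀,φ}`: von Neumann's self-adjoint extension, with
parameter `φ ∈ (-π, π]`, of `-Δ` on smooth functions vanishing near `x₀`.  Its domain is the
domain of the closure plus the line spanned by `G_i + e^{iφ} G_{-i}` (so that `φ = π` gives the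
usual Laplacian), and it acts by `G_{±i} ↦ ±i G_{±i}` on the latter. -/
def scattererGraph (x₀ : Torus) (φ : ℝ) : Submodule ℂ (L2Torus × L2Torus) :=
  (minimalGraph x₀).topologicalClosure ⊔
    Submodule.span ℂ {(deficiencyVector x₀ φ, deficiencyImage x₀ φ)}

/-- `lam` is an eigenvalue of the point scatterer `-Δ_{x₀,φ}`. -/
def IsEigenvalue (x₀ : Torus) (φ lam : ℝ) : Prop :=
  ∃ f : L2Torus, f ≠ 0 ∧ (f, (lam : ℂ) • f) ∈ scattererGraph x₀ φ

/-- The set `Λ_φ` of new eigenvalues: the eigenvalues of `-Δ_{x₀,φ}` that are not eigenvalues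
`|ξ|²`, `ξ ∈ ℤ²`, of the unperturbed Laplacian `-Δ`. -/
def newEigenvalues (x₀ : Torus) (φ : ℝ) : Set ℝ :=
  {lam | IsEigenvalue x₀ φ lam ∧ ∀ ξ : Fin 2 → ℤ, (normSq ξ : ℝ) ≠ lam}

/-- `S'` is a subset of `S` of density one:
`#{lam ∈ S' : lam ≤ X} / #{lam ∈ S : lam ≤ X} → 1` as `X → ∞`. -/
def IsDensityOneSubset (S' S : Set ℝ) : Prop :=
  S' ⊆ S ∧
    Tendsto (fun X : ℝ => ({lam ∈ S' | lam ≤ X}.ncard : ℝ) / ({lam ∈ S | lam ≤ X}.ncard : ℝ))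
      atTop (𝓝 1)

/-- The supremum over `x` in the torus and `ρ < r ≤ π` of
`|(∫_{B_r(x)} |g_λ(y)|² dy) / (π r²) - 1|`, an element of `[0, ∞]`. -/
def massDiscrepancy (x₀ : Torus) (lam ρ : ℝ) : ENNReal :=
  ⨆ (x : Torus) (r : ℝ) (_ : ρ < r ∧ r ≤ Real.pi),
    ENNReal.ofReal
      |(∫ y in geodesicBall x r, ‖normalizedGreen x₀ lam y‖ ^ 2) / (Real.pi * r ^ 2) - 1|

end

end PointScatterer

/-!
Write `G_lam = ∑ c_ξ e_ξ` with `c_ξ = 1 / (|ξ|² - lam)`. The Fourier coefficient of the mass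
density `|G_lam|²` at `ζ` is the autocorrelation `∑ c_ξ c_{ξ+ζ}`, and the theorem holds because
for most `lam` these autocorrelations, summed over all nonzero `|ζ_j| ≤ lam ^ (1/2 - a)`, are
small compared with `∑ c_ξ²` (`massError`).

*New eigenvalues.* An element of the closure of the minimal operator has Fourier coefficients
summing to zero. Conversely, such elements are limits of combinations of `e_ξ - e_0`, which vanish
at `x₀` and so can be cut off at distance `√δ` from `x₀`: the Laplacians of the truncations then
differ from the limit by functions of size `O(δ ^ (-1/2))` on sets of measure `O(δ)`, which are
bounded in `L²` and have shrinking support, hence tend weakly to zero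
(`wave_sub_const_mem_closure`). Hence `lam` is a new eigenvalue if and only if it solves the
spectral equation (`hasSum_spectralTerm_of_mem`, `mem_newEigenvalues_of_hasSum`). The left side of
that equation increases from `-∞` to `∞` between consecutive values of `|ξ|²`, so each bounded gap
contains exactly one new eigenvalue.

*Counting.* If `lam` lies in a gap of length `h` starting at `m`, then `|c_ξ|` is at most `2 h /
(1 + ||ξ|² - m|)` times the largest coefficient, and `massError` is at most `4 h²` times the
weighted number `pairSum m K` of pairs of lattice points near the circle `|ξ|² = m` at sup
distance at most `K` (`massError_le`). For fixed `ζ`, the points with `|ξ + ζ|² - |ξ|² = t` lie on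
a line, which bounds the mean of `pairSum m K` over `m ≤ X` by `X ^ (-1/2 + δ) K`
(`exists_sum_pairSum_le`). The same count for coinciding circles and the Cauchy–Schwarz inequality
give at least `X ^ (1 - δ)` values of `|ξ|²` up to `X` (`exists_le_card_normValues`), while at
most `X / h` gaps are longer than `h`. So the exceptional eigenvalues up to `X` number at most `X
^ (1 - a/4)`, which is of density zero.

*Equidistribution.* A high power of a Dirichlet kernel is a nonnegative trigonometric polynomial
of degree `lam ^ (1/2 - a)` concentrated at scale slightly above `lam ^ (-1/2 + a)`
(`exists_kernel`). The convolution of `|g_lam|²` with it is uniformly within `massError` of one,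
and comparing a ball with slightly smaller and larger concentric balls gives the mass of every
ball of radius `r > lam ^ (-1/2 + 2 a)` (`exists_massDiscrepancy_le`). The exceptional sets grow
as `a` decreases to zero, and removing them up to bounded pieces leaves a single set of density
one (`exists_isDensityOneSubset`).
-/

namespace PointScatterer

open MeasureTheory Filter Topology
open scoped ComplexConjugate

noncomputable section

/-! ### The exponentials as a Hilbert basis -/

/-- The function `expWave x₀ ξ` as an element of `L²`. -/
def waveLp (x₀ : Torus) (ξ : Fin 2 → ℤ) : L2Torus :=
  ContinuousMap.toLp (E := ℂ) 2 normalizedVolume ℂ (expWave x₀ ξ)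

lemma expWave_apply (x₀ : Torus) (ξ : Fin 2 → ℤ) (x : Torus) :
    expWave x₀ ξ x = ∏ j, fourier (ξ j) (x j - x₀ j) := rfl

lemma expWave_add (x₀ : Torus) (ξ η : Fin 2 → ℤ) (x : Torus) :
    expWave x₀ (ξ + η) x = expWave x₀ ξ x * expWave x₀ η x := by
  simp only [expWave_apply, Pi.add_apply, fourier_add, Finset.prod_mul_distrib]

lemma expWave_neg (x₀ : Torus) (ξ : Fin 2 → ℤ) (x : Torus) :
    expWave x₀ (-ξ) x = conj (expWave x₀ ξ x) := by
  simp only [expWave_apply, Pi.neg_apply, fourier_neg, map_prod]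

lemma expWave_zero (x₀ : Torus) (x : Torus) : expWave x₀ 0 x = 1 := by
  simp [expWave_apply]

lemma expWave_self (x₀ : Torus) (ξ : Fin 2 → ℤ) : expWave x₀ ξ x₀ = 1 := by
  simp [expWave_apply]

lemma norm_expWave_apply (x₀ : Torus) (ξ : Fin 2 → ℤ) (x : Torus) :
    ‖expWave x₀ ξ x‖ = 1 := by
  rw [expWave_apply, norm_prod]
  exact Finset.prod_eq_one fun j _ => Circle.norm_coe _

lemma expWave_translate (x₀ : Torus) (ξ : Fin 2 → ℤ) (x a : Torus) :
    expWave x₀ ξ (x + a) = expWave x₀ ξ x * expWave 0 ξ a := by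
  simp only [expWave_apply, ← Finset.prod_mul_distrib, fourier_apply]
  refine Finset.prod_congr rfl fun j _ => ?_
  rw [← Circle.coe_mul, ← AddCircle.toCircle_add, ← smul_add]
  congr 3
  simp; abel

instance : normalizedVolume.IsAddHaarMeasure := by
  unfold normalizedVolume; infer_instance

lemma integral_fourier_sub (n : ℤ) (a : AddCircle (2 * Real.pi)) :
    ∫ t, fourier n (t - a) ∂AddCircle.haarAddCircle = if n = 0 then 1 else 0 := by
  rw [integral_sub_right_eq_self (fun t : AddCircle (2 * Real.pi) => (fourier n t : ℂ)) a]
  have h := (orthonormal_iff_ite.mp (orthonormal_fourier (T := 2 * Real.pi))) 0 n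
  simp only [ContinuousMap.inner_toLp, fourierLp] at h
  rw [show (if n = 0 then (1 : ℂ) else 0) = if 0 = n then 1 else 0 by simp [eq_comm], ← h]
  simp

lemma integral_expWave (x₀ : Torus) (ξ : Fin 2 → ℤ) :
    ∫ x, expWave x₀ ξ x ∂normalizedVolume = if ξ = 0 then 1 else 0 := by
  simp only [expWave_apply, normalizedVolume]
  rw [integral_fintype_prod_eq_prod (𝕜 := ℂ)
    (f := fun (j : Fin 2) (t : AddCircle (2 * Real.pi)) => (fourier (ξ j) (t - x₀ j) : ℂ))]
  simp only [integral_fourier_sub, Fin.prod_univ_two, funext_iff, Fin.forall_fin_two, Pi.zero_apply]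
  split_ifs <;> simp_all

lemma orthonormal_waveLp (x₀ : Torus) : Orthonormal ℂ (waveLp x₀) := by
  rw [orthonormal_iff_ite]
  intro ξ η
  simp only [waveLp, ContinuousMap.inner_toLp]
  simp only [← expWave_neg, ← expWave_add, integral_expWave]
  simp [add_neg_eq_zero, eq_comm]

lemma span_expWave_closure_eq_top (x₀ : Torus) :
    (Submodule.span ℂ (Set.range (expWave x₀))).topologicalClosure = ⊤ := by
  let A : StarSubalgebra ℂ C(Torus, ℂ) :=
    { toSubalgebra := Algebra.adjoin ℂ (Set.range (expWave x₀))
      star_mem' := by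
        change Algebra.adjoin ℂ (Set.range (expWave x₀)) ≤
          star (Algebra.adjoin ℂ (Set.range (expWave x₀)))
        refine Algebra.adjoin_le ?_
        rintro _ ⟨ξ, rfl⟩
        refine Algebra.subset_adjoin ⟨-ξ, ?_⟩
        ext1 x
        simp only [expWave_neg, starRingEnd_apply, ContinuousMap.star_apply] }
  have hA : A.toSubalgebra.toSubmodule = Submodule.span ℂ (Set.range (expWave x₀)) := by
    apply Algebra.adjoin_eq_span_of_subset
    refine .trans (fun x ↦ Submonoid.closure_induction (fun _ ↦ id) ⟨0, ?_⟩ ?_)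
      Submodule.subset_span
    · ext z
      exact expWave_zero x₀ z
    · rintro _ _ _ _ ⟨ξ, rfl⟩ ⟨η, rfl⟩
      refine ⟨ξ + η, ?_⟩
      ext z
      exact expWave_add x₀ ξ η z
  have hsep : A.SeparatesPoints := by
    intro x y hxy
    rw [Ne, funext_iff, not_forall] at hxy
    obtain ⟨i, hi⟩ := hxy
    refine ⟨_, ⟨expWave x₀ (Pi.single i 1), Algebra.subset_adjoin ⟨Pi.single i 1, rfl⟩, rfl⟩, ?_⟩
    have key : ∀ z : Torus, expWave x₀ (Pi.single i 1) z = fourier 1 (z i - x₀ i) := by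
      intro z
      rw [expWave_apply, Finset.prod_eq_single i]
      · simp
      · intro j _ hj
        simp [Pi.single_eq_of_ne hj]
      · simp
    dsimp only
    rw [key, key, fourier_one, fourier_one]
    intro h
    exact hi (sub_left_injective
      (AddCircle.injective_toCircle Real.two_pi_pos.ne' (Circle.coe_injective h)))
  rw [← hA]
  exact congr_arg (Subalgebra.toSubmodule <| StarSubalgebra.toSubalgebra ·)
    (ContinuousMap.starSubalgebra_topologicalClosure_eq_top_of_separatesPoints A hsep)

lemma span_waveLp_closure_eq_top (x₀ : Torus) :
    (Submodule.span ℂ (Set.range (waveLp x₀))).topologicalClosure = ⊤ := by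
  have h := (ContinuousMap.toLp_denseRange ℂ normalizedVolume ℂ
    (p := 2) (by simp)).topologicalClosure_map_submodule (span_expWave_closure_eq_top x₀)
  rw [Submodule.map_span, ← Set.range_comp] at h
  exact h

/-- The exponentials `expWave x₀ ξ` as a Hilbert basis of `L²` of the torus. -/
def waveBasis (x₀ : Torus) : HilbertBasis (Fin 2 → ℤ) ℂ L2Torus :=
  HilbertBasis.mk (orthonormal_waveLp x₀) (span_waveLp_closure_eq_top x₀).ge

lemma coe_waveBasis (x₀ : Torus) : ⇑(waveBasis x₀) = waveLp x₀ := HilbertBasis.coe_mk _ _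

lemma hasSum_wave (x₀ : Torus) (f : L2Torus) :
    HasSum (fun ξ => inner ℂ (waveLp x₀ ξ) f • waveLp x₀ ξ) f := by
  simpa [HilbertBasis.repr_apply_apply, coe_waveBasis] using (waveBasis x₀).hasSum_repr f

lemma ext_wave (x₀ : Torus) {f g : L2Torus}
    (h : ∀ ξ, inner ℂ (waveLp x₀ ξ) f = inner ℂ (waveLp x₀ ξ) g) : f = g :=
  (hasSum_wave x₀ f).unique (by simpa only [h] using hasSum_wave x₀ g)

lemma hasSum_conj_mul (x₀ : Torus) (f g : L2Torus) :
    HasSum (fun ξ => conj (inner ℂ (waveLp x₀ ξ) f) * inner ℂ (waveLp x₀ ξ) g) (inner ℂ f g) := by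
  have h := (waveBasis x₀).hasSum_inner_mul_inner f g
  simpa only [coe_waveBasis, inner_conj_symm] using h

lemma summable_norm_sq_inner (x₀ : Torus) (f : L2Torus) :
    Summable fun ξ => ‖inner ℂ (waveLp x₀ ξ) f‖ ^ 2 :=
  (orthonormal_waveLp x₀).inner_products_summable f

/-- A square-summable family of coefficients defines an element of `L²`. -/
lemma hasSum_smul_wave (x₀ : Torus) {c : (Fin 2 → ℤ) → ℂ} (hc : Summable fun ξ => ‖c ξ‖ ^ 2) :
    HasSum (fun ξ => c ξ • waveLp x₀ ξ) (∑' ξ, c ξ • waveLp x₀ ξ) := by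
  have hmem : Memℓp c 2 := by
    refine memℓp_gen ?_
    simpa using hc
  have h := (waveBasis x₀).hasSum_repr_symm ⟨c, hmem⟩
  simp only [coe_waveBasis] at h
  exact h.summable.hasSum

lemma inner_tsum_wave (x₀ : Torus) {c : (Fin 2 → ℤ) → ℂ} (hc : Summable fun ξ => ‖c ξ‖ ^ 2)
    (ξ : Fin 2 → ℤ) : inner ℂ (waveLp x₀ ξ) (∑' η, c η • waveLp x₀ η) = c ξ := by
  have h := (hasSum_smul_wave x₀ hc).mapL (innerSL ℂ (waveLp x₀ ξ))
  simp only [innerSL_apply_apply, inner_smul_right,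
    orthonormal_iff_ite.1 (orthonormal_waveLp x₀)] at h
  refine h.unique ?_
  refine (hasSum_ite_eq ξ (c ξ)).congr_fun fun η => ?_
  by_cases hη : η = ξ
  · simp [hη]
  · simp [hη, Ne.symm hη]

/-! ### Lattice sums and Green's function -/

lemma normSq_nonneg (ξ : Fin 2 → ℤ) : 0 ≤ normSq ξ :=
  Finset.sum_nonneg fun _ _ => sq_nonneg _

lemma normSq_zero : normSq 0 = 0 := by simp [normSq]

lemma sq_norm_le_normSq (ξ : Fin 2 → ℤ) : ‖ξ‖ ^ 2 ≤ normSq ξ := by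
  have h : ‖ξ‖ ≤ √(normSq ξ : ℝ) := by
    rw [pi_norm_le_iff_of_nonneg (Real.sqrt_nonneg _)]
    intro j
    apply Real.le_sqrt_of_sq_le
    rw [Int.norm_eq_abs, sq_abs]
    have : (ξ j) ^ 2 ≤ normSq ξ :=
      Finset.single_le_sum (f := fun j => ξ j ^ 2) (fun _ _ => sq_nonneg _) (Finset.mem_univ j)
    exact_mod_cast this
  have h0 : (0 : ℝ) ≤ normSq ξ := by exact_mod_cast normSq_nonneg ξ
  exact (Real.le_sqrt (norm_nonneg _) h0).1 h

lemma summable_one_add_normSq_rpow {s : ℝ} (hs : 1 < s) :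
    Summable fun ξ : Fin 2 → ℤ => (1 + (normSq ξ : ℝ)) ^ (-s) := by
  have h := EisensteinSeries.summable_one_div_norm_rpow (k := 2 * s) (by linarith)
  refine Summable.of_norm_bounded_eventually h ?_
  have : ∀ᶠ ξ : Fin 2 → ℤ in cofinite, ξ ≠ 0 := by
    simp
  filter_upwards [this] with ξ hξ
  have hpos : 0 < ‖ξ‖ := norm_pos_iff.2 hξ
  have h0 : (0 : ℝ) ≤ normSq ξ := by exact_mod_cast normSq_nonneg ξ
  rw [Real.norm_of_nonneg (by positivity), show -(2 * s) = 2 * (-s) by ring,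
    Real.rpow_mul hpos.le]
  apply Real.rpow_le_rpow_of_nonpos (by positivity)
  · have := sq_norm_le_normSq ξ
    norm_num
    linarith
  · linarith

lemma summable_inv_one_add_normSq_sq :
    Summable fun ξ : Fin 2 → ℤ => ((1 + (normSq ξ : ℝ)) ^ 2)⁻¹ := by
  refine (summable_one_add_normSq_rpow (s := 2) (by norm_num)).congr fun ξ => ?_
  have h0 : (0 : ℝ) ≤ normSq ξ := by exact_mod_cast normSq_nonneg ξ
  rw [Real.rpow_neg (by linarith)]
  norm_num

lemma eventually_normSq_ge (R : ℝ) : ∀ᶠ ξ : Fin 2 → ℤ in cofinite, R ≤ normSq ξ := by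
  have h := summable_inv_one_add_normSq_sq.tendsto_cofinite_zero
  have hR : (0 : ℝ) < ((1 + |R|) ^ 2)⁻¹ := by positivity
  filter_upwards [h.eventually (gt_mem_nhds hR)] with ξ hξ
  have h0 : (0 : ℝ) ≤ normSq ξ := by exact_mod_cast normSq_nonneg ξ
  have h1 := lt_of_pow_lt_pow_left₀ 2 (by positivity)
    ((inv_lt_inv₀ (by positivity) (by positivity)).1 hξ)
  linarith [le_abs_self R]

/-- All resolvent factors `1 / (|ξ|² - z)` are `O (1 / (1 + |ξ|²))`, uniformly for bounded `z`
up to finitely many `ξ`. -/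
lemma eventually_norm_resolvent_le (R : ℝ) : ∀ᶠ ξ : Fin 2 → ℤ in cofinite, ∀ z : ℂ, ‖z‖ ≤ R →
    ‖1 / ((normSq ξ : ℂ) - z)‖ ≤ 2 * (1 + (normSq ξ : ℝ))⁻¹ := by
  filter_upwards [eventually_normSq_ge (2 * R + 1)] with ξ hξ z hz
  have h0 : (0 : ℝ) ≤ normSq ξ := by exact_mod_cast normSq_nonneg ξ
  have h1 : (1 + (normSq ξ : ℝ)) / 2 ≤ ‖(normSq ξ : ℂ) - z‖ := by
    have := norm_sub_norm_le (normSq ξ : ℂ) z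
    have h2 : ‖(normSq ξ : ℂ)‖ = (normSq ξ : ℝ) := by
      rw [Complex.norm_intCast, abs_of_nonneg h0]
    linarith
  rw [norm_div, norm_one, one_div]
  calc ‖(normSq ξ : ℂ) - z‖⁻¹ ≤ ((1 + (normSq ξ : ℝ)) / 2)⁻¹ := by
        apply inv_anti₀ (by positivity) h1
    _ = _ := by field_simp

lemma summable_norm_sq_resolvent (z : ℂ) :
    Summable fun ξ : Fin 2 → ℤ => ‖1 / ((normSq ξ : ℂ) - z)‖ ^ 2 := by
  refine Summable.of_norm_bounded_eventually (summable_inv_one_add_normSq_sq.mul_left 4) ?_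
  filter_upwards [eventually_norm_resolvent_le ‖z‖] with ξ hξ
  have h0 : (0 : ℝ) ≤ normSq ξ := by exact_mod_cast normSq_nonneg ξ
  rw [Real.norm_of_nonneg (by positivity)]
  calc ‖1 / ((normSq ξ : ℂ) - z)‖ ^ 2 ≤ (2 * (1 + (normSq ξ : ℝ))⁻¹) ^ 2 := by
        gcongr; exact hξ z le_rfl
    _ = _ := by rw [mul_pow, inv_pow]; norm_num

lemma inner_wave_green (x₀ : Torus) (z : ℂ) (ξ : Fin 2 → ℤ) :
    inner ℂ (waveLp x₀ ξ) (green x₀ z) = 1 / ((normSq ξ : ℂ) - z) :=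
  inner_tsum_wave x₀ (summable_norm_sq_resolvent z) ξ

/-! ### Calculus on the torus -/

lemma isOpenQuotientMap_proj : IsOpenQuotientMap proj := by
  have h : IsOpenQuotientMap (fun y : Fin 2 → ℝ => fun j => (y j : AddCircle (2 * Real.pi))) :=
    IsOpenQuotientMap.piMap fun _ => QuotientAddGroup.isOpenQuotientMap_mk
  exact h.comp (EuclideanSpace.equiv (Fin 2) ℝ).toHomeomorph.isOpenQuotientMap

lemma exists_proj_eq (x : Torus) : ∃ y, proj y = x := isOpenQuotientMap_proj.surjective x

lemma continuous_of_proj {X : Type*} [TopologicalSpace X] {U : Torus → X}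
    (h : Continuous fun y => U (proj y)) : Continuous U :=
  isOpenQuotientMap_proj.isQuotientMap.continuous_iff.2 h

/-- The translation vector of length `t` in the `j`-th coordinate direction of the torus. -/
def step (j : Fin 2) (t : ℝ) : Torus := Pi.single j (t : AddCircle (2 * Real.pi))

lemma proj_add_smul_single (y : EuclideanSpace ℝ (Fin 2)) (j : Fin 2) (t : ℝ) :
    proj (y + t • EuclideanSpace.single j 1) = proj y + step j t := by
  ext k
  by_cases hk : k = j
  · subst hk; simp [proj, step]
  · simp [proj, step, hk]

lemma step_add (j : Fin 2) (s t : ℝ) : step j (s + t) = step j s + step j t := by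
  simp [step, Pi.single_add]

lemma step_zero (j : Fin 2) : step j 0 = 0 := by simp [step]

lemma continuous_step (j : Fin 2) : Continuous (step j) :=
  (continuous_single j).comp (AddCircle.continuous_mk' _)

lemma expWave_step (ξ : Fin 2 → ℤ) (j : Fin 2) (t : ℝ) :
    expWave 0 ξ (step j t) = Complex.exp (Complex.I * ξ j * t) := by
  rw [expWave_apply, Finset.prod_eq_single j]
  · simp only [step, Pi.single_eq_same, Pi.zero_apply, sub_zero, fourier_coe_apply]
    congr 1
    have : (Real.pi : ℂ) ≠ 0 := by exact_mod_cast Real.pi_ne_zero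
    push_cast
    field_simp
  · intro k _ hk
    simp [step, Pi.single_eq_of_ne hk]
  · simp

/-- A function on the torus is smooth if its periodic lift to the plane is. -/
def IsSmooth (U : Torus → ℂ) : Prop :=
  ContDiff ℝ ((⊤ : ℕ∞) : WithTop ℕ∞) (fun y => U (proj y))

/-- The partial derivative in the `j`-th coordinate direction of a function on the torus. -/
def dirDeriv (j : Fin 2) (U : Torus → ℂ) (x : Torus) : ℂ :=
  deriv (fun t : ℝ => U (x + step j t)) 0

lemma IsSmooth.continuous {U : Torus → ℂ} (hU : IsSmooth U) : Continuous U :=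
  continuous_of_proj (ContDiff.continuous hU)

lemma IsSmooth.hasDerivAt {U : Torus → ℂ} (hU : IsSmooth U) (j : Fin 2)
    (y : EuclideanSpace ℝ (Fin 2)) :
    HasDerivAt (fun t : ℝ => U (proj y + step j t))
      (fderiv ℝ (fun y => U (proj y)) y (EuclideanSpace.single j 1)) 0 := by
  have h1 : HasFDerivAt (fun y => U (proj y)) (fderiv ℝ (fun y => U (proj y)) y)
      (y + (0 : ℝ) • EuclideanSpace.single j (1 : ℝ)) := by
    rw [zero_smul, add_zero]
    exact (ContDiff.differentiable hU (by simp) y).hasFDerivAt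
  have h2 : HasDerivAt (fun t : ℝ => y + t • EuclideanSpace.single j (1 : ℝ))
      (EuclideanSpace.single j (1 : ℝ)) 0 := by
    simpa using ((hasDerivAt_id (0 : ℝ)).smul_const (EuclideanSpace.single j (1 : ℝ))).const_add y
  have h3 := h1.comp_hasDerivAt (0 : ℝ) h2
  simpa only [Function.comp_def, proj_add_smul_single] using h3

lemma IsSmooth.dirDeriv_proj {U : Torus → ℂ} (hU : IsSmooth U) (j : Fin 2)
    (y : EuclideanSpace ℝ (Fin 2)) :
    dirDeriv j U (proj y) = fderiv ℝ (fun y => U (proj y)) y (EuclideanSpace.single j 1) :=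
  (hU.hasDerivAt j y).deriv

lemma IsSmooth.hasDerivAt_step {U : Torus → ℂ} (hU : IsSmooth U) (j : Fin 2) (x : Torus) (t : ℝ) :
    HasDerivAt (fun t : ℝ => U (x + step j t)) (dirDeriv j U (x + step j t)) t := by
  obtain ⟨y, hy⟩ := exists_proj_eq (x + step j t)
  have h := hU.hasDerivAt j y
  rw [← hU.dirDeriv_proj, hy] at h
  have h' := HasDerivAt.comp_sub_const t t (by simpa using h)
  refine h'.congr_of_eventuallyEq (Eventually.of_forall fun s => ?_)
  simp only [add_assoc, ← step_add]
  congr 3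
  ring

lemma IsSmooth.dirDeriv {U : Torus → ℂ} (hU : IsSmooth U) (j : Fin 2) :
    IsSmooth (dirDeriv j U) := by
  unfold IsSmooth
  simp_rw [hU.dirDeriv_proj]
  exact (ContDiff.fderiv_right hU (by simp)).clm_apply contDiff_const

lemma IsSmooth.laplacian {U : Torus → ℂ} (hU : IsSmooth U) (y : EuclideanSpace ℝ (Fin 2)) :
    Laplacian.laplacian (fun y => U (proj y)) y
      = ∑ j, PointScatterer.dirDeriv j (PointScatterer.dirDeriv j U) (proj y) := by
  rw [InnerProductSpace.laplacian_eq_iteratedFDeriv_orthonormalBasis _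
    (EuclideanSpace.basisFun (Fin 2) ℝ)]
  refine Finset.sum_congr rfl fun j _ => ?_
  rw [(hU.dirDeriv j).dirDeriv_proj, iteratedFDeriv_two_apply]
  simp_rw [hU.dirDeriv_proj]
  have h : DifferentiableAt ℝ (fderiv ℝ fun y => U (proj y)) y :=
    (ContDiff.fderiv_right (m := 1) hU (WithTop.coe_le_coe.2 le_top)).differentiable (by simp) y
  rw [fderiv_clm_apply h (differentiableAt_const _)]
  simp

lemma Continuous.integrable_torus {E : Type*} [NormedAddCommGroup E] {U : Torus → E}
    (hU : Continuous U) :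
    Integrable U normalizedVolume :=
  hU.integrable_of_hasCompactSupport (HasCompactSupport.of_compactSpace U)

/-- Integration by parts, obtained by differentiating in the translation parameter. -/
lemma IsSmooth.integral_dirDeriv {U : Torus → ℂ} (hU : IsSmooth U) (x₀ : Torus) (ξ : Fin 2 → ℤ)
    (j : Fin 2) :
    ∫ x, conj (expWave x₀ ξ x) * PointScatterer.dirDeriv j U x ∂normalizedVolume
      = Complex.I * ξ j * ∫ x, conj (expWave x₀ ξ x) * U x ∂normalizedVolume := by
  have hc : Continuous (PointScatterer.dirDeriv j U) := (hU.dirDeriv j).continuous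
  have hcU := hU.continuous
  have hstep := continuous_step j
  obtain ⟨C, hC⟩ := isCompact_univ.exists_bound_of_continuousOn hc.continuousOn
  have hF : ∀ t : ℝ, ∫ x, conj (expWave x₀ ξ x) * U (x + step j t) ∂normalizedVolume
      = Complex.exp (Complex.I * ξ j * t)
        * ∫ x, conj (expWave x₀ ξ x) * U x ∂normalizedVolume := by
    intro t
    rw [← integral_const_mul, ← integral_add_right_eq_self
      (fun x => Complex.exp (Complex.I * ξ j * t) * (conj (expWave x₀ ξ x) * U x)) (step j t)]
    refine integral_congr_ae (Eventually.of_forall fun x => ?_)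
    simp only [expWave_translate, map_mul, ← expWave_step]
    have h1 : expWave 0 ξ (step j t) * conj (expWave 0 ξ (step j t)) = 1 := by
      rw [Complex.mul_conj, Complex.normSq_eq_norm_sq, norm_expWave_apply]; simp
    linear_combination (-(conj (expWave x₀ ξ x)) * U (x + step j t)) * h1
  have hd := (hasDerivAt_integral_of_dominated_loc_of_deriv_le (μ := normalizedVolume)
    (F := fun (t : ℝ) x => conj (expWave x₀ ξ x) * U (x + step j t))
    (F' := fun (t : ℝ) x => conj (expWave x₀ ξ x) * PointScatterer.dirDeriv j U (x + step j t))
    (x₀ := (0 : ℝ)) (s := Set.univ) (bound := fun _ => C) univ_mem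
    (Eventually.of_forall fun t => (by fun_prop : Continuous _).aestronglyMeasurable)
    (Continuous.integrable_torus (by fun_prop))
    (by fun_prop : Continuous _).aestronglyMeasurable
    (Eventually.of_forall fun x t _ => by
      rw [norm_mul, RCLike.norm_conj, norm_expWave_apply, one_mul]; exact hC _ (Set.mem_univ _))
    (integrable_const _)
    (Eventually.of_forall fun x t _ => (hU.hasDerivAt_step j x t).const_mul _)).2
  have hd2 : HasDerivAt (fun t : ℝ => Complex.exp (Complex.I * ξ j * t)
      * ∫ x, conj (expWave x₀ ξ x) * U x ∂normalizedVolume)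
      (Complex.I * ξ j * ∫ x, conj (expWave x₀ ξ x) * U x ∂normalizedVolume) 0 := by
    have h1 : HasDerivAt (fun t : ℝ => Complex.I * ξ j * (t : ℂ)) (Complex.I * ξ j) 0 := by
      simpa using (Complex.ofRealCLM.hasDerivAt (x := (0 : ℝ))).const_mul (Complex.I * (ξ j : ℂ))
    simpa using h1.cexp.mul_const _
  simp_rw [hF] at hd
  simpa [step_zero] using hd.unique hd2

/-! ### Fourier coefficients on the domain of the minimal operator -/

lemma inner_wave_eq_integral (x₀ : Torus) (ξ : Fin 2 → ℤ) {f : L2Torus} {U : Torus → ℂ}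
    (hf : f =ᵐ[normalizedVolume] U) :
    inner ℂ (waveLp x₀ ξ) f = ∫ x, conj (expWave x₀ ξ x) * U x ∂normalizedVolume := by
  rw [L2.inner_def]
  refine integral_congr_ae ?_
  filter_upwards [hf, ContinuousMap.coeFn_toLp (p := 2) (𝕜 := ℂ) normalizedVolume (expWave x₀ ξ)]
    with x hx hx'
  simp only [waveLp, hx, hx', RCLike.inner_apply]
  ring

lemma inner_wave_of_mem_minimalGraph {x₀ : Torus} {p : L2Torus × L2Torus}
    (hp : p ∈ minimalGraph x₀) (ξ : Fin 2 → ℤ) :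
    inner ℂ (waveLp x₀ ξ) p.2 = normSq ξ * inner ℂ (waveLp x₀ ξ) p.1 := by
  obtain ⟨U, V, hU, -, hV, h1, h2⟩ := hp
  have hU' : IsSmooth U := hU
  have hV' : V = fun x => -∑ j, dirDeriv j (dirDeriv j U) x := by
    ext x
    obtain ⟨y, rfl⟩ := exists_proj_eq x
    rw [hV y, hU'.laplacian]
  rw [inner_wave_eq_integral x₀ ξ h1, inner_wave_eq_integral x₀ ξ h2, hV']
  have hint : ∀ j, Integrable (fun x => conj (expWave x₀ ξ x) * dirDeriv j (dirDeriv j U) x)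
      normalizedVolume := fun j => by
    have := ((hU'.dirDeriv j).dirDeriv j).continuous
    exact Continuous.integrable_torus (by fun_prop)
  simp only [mul_neg, integral_neg, Finset.mul_sum]
  rw [integral_finsetSum _ fun j _ => hint j]
  simp only [(hU'.dirDeriv _).integral_dirDeriv, hU'.integral_dirDeriv]
  simp only [normSq, Fin.sum_univ_two]
  push_cast
  linear_combination (-(ξ 0 : ℂ) ^ 2 - (ξ 1 : ℂ) ^ 2) *
    (∫ x, conj (expWave x₀ ξ x) * U x ∂normalizedVolume) * Complex.I_sq

lemma conj_resolvent_I (n : ℤ) : conj (1 / ((n : ℂ) - Complex.I)) * (n + Complex.I) = 1 := by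
  have h : (n : ℂ) + Complex.I ≠ 0 := by
    intro h; simpa using congrArg Complex.im h
  simp only [map_div₀, map_one, map_sub, Complex.conj_I, map_intCast, sub_neg_eq_add]
  field_simp

/-- A function in the domain of the minimal operator vanishes at `x₀`, so its Fourier coefficients
sum to zero; expressed as orthogonality to `G_i`, this passes to the closure. -/
lemma inner_green_of_mem_minimalGraph {x₀ : Torus} {p : L2Torus × L2Torus}
    (hp : p ∈ minimalGraph x₀) :
    inner ℂ (green x₀ Complex.I) (p.2 + Complex.I • p.1) = 0 := by
  have hs := hasSum_conj_mul x₀ (green x₀ Complex.I) (p.2 + Complex.I • p.1)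
  have hterm : ∀ ξ, conj (inner ℂ (waveLp x₀ ξ) (green x₀ Complex.I)) *
      inner ℂ (waveLp x₀ ξ) (p.2 + Complex.I • p.1) = inner ℂ (waveLp x₀ ξ) p.1 := by
    intro ξ
    rw [inner_wave_green, inner_add_right, inner_smul_right, inner_wave_of_mem_minimalGraph hp,
      ← add_mul, ← mul_assoc, conj_resolvent_I, one_mul]
  simp only [hterm] at hs
  obtain ⟨U, V, hU, hU0, hV, h1, h2⟩ := hp
  have hUc : Continuous U := IsSmooth.continuous hU
  let u : C(Torus, ℂ) := ⟨U, hUc⟩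
  have hu : ContinuousMap.toLp (E := ℂ) 2 normalizedVolume ℂ u = p.1 := by
    apply Lp.ext
    exact (ContinuousMap.coeFn_toLp normalizedVolume u).trans h1.symm
  have hsum : HasSum (fun ξ => inner ℂ (waveLp x₀ ξ) p.1 • expWave x₀ ξ) u := by
    refine ContinuousMap.hasSum_of_hasSum_Lp (μ := normalizedVolume) (p := 2) (𝕜 := ℂ)
      (.of_norm ?_) ?_
    · refine hs.summable.norm.of_nonneg_of_le (fun _ => norm_nonneg _) fun ξ => ?_
      rw [norm_smul]
      refine mul_le_of_le_one_right (norm_nonneg _) ?_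
      exact (ContinuousMap.norm_le _ zero_le_one).2 fun x => (norm_expWave_apply x₀ ξ x).le
    · rw [hu]
      refine (hasSum_wave x₀ p.1).congr_fun fun ξ => ?_
      simp only [Function.comp_apply, map_smul]
      rfl
  have hev := hsum.mapL (ContinuousMap.evalCLM ℂ x₀)
  simp only [ContinuousMap.evalCLM_apply, ContinuousMap.smul_apply, expWave_self, smul_eq_mul,
    mul_one] at hev
  rw [hs.unique hev]
  exact hU0.self_of_nhds

lemma inner_wave_of_mem_closure {x₀ : Torus} {p : L2Torus × L2Torus}
    (hp : p ∈ (minimalGraph x₀).topologicalClosure) (ξ : Fin 2 → ℤ) :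
    inner ℂ (waveLp x₀ ξ) p.2 = normSq ξ * inner ℂ (waveLp x₀ ξ) p.1 := by
  have hclosed : IsClosed {p : L2Torus × L2Torus |
      inner ℂ (waveLp x₀ ξ) p.2 = normSq ξ * inner ℂ (waveLp x₀ ξ) p.1} :=
    isClosed_eq (by fun_prop) (by fun_prop)
  exact closure_minimal (fun q hq => inner_wave_of_mem_minimalGraph hq ξ) hclosed hp

lemma inner_green_of_mem_closure {x₀ : Torus} {p : L2Torus × L2Torus}
    (hp : p ∈ (minimalGraph x₀).topologicalClosure) :
    inner ℂ (green x₀ Complex.I) (p.2 + Complex.I • p.1) = 0 := by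
  have hclosed : IsClosed {p : L2Torus × L2Torus |
      inner ℂ (green x₀ Complex.I) (p.2 + Complex.I • p.1) = 0} :=
    isClosed_eq (by fun_prop) (by fun_prop)
  exact closure_minimal (fun q hq => inner_green_of_mem_minimalGraph hq) hclosed hp

/-- The Fourier coefficients of an element of the domain of the closure are summable, with
vanishing sum. -/
lemma hasSum_inner_of_mem_closure {x₀ : Torus} {p : L2Torus × L2Torus}
    (hp : p ∈ (minimalGraph x₀).topologicalClosure) :
    HasSum (fun ξ => inner ℂ (waveLp x₀ ξ) p.1) 0 := by
  have hs := hasSum_conj_mul x₀ (green x₀ Complex.I) (p.2 + Complex.I • p.1)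
  rw [inner_green_of_mem_closure hp] at hs
  refine hs.congr_fun fun ξ => ?_
  rw [inner_wave_green, inner_add_right, inner_smul_right, inner_wave_of_mem_closure hp,
    ← add_mul, ← mul_assoc, conj_resolvent_I, one_mul]

/-! ### Cutting off near the scatterer -/

/-- A continuous linear functional that separates a point from a submodule can be taken to vanish
on the submodule. -/
lemma exists_dual_of_notMem_closure {E : Type*} [NormedAddCommGroup E] [NormedSpace ℂ E]
    {M : Submodule ℂ E} {x : E} (hx : x ∉ M.topologicalClosure) :
    ∃ f : StrongDual ℂ E, (∀ a ∈ M, f a = 0) ∧ f x ≠ 0 := by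
  obtain ⟨f, u, hu, hux⟩ := RCLike.geometric_hahn_banach_closed_point (𝕜 := ℂ)
    (M.topologicalClosure.restrictScalars ℝ).convex M.isClosed_topologicalClosure hx
  have hu0 : 0 < u := by simpa using hu 0 (zero_mem _)
  refine ⟨f, fun a ha => ?_, fun h => ?_⟩
  · by_contra hfa
    have h1 := hu (((u : ℂ) / f a) • a)
      (M.topologicalClosure.smul_mem _ (M.le_topologicalClosure ha))
    rw [map_smul, smul_eq_mul, div_mul_cancel₀ _ hfa] at h1
    simp at h1
  · rw [h] at hux
    simp at hux
    linarith

/-- An `L²` function of size `B` supported on a set `A` pairs with `p` to at most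
`η B² μ(A) + η⁻¹ ∫_A |p|²`. -/
lemma norm_inner_le_of_support {p w : L2Torus} {A : Set Torus} (hA : MeasurableSet A) {B η : ℝ}
    (hη : 0 < η) (hw : ∀ᵐ x ∂normalizedVolume, x ∉ A → w x = 0)
    (hB : ∀ᵐ x ∂normalizedVolume, ‖w x‖ ≤ B) :
    ‖inner ℂ p w‖ ≤ η * B ^ 2 * normalizedVolume.real A
      + η⁻¹ * ∫ x in A, ‖p x‖ ^ 2 ∂normalizedVolume := by
  have hp : Integrable (fun x => ‖p x‖ ^ 2) normalizedVolume :=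
    (memLp_two_iff_integrable_sq_norm (Lp.aestronglyMeasurable p)).1 (Lp.memLp p)
  have hB' : Integrable (A.indicator fun _ : Torus => η * B ^ 2) normalizedVolume :=
    (integrable_const _).indicator hA
  have hpA : Integrable (A.indicator fun x => η⁻¹ * ‖p x‖ ^ 2) normalizedVolume :=
    (hp.const_mul _).indicator hA
  rw [L2.inner_def]
  calc ‖∫ x, inner ℂ (p x) (w x) ∂normalizedVolume‖
      ≤ ∫ x, A.indicator (fun _ : Torus => η * B ^ 2) x
        + A.indicator (fun x => η⁻¹ * ‖p x‖ ^ 2) x ∂normalizedVolume := by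
        refine norm_integral_le_of_norm_le (hB'.add hpA) ?_
        filter_upwards [hw, hB] with x hx hxB
        by_cases hxA : x ∈ A
        · simp only [Set.indicator_of_mem hxA]
          refine (norm_inner_le_norm _ _).trans ?_
          have h1 : η * ‖w x‖ ^ 2 ≤ η * B ^ 2 := by gcongr
          have h2 : 0 ≤ η⁻¹ * (η * ‖w x‖ - ‖p x‖) ^ 2 := by positivity
          have h3 : η⁻¹ * (η * ‖w x‖ - ‖p x‖) ^ 2
              = η * ‖w x‖ ^ 2 - 2 * (‖p x‖ * ‖w x‖) + η⁻¹ * ‖p x‖ ^ 2 := by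
            field_simp; ring
          have h4 : 0 ≤ ‖p x‖ * ‖w x‖ := by positivity
          linarith
        · simp [hx hxA, hxA]
    _ = _ := by
        rw [integral_add hB' hpA, integral_indicator hA, integral_indicator hA,
          setIntegral_const, integral_const_mul, smul_eq_mul]
        ring

/-- Coordinatewise phase `exp (i (x_j - x₀_j))`. -/
def phase (x₀ : Torus) (j : Fin 2) (x : Torus) : ℂ := expWave x₀ (Pi.single j 1) x

/-- A smooth periodic substitute `∑ (1 - cos (x_j - x₀_j))` for half the squared distance
to `x₀`. -/
def sqDist (x₀ x : Torus) : ℝ := ∑ j, (1 - (phase x₀ j x).re)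

lemma expWave_proj (a y : EuclideanSpace ℝ (Fin 2)) (ξ : Fin 2 → ℤ) :
    expWave (proj a) ξ (proj y) = Complex.exp (Complex.I * ∑ j, ξ j * ((y j - a j : ℝ) : ℂ)) := by
  rw [Finset.mul_sum, Complex.exp_sum, expWave_apply]
  refine Finset.prod_congr rfl fun j _ => ?_
  have : (Real.pi : ℂ) ≠ 0 := by exact_mod_cast Real.pi_ne_zero
  simp only [proj, ← AddCircle.coe_sub, fourier_coe_apply]
  congr 1
  push_cast
  field_simp

lemma phase_proj (a y : EuclideanSpace ℝ (Fin 2)) (j : Fin 2) :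
    phase (proj a) j (proj y) = Complex.exp (((y j - a j : ℝ) : ℂ) * Complex.I) := by
  rw [phase, expWave_proj]
  congr 1
  rw [Finset.sum_eq_single j]
  · simp [mul_comm]
  · intro k _ hk; simp [hk]
  · simp

lemma sqDist_proj (a y : EuclideanSpace ℝ (Fin 2)) :
    sqDist (proj a) (proj y) = ∑ j, (1 - Real.cos (y j - a j)) := by
  simp only [sqDist, phase_proj, Complex.exp_ofReal_mul_I_re]

lemma norm_phase (x₀ : Torus) (j : Fin 2) (x : Torus) : ‖phase x₀ j x‖ = 1 :=
  norm_expWave_apply _ _ _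

lemma phase_re_sq_add (x₀ : Torus) (j : Fin 2) (x : Torus) :
    (phase x₀ j x).re ^ 2 + (phase x₀ j x).im ^ 2 = 1 := by
  have h := norm_phase x₀ j x
  rw [← sq_eq_sq₀ (norm_nonneg _) zero_le_one, ← Complex.normSq_eq_norm_sq,
    Complex.normSq_apply] at h
  linarith

lemma phase_re_le (x₀ : Torus) (j : Fin 2) (x : Torus) : (phase x₀ j x).re ≤ 1 := by
  nlinarith [phase_re_sq_add x₀ j x, sq_nonneg (phase x₀ j x).im]

lemma neg_one_le_phase_re (x₀ : Torus) (j : Fin 2) (x : Torus) : -1 ≤ (phase x₀ j x).re := by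
  nlinarith [phase_re_sq_add x₀ j x, sq_nonneg (phase x₀ j x).im]

lemma one_sub_phase_re_le (x₀ : Torus) (j : Fin 2) (x : Torus) :
    1 - (phase x₀ j x).re ≤ sqDist x₀ x :=
  Finset.single_le_sum (f := fun j => 1 - (phase x₀ j x).re)
    (fun j _ => by linarith [phase_re_le x₀ j x]) (Finset.mem_univ j)

lemma sqDist_nonneg (x₀ x : Torus) : 0 ≤ sqDist x₀ x :=
  Finset.sum_nonneg fun j _ => by linarith [phase_re_le x₀ j x]

lemma phase_im_sq_le (x₀ : Torus) (j : Fin 2) (x : Torus) :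
    (phase x₀ j x).im ^ 2 ≤ 2 * sqDist x₀ x := by
  nlinarith [phase_re_sq_add x₀ j x, one_sub_phase_re_le x₀ j x, phase_re_le x₀ j x,
    neg_one_le_phase_re x₀ j x]

lemma norm_phase_sub_one_le (x₀ : Torus) (j : Fin 2) (x : Torus) :
    ‖phase x₀ j x - 1‖ ≤ √(2 * sqDist x₀ x) := by
  apply Real.le_sqrt_of_sq_le
  rw [← Complex.normSq_eq_norm_sq, Complex.normSq_apply]
  simp only [Complex.sub_re, Complex.sub_im, Complex.one_re, Complex.one_im, sub_zero]
  nlinarith [phase_re_sq_add x₀ j x, one_sub_phase_re_le x₀ j x]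

lemma norm_zpow_sub_one_le {z : ℂ} (hz : ‖z‖ = 1) (n : ℤ) : ‖z ^ n - 1‖ ≤ |(n : ℝ)| * ‖z - 1‖ := by
  have hz0 : z ≠ 0 := by rintro rfl; simp at hz
  have hnat : ∀ k : ℕ, ‖z ^ k - 1‖ ≤ k * ‖z - 1‖ := by
    intro k
    induction k with
    | zero => simp
    | succ k ih =>
      have : z ^ (k + 1) - 1 = z ^ k * (z - 1) + (z ^ k - 1) := by ring
      rw [this]
      refine (norm_add_le _ _).trans ?_
      rw [norm_mul, norm_pow, hz, one_pow, one_mul]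
      push_cast
      linarith
  obtain ⟨k, rfl | rfl⟩ := n.eq_nat_or_neg
  · simpa using hnat k
  · have h1 : z ^ (-(k : ℤ)) - 1 = -(z ^ (-(k : ℤ)) * (z ^ k - 1)) := by
      rw [mul_sub, mul_one, zpow_neg, zpow_natCast, inv_mul_cancel₀ (pow_ne_zero _ hz0)]
      ring
    rw [h1, norm_neg, norm_mul, norm_zpow, hz, one_zpow, one_mul]
    simpa using hnat k

lemma expWave_eq_phase (x₀ : Torus) (ξ : Fin 2 → ℤ) (x : Torus) :
    expWave x₀ ξ x = phase x₀ 0 x ^ ξ 0 * phase x₀ 1 x ^ ξ 1 := by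
  obtain ⟨a, rfl⟩ := exists_proj_eq x₀
  obtain ⟨y, rfl⟩ := exists_proj_eq x
  rw [expWave_proj, phase_proj, phase_proj, ← Complex.exp_int_mul, ← Complex.exp_int_mul,
    ← Complex.exp_add, Fin.sum_univ_two]
  congr 1
  push_cast
  ring

lemma norm_expWave_sub_one_le (x₀ : Torus) (ξ : Fin 2 → ℤ) (x : Torus) :
    ‖expWave x₀ ξ x - 1‖ ≤ (|(ξ 0 : ℝ)| + |(ξ 1 : ℝ)|) * √(2 * sqDist x₀ x) := by
  have h : expWave x₀ ξ x - 1
      = phase x₀ 0 x ^ ξ 0 * (phase x₀ 1 x ^ ξ 1 - 1) + (phase x₀ 0 x ^ ξ 0 - 1) := by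
    rw [expWave_eq_phase]; ring
  rw [h, add_mul]
  refine (norm_add_le _ _).trans ?_
  rw [norm_mul, norm_zpow, norm_phase, one_zpow, one_mul, add_comm]
  exact add_le_add
    ((norm_zpow_sub_one_le (norm_phase _ _ _) _).trans
      (mul_le_mul_of_nonneg_left (norm_phase_sub_one_le _ _ _) (abs_nonneg _)))
    ((norm_zpow_sub_one_le (norm_phase _ _ _) _).trans
      (mul_le_mul_of_nonneg_left (norm_phase_sub_one_le _ _ _) (abs_nonneg _)))

lemma continuous_phase (x₀ : Torus) (j : Fin 2) : Continuous (phase x₀ j) := by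
  unfold phase; fun_prop

lemma continuous_sqDist (x₀ : Torus) : Continuous (sqDist x₀) := by
  have := continuous_phase x₀
  unfold sqDist
  fun_prop

lemma haar_closedBall_le (x : AddCircle (2 * Real.pi)) {r : ℝ} (hr : 0 ≤ r) :
    (AddCircle.haarAddCircle : Measure (AddCircle (2 * Real.pi))).real (Metric.closedBall x r)
      ≤ r / Real.pi := by
  have h := AddCircle.volume_closedBall (T := 2 * Real.pi) (x := x) r
  have hpi := Real.pi_pos
  rw [AddCircle.volume_eq_smul_haarAddCircle] at h
  have h2 := congrArg ENNReal.toReal h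
  rw [Measure.smul_apply, smul_eq_mul, ENNReal.toReal_mul, ENNReal.toReal_ofReal (by positivity),
    ENNReal.toReal_ofReal (by positivity)] at h2
  rw [le_div_iff₀ hpi, Measure.real]
  have := min_le_right (2 * Real.pi) (2 * r)
  nlinarith

lemma norm_le_of_phase_re (x₀ x : Torus) (j : Fin 2) {δ : ℝ} (h : 1 - (phase x₀ j x).re ≤ 2 * δ) :
    ‖x j - x₀ j‖ ≤ Real.pi * √δ := by
  obtain ⟨a, rfl⟩ := exists_proj_eq x₀
  obtain ⟨y, rfl⟩ := exists_proj_eq x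
  have hpi := Real.pi_pos
  rw [phase_proj, Complex.exp_ofReal_mul_I_re] at h
  have hnorm : ‖proj y j - proj a j‖ = ‖((y j - a j : ℝ) : AddCircle (2 * Real.pi))‖ := by
    simp [proj]
  rw [hnorm]
  set b := y j - a j
  set m := round ((2 * Real.pi)⁻¹ * b)
  have hb : ‖((b : ℝ) : AddCircle (2 * Real.pi))‖ = |b - m * (2 * Real.pi)| := AddCircle.norm_eq _
  have hle : |b - m * (2 * Real.pi)| ≤ Real.pi := by
    rw [← hb]
    refine (AddCircle.norm_le_half_period _ (by positivity)).trans_eq ?_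
    rw [abs_of_pos (by positivity)]; ring
  have hcos := Real.cos_le_one_sub_mul_cos_sq hle
  rw [Real.cos_sub_int_mul_two_pi] at hcos
  have h3 : 2 / Real.pi ^ 2 * (b - m * (2 * Real.pi)) ^ 2 ≤ 2 * δ := by linarith
  have h4 : (b - m * (2 * Real.pi)) ^ 2 ≤ Real.pi ^ 2 * δ := by
    rw [div_mul_eq_mul_div, div_le_iff₀ (by positivity)] at h3
    linarith
  rw [hb]
  refine (Real.abs_le_sqrt h4).trans_eq ?_
  rw [Real.sqrt_mul (by positivity), Real.sqrt_sq hpi.le]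

lemma measure_sqDist_le (x₀ : Torus) {δ : ℝ} (hδ : 0 ≤ δ) :
    normalizedVolume.real {x | sqDist x₀ x ≤ 2 * δ} ≤ δ := by
  have hsub : {x | sqDist x₀ x ≤ 2 * δ}
      ⊆ Set.univ.pi fun j => Metric.closedBall (x₀ j) (Real.pi * √δ) := by
    intro x hx j _
    rw [mem_closedBall_iff_norm]
    exact norm_le_of_phase_re x₀ x j ((one_sub_phase_re_le x₀ j x).trans hx)
  refine (measureReal_mono hsub).trans ?_
  rw [normalizedVolume, Measure.real, Measure.pi_pi, ENNReal.toReal_prod]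
  have h : ∀ j : Fin 2, ((AddCircle.haarAddCircle : Measure (AddCircle (2 * Real.pi)))
      (Metric.closedBall (x₀ j) (Real.pi * √δ))).toReal ≤ √δ := fun j => by
    refine (haar_closedBall_le (x₀ j) (by positivity)).trans_eq ?_
    have := Real.pi_ne_zero
    field_simp
  rw [Fin.prod_univ_two]
  calc _ ≤ √δ * √δ := mul_le_mul (h 0) (h 1) ENNReal.toReal_nonneg (Real.sqrt_nonneg _)
    _ = δ := Real.mul_self_sqrt hδ

/-- `U'` is the partial derivative of `U` in the `j`-th coordinate direction. -/
def HasDirDeriv {E : Type*} [NormedAddCommGroup E] [NormedSpace ℝ E] (j : Fin 2)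
    (U U' : Torus → E) : Prop :=
  ∀ x, HasDerivAt (fun t : ℝ => U (x + step j t)) (U' x) 0

lemma HasDirDeriv.dirDeriv_eq {j : Fin 2} {U U' : Torus → ℂ} (h : HasDirDeriv j U U') :
    dirDeriv j U = U' := funext fun x => (h x).deriv

lemma hasDirDeriv_expWave (x₀ : Torus) (ξ : Fin 2 → ℤ) (j : Fin 2) :
    HasDirDeriv j (expWave x₀ ξ) fun x => Complex.I * ξ j * expWave x₀ ξ x := by
  intro x
  simp only [expWave_translate, expWave_step]
  have h1 : HasDerivAt (fun t : ℝ => Complex.I * ξ j * (t : ℂ)) (Complex.I * ξ j) 0 := by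
    simpa using (Complex.ofRealCLM.hasDerivAt (x := (0 : ℝ))).const_mul (Complex.I * (ξ j : ℂ))
  simpa [mul_comm] using h1.cexp.const_mul (expWave x₀ ξ x)

lemma hasDirDeriv_phase (x₀ : Torus) (k j : Fin 2) :
    HasDirDeriv j (phase x₀ k) fun x => if k = j then Complex.I * phase x₀ k x else 0 := by
  intro x
  have h := hasDirDeriv_expWave x₀ (Pi.single k 1) j x
  split_ifs with hkj
  · subst hkj; simpa [phase] using h
  · simpa [phase, Pi.single_eq_of_ne (Ne.symm hkj)] using h

lemma hasDirDeriv_sqDist (x₀ : Torus) (j : Fin 2) :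
    HasDirDeriv j (sqDist x₀) fun x => (phase x₀ j x).im := by
  intro x
  have h : HasDerivAt (fun t : ℝ => sqDist x₀ (x + step j t))
      (∑ k, (-((if k = j then Complex.I * phase x₀ k x else 0) : ℂ).re)) 0 := by
    refine HasDerivAt.fun_sum fun k _ => ?_
    have hk := hasDirDeriv_phase x₀ k j x
    exact (Complex.reCLM.hasFDerivAt.comp_hasDerivAt (0 : ℝ) hk).const_sub 1
  refine h.congr_deriv ?_
  rw [Finset.sum_eq_single j]
  · simp
  · intro k _ hk; simp [hk]
  · simp

lemma hasDirDeriv_phase_im (x₀ : Torus) (j : Fin 2) :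
    HasDirDeriv j (fun x => (phase x₀ j x).im) fun x => (phase x₀ j x).re := by
  intro x
  have hk := hasDirDeriv_phase x₀ j j x
  exact (Complex.imCLM.hasFDerivAt.comp_hasDerivAt (0 : ℝ) hk).congr_deriv (by simp)

lemma HasDirDeriv.mul {j : Fin 2} {U U' W W' : Torus → ℂ} (hU : HasDirDeriv j U U')
    (hW : HasDirDeriv j W W') :
    HasDirDeriv j (fun x => U x * W x) fun x => U' x * W x + U x * W' x := by
  intro x
  simpa [step_zero] using (hU x).fun_mul (hW x)

lemma HasDirDeriv.add {j : Fin 2} {U U' W W' : Torus → ℂ} (hU : HasDirDeriv j U U')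
    (hW : HasDirDeriv j W W') :
    HasDirDeriv j (fun x => U x + W x) fun x => U' x + W' x := fun x => (hU x).fun_add (hW x)

lemma HasDirDeriv.const_mul {j : Fin 2} {U U' : Torus → ℂ} (hU : HasDirDeriv j U U') (c : ℂ) :
    HasDirDeriv j (fun x => c * U x) fun x => c * U' x := fun x => (hU x).const_mul c

lemma HasDirDeriv.sub_const {j : Fin 2} {U U' : Torus → ℂ} (hU : HasDirDeriv j U U') (c : ℂ) :
    HasDirDeriv j (fun x => U x - c) U' := fun x => (hU x).sub_const c

lemma HasDirDeriv.ofReal {j : Fin 2} {U U' : Torus → ℝ} (hU : HasDirDeriv j U U') :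
    HasDirDeriv j (fun x => (U x : ℂ)) fun x => (U' x : ℂ) := fun x => (hU x).ofReal_comp

/-- A smooth step function, equal to `0` for `t ≤ 1` and to `1` for `t ≥ 2`. -/
def smoothStep (t : ℝ) : ℝ := Real.smoothTransition (t - 1)

lemma contDiff_smoothStep : ContDiff ℝ ((⊤ : ℕ∞) : WithTop ℕ∞) smoothStep :=
  Real.smoothTransition.contDiff.comp (contDiff_id.sub contDiff_const)

lemma contDiff_deriv_smoothStep : ContDiff ℝ ((⊤ : ℕ∞) : WithTop ℕ∞) (deriv smoothStep) :=
  contDiff_smoothStep.iterate_deriv 1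

lemma smoothStep_of_le {t : ℝ} (ht : t ≤ 1) : smoothStep t = 0 :=
  Real.smoothTransition.zero_of_nonpos (by linarith)

lemma smoothStep_of_ge {t : ℝ} (ht : 2 ≤ t) : smoothStep t = 1 :=
  Real.smoothTransition.one_of_one_le (by linarith)

lemma deriv_smoothStep_of_gt {t : ℝ} (ht : 2 < t) : deriv smoothStep t = 0 := by
  have : smoothStep =ᶠ[𝓝 t] fun _ => 1 := by
    filter_upwards [lt_mem_nhds ht] with s hs using smoothStep_of_ge hs.le
  rw [this.deriv_eq, deriv_const]

lemma deriv_deriv_smoothStep_of_gt {t : ℝ} (ht : 2 < t) : deriv (deriv smoothStep) t = 0 := by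
  have : deriv smoothStep =ᶠ[𝓝 t] fun _ => 0 := by
    filter_upwards [lt_mem_nhds ht] with s hs using deriv_smoothStep_of_gt hs
  rw [this.deriv_eq, deriv_const]

lemma exists_bound_deriv_smoothStep : ∃ M : ℝ, 0 ≤ M ∧ ∀ t ∈ Set.Icc (0 : ℝ) 2,
    |deriv smoothStep t| ≤ M ∧ |deriv (deriv smoothStep) t| ≤ M := by
  obtain ⟨M₁, h₁⟩ := (isCompact_Icc (a := (0 : ℝ)) (b := 2)).exists_bound_of_continuousOn
    contDiff_deriv_smoothStep.continuous.continuousOn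
  obtain ⟨M₂, h₂⟩ := (isCompact_Icc (a := (0 : ℝ)) (b := 2)).exists_bound_of_continuousOn
    ((contDiff_deriv_smoothStep.continuous_deriv (by simp)).continuousOn)
  refine ⟨max M₁ M₂, le_max_of_le_left ((norm_nonneg _).trans (h₁ 0 (by simp))), fun t ht =>
    ⟨(h₁ t ht).trans (le_max_left _ _), (h₂ t ht).trans (le_max_right _ _)⟩⟩

lemma HasDirDeriv.comp_sqDist {g : ℝ → ℝ} (hg : Differentiable ℝ g) (x₀ : Torus) (j : Fin 2)
    (δ : ℝ) : HasDirDeriv j (fun x => g (sqDist x₀ x / δ))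
      fun x => deriv g (sqDist x₀ x / δ) * ((phase x₀ j x).im / δ) := by
  intro x
  have h1 := (hasDirDeriv_sqDist x₀ j x).div_const δ
  have h2 : HasDerivAt g (deriv g (sqDist x₀ x / δ)) (sqDist x₀ (x + step j 0) / δ) := by
    rw [step_zero, add_zero]; exact (hg _).hasDerivAt
  exact h2.comp (0 : ℝ) h1

/-- The truncation of `expWave x₀ ξ - 1` away from `x₀`, at the distance `√δ`. -/
def truncation (x₀ : Torus) (ξ : Fin 2 → ℤ) (δ : ℝ) (x : Torus) : ℂ :=
  (smoothStep (sqDist x₀ x / δ) : ℂ) * (expWave x₀ ξ x - 1)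

/-- The second partial derivative of `truncation`. -/
def truncationDeriv2 (x₀ : Torus) (ξ : Fin 2 → ℤ) (δ : ℝ) (j : Fin 2) (x : Torus) : ℂ :=
  ((deriv (deriv smoothStep) (sqDist x₀ x / δ) * ((phase x₀ j x).im / δ) ^ 2
      + deriv smoothStep (sqDist x₀ x / δ) * ((phase x₀ j x).re / δ) : ℝ) : ℂ)
      * (expWave x₀ ξ x - 1)
    + 2 * ((deriv smoothStep (sqDist x₀ x / δ) * ((phase x₀ j x).im / δ) : ℝ) : ℂ)
      * (Complex.I * ξ j * expWave x₀ ξ x)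
    + (smoothStep (sqDist x₀ x / δ) : ℂ) * (-(ξ j : ℂ) ^ 2 * expWave x₀ ξ x)

lemma isSmooth_truncation (x₀ : Torus) (ξ : Fin 2 → ℤ) (δ : ℝ) :
    IsSmooth (truncation x₀ ξ δ) := by
  obtain ⟨a, rfl⟩ := exists_proj_eq x₀
  have hcoord : ∀ j : Fin 2, ContDiff ℝ ((⊤ : ℕ∞) : WithTop ℕ∞)
      (fun y : EuclideanSpace ℝ (Fin 2) => y j - a j) := fun j =>
    (EuclideanSpace.proj (𝕜 := ℝ) j).contDiff.sub contDiff_const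
  unfold IsSmooth truncation
  simp only [sqDist_proj, expWave_proj]
  refine ContDiff.mul ?_ (ContDiff.sub ?_ contDiff_const)
  · refine Complex.ofRealCLM.contDiff.comp (contDiff_smoothStep.comp ?_)
    refine ContDiff.div_const (ContDiff.sum fun j _ => ?_) _
    exact contDiff_const.sub (Real.contDiff_cos.comp (hcoord j))
  · refine ContDiff.cexp (contDiff_const.mul (ContDiff.sum fun j _ => contDiff_const.mul ?_))
    exact Complex.ofRealCLM.contDiff.comp (hcoord j)

lemma dirDeriv_dirDeriv_truncation (x₀ : Torus) (ξ : Fin 2 → ℤ) (δ : ℝ) (j : Fin 2) :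
    dirDeriv j (dirDeriv j (truncation x₀ ξ δ)) = truncationDeriv2 x₀ ξ δ j := by
  have hs := HasDirDeriv.comp_sqDist (contDiff_smoothStep.differentiable (by simp)) x₀ j δ
  have hs' := HasDirDeriv.comp_sqDist (contDiff_deriv_smoothStep.differentiable (by simp)) x₀ j δ
  have him : HasDirDeriv j (fun x => (phase x₀ j x).im / δ) fun x => (phase x₀ j x).re / δ :=
    fun x => (hasDirDeriv_phase_im x₀ j x).div_const δ
  have he := hasDirDeriv_expWave x₀ ξ j
  have h1 : HasDirDeriv j (truncation x₀ ξ δ) _ := hs.ofReal.mul (he.sub_const 1)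
  have h2 := ((hs'.ofReal.mul him.ofReal).mul (he.sub_const 1)).add
    (hs.ofReal.mul (he.const_mul (Complex.I * ξ j)))
  rw [h1.dirDeriv_eq]
  rw [HasDirDeriv.dirDeriv_eq (U := fun x => _) (by simpa only [Complex.ofReal_mul] using h2)]
  ext x
  simp only [truncationDeriv2]
  push_cast
  linear_combination ((smoothStep (sqDist x₀ x / δ) : ℂ) * (ξ j : ℂ) ^ 2 * expWave x₀ ξ x) *
    Complex.I_sq

/-- `-Δ` applied to `truncation`. -/
def truncationLaplacian (x₀ : Torus) (ξ : Fin 2 → ℤ) (δ : ℝ) (x : Torus) : ℂ :=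
  -∑ j, truncationDeriv2 x₀ ξ δ j x

lemma truncationLaplacian_of_gt {x₀ : Torus} {ξ : Fin 2 → ℤ} {δ : ℝ} (hδ : 0 < δ) {x : Torus}
    (hx : 2 * δ < sqDist x₀ x) : truncationLaplacian x₀ ξ δ x = normSq ξ * expWave x₀ ξ x := by
  have h : 2 < sqDist x₀ x / δ := by rwa [lt_div_iff₀ hδ]
  simp only [truncationLaplacian, truncationDeriv2, deriv_smoothStep_of_gt h,
    deriv_deriv_smoothStep_of_gt h, smoothStep_of_ge h.le, normSq, Fin.sum_univ_two]
  push_cast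
  ring

lemma exists_norm_truncationLaplacian_le (x₀ : Torus) (ξ : Fin 2 → ℤ) :
    ∃ C : ℝ, ∀ δ : ℝ, 0 < δ → δ ≤ 1 → ∀ x, sqDist x₀ x ≤ 2 * δ →
      ‖normSq ξ * expWave x₀ ξ x - truncationLaplacian x₀ ξ δ x‖ ≤ C / √δ := by
  obtain ⟨M, hM0, hM⟩ := exists_bound_deriv_smoothStep
  set L : ℝ := |(ξ 0 : ℝ)| + |(ξ 1 : ℝ)| with hL
  have hL0 : 0 ≤ L := by positivity
  have hξ : ∀ j, |(ξ j : ℝ)| ≤ L := by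
    intro j; fin_cases j
    · exact le_add_of_nonneg_right (abs_nonneg _)
    · exact le_add_of_nonneg_left (abs_nonneg _)
  refine ⟨(normSq ξ : ℝ) + 2 * (14 * M * L + L ^ 2), fun δ hδ hδ1 x hx => ?_⟩
  obtain ⟨σ, hσ, hσδ⟩ : ∃ σ : ℝ, 0 < σ ∧ σ ^ 2 = δ := ⟨√δ, by positivity, Real.sq_sqrt hδ.le⟩
  have hsqrt : √δ = σ := by rw [← hσδ, Real.sqrt_sq hσ.le]
  have hσ1 : σ ≤ 1 := by nlinarith
  have hN0 : (0 : ℝ) ≤ normSq ξ := by exact_mod_cast normSq_nonneg ξ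
  rw [hsqrt]
  have ht : sqDist x₀ x / δ ∈ Set.Icc (0 : ℝ) 2 :=
    ⟨div_nonneg (sqDist_nonneg _ _) hδ.le, by rwa [div_le_iff₀ hδ]⟩
  obtain ⟨hb1, hb2⟩ := hM _ ht
  have he : ‖expWave x₀ ξ x - 1‖ ≤ L * (2 * σ) := by
    refine (norm_expWave_sub_one_le x₀ ξ x).trans ?_
    gcongr
    rw [Real.sqrt_le_left (by positivity), mul_pow, hσδ]
    linarith
  have hre : ∀ j, |(phase x₀ j x).re| ≤ 1 := fun j =>
    abs_le.2 ⟨neg_one_le_phase_re x₀ j x, phase_re_le x₀ j x⟩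
  have him : ∀ j, |(phase x₀ j x).im| ≤ 2 * σ := fun j => by
    apply abs_le_of_sq_le_sq _ (by positivity)
    have := phase_im_sq_le x₀ j x
    rw [mul_pow, hσδ]
    linarith
  have him' : ∀ j, |(phase x₀ j x).im / δ| ≤ 2 / σ := fun j => by
    rw [abs_div, abs_of_pos hδ, ← hσδ, div_le_div_iff₀ (by positivity) hσ]
    nlinarith [him j]
  have hre' : ∀ j, |(phase x₀ j x).re / δ| ≤ 1 / σ ^ 2 := fun j => by
    rw [abs_div, abs_of_pos hδ, hσδ]
    gcongr
    exact hre j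
  have hstep : |smoothStep (sqDist x₀ x / δ)| ≤ 1 := by
    rw [smoothStep, abs_of_nonneg (Real.smoothTransition.nonneg _)]
    exact Real.smoothTransition.le_one _
  have hD : ∀ j, ‖truncationDeriv2 x₀ ξ δ j x‖ ≤ (14 * M * L + L ^ 2) / σ := by
    intro j
    have hA : |deriv (deriv smoothStep) (sqDist x₀ x / δ) * ((phase x₀ j x).im / δ) ^ 2
        + deriv smoothStep (sqDist x₀ x / δ) * ((phase x₀ j x).re / δ)| ≤ 5 * M / σ ^ 2 := by
      refine (abs_add_le _ _).trans ?_
      rw [abs_mul, abs_mul, abs_pow]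
      calc _ ≤ M * (2 / σ) ^ 2 + M * (1 / σ ^ 2) := by
            gcongr
            · exact him' j
            · exact hre' j
        _ = _ := by field_simp; ring
    have hB : |deriv smoothStep (sqDist x₀ x / δ)| * |(phase x₀ j x).im / δ| ≤ M * (2 / σ) := by
      gcongr
      exact him' j
    rw [truncationDeriv2]
    refine (norm_add₃_le).trans ?_
    simp only [norm_mul, Complex.norm_real, Real.norm_eq_abs, norm_neg, norm_pow, Complex.norm_I,
      Complex.norm_intCast, norm_expWave_apply, mul_one, one_mul, Complex.norm_ofNat]
    calc _ ≤ 5 * M / σ ^ 2 * (L * (2 * σ)) + 2 * (M * (2 / σ)) * L + 1 * L ^ 2 :=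
          add_le_add (add_le_add (mul_le_mul hA he (norm_nonneg _) (by positivity))
            (mul_le_mul (mul_le_mul_of_nonneg_left hB zero_le_two) (hξ j) (abs_nonneg _)
              (by positivity)))
            (mul_le_mul hstep (pow_le_pow_left₀ (abs_nonneg _) (hξ j) 2) (by positivity)
              zero_le_one)
      _ ≤ 5 * M / σ ^ 2 * (L * (2 * σ)) + 2 * (M * (2 / σ)) * L + L ^ 2 / σ := by
          have : L ^ 2 ≤ L ^ 2 / σ := le_div_self (by positivity) hσ hσ1
          linarith
      _ = (14 * M * L + L ^ 2) / σ := by field_simp; ring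
  have hN : (normSq ξ : ℝ) ≤ normSq ξ / σ := le_div_self hN0 hσ hσ1
  have hN' : ‖(normSq ξ : ℂ)‖ = normSq ξ := by rw [Complex.norm_intCast, abs_of_nonneg hN0]
  rw [truncationLaplacian, sub_neg_eq_add, Fin.sum_univ_two]
  refine (norm_add_le _ _).trans ?_
  rw [norm_mul, norm_expWave_apply, mul_one, hN']
  have := norm_add_le (truncationDeriv2 x₀ ξ δ 0 x) (truncationDeriv2 x₀ ξ δ 1 x)
  rw [add_div, mul_div_assoc]
  linarith [hD 0, hD 1]

lemma eventually_truncation_eq_zero (x₀ : Torus) (ξ : Fin 2 → ℤ) {δ : ℝ} (hδ : 0 < δ) :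
    ∀ᶠ x in 𝓝 x₀, truncation x₀ ξ δ x = 0 := by
  have h0 : sqDist x₀ x₀ = 0 := by simp [sqDist, phase, expWave_self]
  have h := (continuous_sqDist x₀).continuousAt (x := x₀)
  have hlt : sqDist x₀ x₀ < δ := by rw [h0]; exact hδ
  filter_upwards [h.eventually (gt_mem_nhds hlt)] with x hx
  rw [truncation, smoothStep_of_le ((div_le_one hδ).2 hx.le)]
  simp

lemma continuous_truncationLaplacian (x₀ : Torus) (ξ : Fin 2 → ℤ) (δ : ℝ) :
    Continuous (truncationLaplacian x₀ ξ δ) := by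
  have h : truncationLaplacian x₀ ξ δ
      = fun x => -∑ j, dirDeriv j (dirDeriv j (truncation x₀ ξ δ)) x := by
    ext x
    simp only [truncationLaplacian, dirDeriv_dirDeriv_truncation]
  have hc := fun j => (((isSmooth_truncation x₀ ξ δ).dirDeriv j).dirDeriv j).continuous
  rw [h]
  fun_prop

/-- `truncation` and its image under `-Δ`, as an element of `L² × L²`. -/
def truncationPair (x₀ : Torus) (ξ : Fin 2 → ℤ) (δ : ℝ) : L2Torus × L2Torus :=
  (ContinuousMap.toLp (E := ℂ) 2 normalizedVolume ℂ ⟨_, (isSmooth_truncation x₀ ξ δ).continuous⟩,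
    ContinuousMap.toLp (E := ℂ) 2 normalizedVolume ℂ ⟨_, continuous_truncationLaplacian x₀ ξ δ⟩)

lemma truncationPair_mem (x₀ : Torus) (ξ : Fin 2 → ℤ) {δ : ℝ} (hδ : 0 < δ) :
    truncationPair x₀ ξ δ ∈ minimalGraph x₀ := by
  refine ⟨truncation x₀ ξ δ, truncationLaplacian x₀ ξ δ, isSmooth_truncation x₀ ξ δ,
    eventually_truncation_eq_zero x₀ ξ hδ, fun y => ?_, ?_, ?_⟩
  · rw [(isSmooth_truncation x₀ ξ δ).laplacian]
    simp only [truncationLaplacian, dirDeriv_dirDeriv_truncation]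
  · exact ContinuousMap.coeFn_toLp normalizedVolume _
  · exact ContinuousMap.coeFn_toLp normalizedVolume _

/-- The pairing with a fixed `L²` function of functions `w δ` of size `C / √δ` supported in the ball
of radius `√δ` around `x₀` tends to zero: such `w δ` stay bounded in `L²` while their supports
shrink to a point. -/
lemma tendsto_inner_of_shrinking_support (x₀ : Torus) (p : L2Torus) (w : ℝ → C(Torus, ℂ)) (C : ℝ)
    (h0 : ∀ δ, 0 < δ → ∀ x, 2 * δ < sqDist x₀ x → w δ x = 0)
    (hC : ∀ δ, 0 < δ → δ ≤ 1 → ∀ x, sqDist x₀ x ≤ 2 * δ → ‖w δ x‖ ≤ C / √δ) :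
    Tendsto (fun δ => inner ℂ p (ContinuousMap.toLp (E := ℂ) 2 normalizedVolume ℂ (w δ)))
      (𝓝[>] 0) (𝓝 0) := by
  have hp : Integrable (fun x => ‖p x‖ ^ 2) normalizedVolume :=
    (memLp_two_iff_integrable_sq_norm (Lp.aestronglyMeasurable p)).1 (Lp.memLp p)
  have hmeas : ∀ δ, MeasurableSet {x | sqDist x₀ x ≤ 2 * δ} := fun δ =>
    (isClosed_le (continuous_sqDist x₀) continuous_const).measurableSet
  have hvol : Tendsto (normalizedVolume ∘ fun δ => {x | sqDist x₀ x ≤ 2 * δ}) (𝓝[>] 0) (𝓝 0) := by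
    have h1 : Tendsto (fun δ : ℝ => ENNReal.ofReal δ) (𝓝[>] 0) (𝓝 0) := by
      have := (ENNReal.continuous_ofReal.tendsto 0).mono_left (nhdsWithin_le_nhds (s := Set.Ioi 0))
      simpa using this
    refine tendsto_of_tendsto_of_tendsto_of_le_of_le' tendsto_const_nhds h1
      (Eventually.of_forall fun _ => bot_le) ?_
    filter_upwards [self_mem_nhdsWithin] with δ hδ
    rw [Function.comp_apply, ← ofReal_measureReal]
    exact ENNReal.ofReal_le_ofReal (measure_sqDist_le x₀ (le_of_lt hδ))
  have hint := hp.tendsto_setIntegral_nhds_zero hvol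
  rw [Metric.tendsto_nhds]
  intro ε hε
  set η : ℝ := ε / (2 * (C ^ 2 + 1)) with hη
  have hη0 : 0 < η := by positivity
  have hlt : (0 : ℝ) < η * (ε / 2) := by positivity
  filter_upwards [self_mem_nhdsWithin, hint.eventually (gt_mem_nhds hlt),
    Ioc_mem_nhdsGT (zero_lt_one (α := ℝ))] with δ hδ hδint hδ1
  have hδ0 : 0 < δ := hδ
  have hw := ContinuousMap.coeFn_toLp (p := 2) (𝕜 := ℂ) normalizedVolume (w δ)
  have hbd := norm_inner_le_of_support (p := p)
    (w := ContinuousMap.toLp (E := ℂ) 2 normalizedVolume ℂ (w δ)) (hmeas δ) (B := C / √δ) hη0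
    (by
      filter_upwards [hw] with x hx hxA
      rw [hx]
      exact h0 δ hδ x (not_le.1 hxA))
    (by
      filter_upwards [hw] with x hx
      rw [hx]
      by_cases hxA : sqDist x₀ x ≤ 2 * δ
      · exact hC δ hδ hδ1.2 x hxA
      · rw [h0 δ hδ x (not_le.1 hxA), norm_zero]
        exact (norm_nonneg _).trans (hC δ hδ hδ1.2 x₀ (by
          simp [sqDist, phase, expWave_self, hδ0.le])))
  rw [dist_zero_right]
  refine hbd.trans_lt ?_
  have h1 : η * (C / √δ) ^ 2 * normalizedVolume.real {x | sqDist x₀ x ≤ 2 * δ} ≤ η * C ^ 2 := by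
    rw [div_pow, Real.sq_sqrt hδ0.le]
    calc _ ≤ η * (C ^ 2 / δ) * δ := by
          gcongr
          exact measure_sqDist_le x₀ hδ0.le
      _ = _ := by field_simp
  have h2 : η * C ^ 2 ≤ ε / 2 := by
    rw [hη, div_mul_eq_mul_div, div_le_div_iff₀ (by positivity) (by norm_num)]
    nlinarith
  have h3 : η⁻¹ * ∫ x in {x | sqDist x₀ x ≤ 2 * δ}, ‖p x‖ ^ 2 ∂normalizedVolume < ε / 2 := by
    rw [inv_mul_lt_iff₀ hη0]
    exact hδint
  linarith

/-- The functions `exp (i ⟨x - x₀, ξ⟩) - 1`, which vanish at `x₀`, lie in the domain of the closure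
of the minimal operator: their truncations converge to them weakly, together with the
images under `-Δ`. -/
lemma wave_sub_const_mem_closure (x₀ : Torus) (ξ : Fin 2 → ℤ) :
    (waveLp x₀ ξ - waveLp x₀ 0, (normSq ξ : ℂ) • waveLp x₀ ξ)
      ∈ (minimalGraph x₀).topologicalClosure := by
  by_contra hmem
  obtain ⟨f, hf, hfx⟩ := exists_dual_of_notMem_closure hmem
  apply hfx
  obtain ⟨C, hC⟩ := exists_norm_truncationLaplacian_le x₀ ξ
  set p := (InnerProductSpace.toDual ℂ L2Torus).symm (f.comp (ContinuousLinearMap.inl ℂ _ _))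
  set q := (InnerProductSpace.toDual ℂ L2Torus).symm (f.comp (ContinuousLinearMap.inr ℂ _ _))
  have hpq : ∀ a : L2Torus × L2Torus, f a = inner ℂ p a.1 + inner ℂ q a.2 := by
    intro a
    rw [InnerProductSpace.toDual_symm_apply, InnerProductSpace.toDual_symm_apply]
    simp [← map_add]
  let w₁ : ℝ → C(Torus, ℂ) := fun δ =>
    expWave x₀ ξ - expWave x₀ 0 - ⟨_, (isSmooth_truncation x₀ ξ δ).continuous⟩
  let w₂ : ℝ → C(Torus, ℂ) := fun δ =>
    (normSq ξ : ℂ) • expWave x₀ ξ - ⟨_, continuous_truncationLaplacian x₀ ξ δ⟩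
  have hw₁ : ∀ δ x, w₁ δ x = (1 - smoothStep (sqDist x₀ x / δ) : ℝ) * (expWave x₀ ξ x - 1) := by
    intro δ x
    simp only [w₁, ContinuousMap.sub_apply, expWave_zero, ContinuousMap.coe_mk, truncation]
    push_cast
    ring
  have ht₁ := tendsto_inner_of_shrinking_support x₀ p w₁ 2
    (fun δ hδ x hx => by
      rw [hw₁, smoothStep_of_ge ((le_div_iff₀ hδ).2 hx.le)]; simp)
    (fun δ hδ hδ1 x hx => by
      rw [hw₁, norm_mul, Complex.norm_real, Real.norm_eq_abs]
      have h1 : |1 - smoothStep (sqDist x₀ x / δ)| ≤ 1 := by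
        have := Real.smoothTransition.nonneg (sqDist x₀ x / δ - 1)
        have := Real.smoothTransition.le_one (sqDist x₀ x / δ - 1)
        rw [smoothStep, abs_le]; constructor <;> linarith
      have h2 : ‖expWave x₀ ξ x - 1‖ ≤ 2 := by
        refine (norm_sub_le _ _).trans ?_
        rw [norm_expWave_apply, norm_one]; norm_num
      have h3 : (2 : ℝ) ≤ 2 / √δ :=
        le_div_self (by norm_num) (by positivity) (Real.sqrt_le_one.2 hδ1)
      exact (mul_le_mul h1 h2 (norm_nonneg _) zero_le_one).trans (by linarith))
  have ht₂ := tendsto_inner_of_shrinking_support x₀ q w₂ C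
    (fun δ hδ x hx => by
      simp [w₂, truncationLaplacian_of_gt hδ hx])
    (fun δ hδ hδ1 x hx => hC δ hδ hδ1 x hx)
  have hlim := ht₁.add ht₂
  rw [add_zero] at hlim
  refine tendsto_nhds_unique (tendsto_const_nhds (f := 𝓝[>] (0 : ℝ)).congr' ?_) hlim
  filter_upwards [self_mem_nhdsWithin] with δ hδ
  have h0 := hf _ (truncationPair_mem x₀ ξ hδ)
  rw [← sub_zero (f _), ← h0, ← map_sub, hpq]
  simp only [w₁, w₂, map_sub, map_smul, Prod.fst_sub, Prod.snd_sub, truncationPair, waveLp]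

/-- A function whose Fourier coefficients are summable with sum zero (so that it vanishes at `x₀`)
and whose Laplacian is in `L²` lies in the domain of the closure of the minimal operator. -/
lemma mem_closure_of_hasSum {x₀ : Torus} {p : L2Torus × L2Torus}
    (h0 : HasSum (fun ξ => inner ℂ (waveLp x₀ ξ) p.1) 0)
    (h : ∀ ξ, inner ℂ (waveLp x₀ ξ) p.2 = normSq ξ * inner ℂ (waveLp x₀ ξ) p.1) :
    p ∈ (minimalGraph x₀).topologicalClosure := by
  have h1 : HasSum (fun ξ => inner ℂ (waveLp x₀ ξ) p.1 • (waveLp x₀ ξ - waveLp x₀ 0)) p.1 := by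
    have := (hasSum_wave x₀ p.1).sub (h0.smul_const (waveLp x₀ 0))
    simpa only [smul_sub, zero_smul, sub_zero] using this
  have h2 : HasSum (fun ξ => inner ℂ (waveLp x₀ ξ) p.1 • ((normSq ξ : ℂ) • waveLp x₀ ξ)) p.2 := by
    refine (hasSum_wave x₀ p.2).congr_fun fun ξ => ?_
    rw [h, smul_smul, mul_comm (normSq ξ : ℂ)]
  have h3 := h1.prodMk h2
  refine (minimalGraph x₀).isClosed_topologicalClosure.mem_of_tendsto h3
    (Eventually.of_forall fun s => ?_)
  exact Submodule.sum_mem _ fun ξ _ =>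
    Submodule.smul_mem _ _ (wave_sub_const_mem_closure x₀ ξ)

/-! ### The spectral equation -/

/-- The summand of the equation `∑ (1 / (|ξ|² - λ) - (|ξ|² + τ) / (|ξ|⁴ + 1)) = 0` characterizing
the new eigenvalues, where `τ = tan (φ / 2)`. -/
def spectralTerm (τ lam : ℝ) (ξ : Fin 2 → ℤ) : ℝ :=
  1 / ((normSq ξ : ℝ) - lam) - ((normSq ξ : ℝ) + τ) / ((normSq ξ : ℝ) ^ 2 + 1)

/-- The relation between the extension parameter `φ` and the coupling `tan (φ / 2)`: the unit circle
without `-1` is the image of the real line under a Cayley transform. -/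
lemma one_add_exp_ne_zero {φ : ℝ} (hφ : φ ∈ Set.Ioo (-Real.pi) Real.pi) :
    1 + Complex.exp (φ * Complex.I) ≠ 0 ∧
    Complex.I * (1 - Complex.exp (φ * Complex.I))
      = (Real.tan (φ / 2) : ℂ) * (1 + Complex.exp (φ * Complex.I)) := by
  have hc : 0 < Real.cos (φ / 2) :=
    Real.cos_pos_of_mem_Ioo ⟨by linarith [hφ.1], by linarith [hφ.2]⟩
  have hsc : (Real.cos (φ / 2) : ℂ) ^ 2 + (Real.sin (φ / 2) : ℂ) ^ 2 = 1 := by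
    exact_mod_cast Real.cos_sq_add_sin_sq (φ / 2)
  have hc' : (Real.cos (φ / 2) : ℂ) ≠ 0 := by exact_mod_cast hc.ne'
  set c : ℂ := (Real.cos (φ / 2) : ℂ) with hcdef
  set s : ℂ := (Real.sin (φ / 2) : ℂ) with hsdef
  have he : Complex.exp (φ * Complex.I) = (c + s * Complex.I) ^ 2 := by
    have : (φ : ℂ) * Complex.I = ((φ / 2 : ℝ) : ℂ) * Complex.I + ((φ / 2 : ℝ) : ℂ) * Complex.I := by
      push_cast; ring
    rw [this, Complex.exp_add, Complex.exp_mul_I, ← Complex.ofReal_cos, ← Complex.ofReal_sin, sq]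
  have h1 : 1 + Complex.exp (φ * Complex.I) = 2 * c * (c + s * Complex.I) := by
    rw [he]; linear_combination (-1 : ℂ) * hsc - s ^ 2 * Complex.I_sq * (-1)
  have h2 : Complex.I * (1 - Complex.exp (φ * Complex.I)) = 2 * s * (c + s * Complex.I) := by
    rw [he]; linear_combination (-Complex.I) * hsc - (2 * s * c + Complex.I * s ^ 2) * Complex.I_sq
  constructor
  · rw [h1]
    refine mul_ne_zero (mul_ne_zero two_ne_zero hc') fun h => ?_
    have h3 : Real.cos (φ / 2) = 0 := by
      simpa [hcdef, hsdef, -Complex.ofReal_cos, -Complex.ofReal_sin] using congrArg Complex.re h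
    exact hc.ne' h3
  · rw [h1, h2, Real.tan_eq_sin_div_cos, Complex.ofReal_div, ← hcdef, ← hsdef]
    field_simp

lemma intCast_sub_I_ne_zero (n : ℤ) : (n : ℂ) - Complex.I ≠ 0 := fun h => by
  simpa using congrArg Complex.im h

lemma intCast_add_I_ne_zero (n : ℤ) : (n : ℂ) - -Complex.I ≠ 0 := fun h => by
  simpa using congrArg Complex.im h

lemma inner_wave_deficiencyVector (x₀ : Torus) (φ : ℝ) (ξ : Fin 2 → ℤ) :
    inner ℂ (waveLp x₀ ξ) (deficiencyVector x₀ φ) = 1 / ((normSq ξ : ℂ) - Complex.I)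
      + Complex.exp (φ * Complex.I) * (1 / ((normSq ξ : ℂ) - -Complex.I)) := by
  rw [deficiencyVector, inner_add_right, inner_smul_right, inner_wave_green, inner_wave_green]

lemma inner_wave_deficiencyImage (x₀ : Torus) (φ : ℝ) (ξ : Fin 2 → ℤ) :
    inner ℂ (waveLp x₀ ξ) (deficiencyImage x₀ φ)
      = normSq ξ * inner ℂ (waveLp x₀ ξ) (deficiencyVector x₀ φ)
        - (1 + Complex.exp (φ * Complex.I)) := by
  rw [inner_wave_deficiencyVector, deficiencyImage, inner_sub_right, inner_smul_right,
    inner_smul_right, inner_wave_green, inner_wave_green]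
  have h1 := intCast_sub_I_ne_zero (normSq ξ)
  have h2 := intCast_add_I_ne_zero (normSq ξ)
  field_simp
  ring

lemma spectralTerm_eq {φ : ℝ} (hφ : φ ∈ Set.Ioo (-Real.pi) Real.pi) (lam : ℝ)
    (ξ : Fin 2 → ℤ) (x₀ : Torus) :
    (1 + Complex.exp (φ * Complex.I)) * (1 / ((normSq ξ : ℂ) - lam))
      - inner ℂ (waveLp x₀ ξ) (deficiencyVector x₀ φ)
      = (1 + Complex.exp (φ * Complex.I)) * (spectralTerm (Real.tan (φ / 2)) lam ξ : ℂ) := by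
  rw [inner_wave_deficiencyVector]
  have h := (one_add_exp_ne_zero hφ).2
  have h1 := intCast_sub_I_ne_zero (normSq ξ)
  have h2 := intCast_add_I_ne_zero (normSq ξ)
  have h4 : (normSq ξ : ℂ) ^ 2 + 1 = ((normSq ξ : ℂ) - Complex.I)
      * ((normSq ξ : ℂ) - -Complex.I) := by
    linear_combination Complex.I_sq
  have h5 : (normSq ξ : ℂ) ^ 2 + 1 ≠ 0 := by rw [h4]; exact mul_ne_zero h1 h2
  simp only [spectralTerm]
  push_cast [-Complex.ofReal_tan]
  rw [mul_sub]
  congr 1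
  rw [← mul_div_assoc (1 + Complex.exp (φ * Complex.I)), mul_add,
    mul_comm _ (Real.tan (φ / 2) : ℂ), ← h, h4]
  field_simp
  ring

/-- New eigenvalues solve the spectral equation. -/
lemma hasSum_spectralTerm_of_mem {x₀ : Torus} {φ lam : ℝ} (hφ : φ ∈ Set.Ioo (-Real.pi) Real.pi)
    (h : lam ∈ newEigenvalues x₀ φ) : HasSum (spectralTerm (Real.tan (φ / 2)) lam) 0 := by
  obtain ⟨⟨f, hf0, hf⟩, hlam⟩ := h
  obtain ⟨p, hp, q, hq, hpq⟩ := Submodule.mem_sup.1 hf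
  obtain ⟨c, rfl⟩ := Submodule.mem_span_singleton.1 hq
  have h1 : p.1 + c • deficiencyVector x₀ φ = f := congrArg Prod.fst hpq
  have h2 : p.2 + c • deficiencyImage x₀ φ = (lam : ℂ) • f := congrArg Prod.snd hpq
  have he := (one_add_exp_ne_zero hφ).1
  have hne : ∀ ξ, (normSq ξ : ℂ) - lam ≠ 0 := fun ξ => by
    rw [sub_ne_zero]; exact_mod_cast hlam ξ
  have hcoef : ∀ ξ, inner ℂ (waveLp x₀ ξ) f
      = c * ((1 + Complex.exp (φ * Complex.I)) * (1 / ((normSq ξ : ℂ) - lam))) := by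
    intro ξ
    have h1' := congrArg (inner ℂ (waveLp x₀ ξ)) h1
    have h2' := congrArg (inner ℂ (waveLp x₀ ξ)) h2
    rw [inner_add_right, inner_smul_right] at h1' h2'
    rw [inner_smul_right, inner_wave_of_mem_closure hp, inner_wave_deficiencyImage] at h2'
    have := hne ξ
    field_simp
    linear_combination h2' - (normSq ξ : ℂ) * h1'
  have hc : c ≠ 0 := by
    rintro rfl
    refine hf0 (ext_wave x₀ fun ξ => ?_)
    rw [hcoef ξ, inner_zero_right, zero_mul]
  have hu : ∀ ξ, inner ℂ (waveLp x₀ ξ) p.1 = c * (1 + Complex.exp (φ * Complex.I))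
      * (spectralTerm (Real.tan (φ / 2)) lam ξ : ℂ) := by
    intro ξ
    have h1' := congrArg (inner ℂ (waveLp x₀ ξ)) h1
    rw [inner_add_right, inner_smul_right, hcoef ξ] at h1'
    rw [mul_assoc, ← spectralTerm_eq hφ lam ξ x₀]
    linear_combination h1'
  have hs := hasSum_inner_of_mem_closure hp
  simp only [hu] at hs
  rw [← mul_zero (c * (1 + Complex.exp (φ * Complex.I))),
    hasSum_mul_left_iff (mul_ne_zero hc he)] at hs
  exact Complex.hasSum_ofReal.1 (by simpa using hs)

/-- Solutions of the spectral equation are new eigenvalues. -/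
lemma mem_newEigenvalues_of_hasSum (x₀ : Torus) {φ lam : ℝ}
    (hφ : φ ∈ Set.Ioo (-Real.pi) Real.pi) (hlam : ∀ ξ, (normSq ξ : ℝ) ≠ lam)
    (h : HasSum (spectralTerm (Real.tan (φ / 2)) lam) 0) : lam ∈ newEigenvalues x₀ φ := by
  have he := (one_add_exp_ne_zero hφ).1
  have hne : ∀ ξ, (normSq ξ : ℂ) - lam ≠ 0 := fun ξ => by
    rw [sub_ne_zero]; exact_mod_cast hlam ξ
  set e := 1 + Complex.exp (φ * Complex.I) with hedef
  refine ⟨⟨e • green x₀ lam, ?_, ?_⟩, hlam⟩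
  · intro h0
    have h1 := congrArg (inner ℂ (waveLp x₀ 0)) h0
    rw [inner_smul_right, inner_wave_green, inner_zero_right] at h1
    exact (mul_ne_zero he (one_div_ne_zero (hne 0))) h1
  · refine Submodule.mem_sup.2 ⟨(e • green x₀ lam - deficiencyVector x₀ φ,
      (lam : ℂ) • e • green x₀ lam - deficiencyImage x₀ φ), ?_, _,
      Submodule.mem_span_singleton_self _, by simp⟩
    have hu : ∀ ξ, inner ℂ (waveLp x₀ ξ) (e • green x₀ lam - deficiencyVector x₀ φ)
        = e * (spectralTerm (Real.tan (φ / 2)) lam ξ : ℂ) := by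
      intro ξ
      rw [inner_sub_right, inner_smul_right, inner_wave_green, spectralTerm_eq hφ lam ξ]
    refine mem_closure_of_hasSum ?_ fun ξ => ?_
    · simp only [hu]
      have h' : HasSum (fun ξ => (spectralTerm (Real.tan (φ / 2)) lam ξ : ℂ)) 0 := by
        simpa using Complex.hasSum_ofReal.2 h
      simpa using h'.mul_left e
    · simp only [inner_sub_right, inner_smul_right, inner_wave_deficiencyImage, inner_wave_green]
      have := hne ξ
      field_simp
      ring

lemma spectralTerm_sub {τ lam mu : ℝ} {ξ : Fin 2 → ℤ} (h1 : (normSq ξ : ℝ) ≠ lam)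
    (h2 : (normSq ξ : ℝ) ≠ mu) : spectralTerm τ lam ξ - spectralTerm τ mu ξ
      = (lam - mu) / (((normSq ξ : ℝ) - lam) * ((normSq ξ : ℝ) - mu)) := by
  have h1' := sub_ne_zero.2 h1
  have h2' := sub_ne_zero.2 h2
  rw [spectralTerm, spectralTerm]
  field_simp
  ring

/-- The spectral equation has at most one solution in an interval free of the values `|ξ|²`. -/
lemma eq_of_hasSum_spectralTerm {τ lam mu : ℝ} (h1 : HasSum (spectralTerm τ lam) 0)
    (h2 : HasSum (spectralTerm τ mu) 0) (hle : lam ≤ mu)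
    (h : ∀ ξ, (normSq ξ : ℝ) < lam ∨ mu < normSq ξ) : lam = mu := by
  by_contra hne
  have hlt : lam < mu := lt_of_le_of_ne hle hne
  have hterm : ∀ ξ, spectralTerm τ lam ξ < spectralTerm τ mu ξ := by
    intro ξ
    rw [← sub_neg, spectralTerm_sub]
    · refine div_neg_of_neg_of_pos (by linarith) ?_
      rcases h ξ with h | h
      · exact mul_pos_of_neg_of_neg (by linarith) (by linarith)
      · exact mul_pos (by linarith) (by linarith)
    · rcases h ξ with h | h
      · exact h.ne
      · exact (hlt.trans h).ne'
    · rcases h ξ with h | h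
      · exact (h.trans hlt).ne
      · exact h.ne'
  exact lt_irrefl _ (hasSum_lt (fun ξ => (hterm ξ).le) (hterm 0) h1 h2)

lemma summable_spectralTerm (τ lam : ℝ) : Summable (spectralTerm τ lam) := by
  have hC : 0 ≤ 4 * (1 + |lam| + |τ| + |τ| * |lam|) := by positivity
  refine Summable.of_norm_bounded_eventually
    (summable_inv_one_add_normSq_sq.mul_left (4 * (1 + |lam| + |τ| + |τ| * |lam|))) ?_
  filter_upwards [eventually_normSq_ge (2 * |lam| + 1)] with ξ hξ
  have h0 : (0 : ℝ) ≤ normSq ξ := by exact_mod_cast normSq_nonneg ξ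
  set n : ℝ := (normSq ξ : ℝ)
  have h1 : (1 + n) / 2 ≤ n - lam := by linarith [le_abs_self lam]
  have h1' : 0 < n - lam := by linarith
  have h2 : (1 + n) ^ 2 / 2 ≤ n ^ 2 + 1 := by nlinarith [sq_nonneg (n - 1)]
  have h3 : spectralTerm τ lam ξ = (1 + n * lam - τ * n + τ * lam) / ((n - lam) * (n ^ 2 + 1)) := by
    rw [spectralTerm]
    have : n ^ 2 + 1 ≠ 0 := by positivity
    have := h1'.ne'
    change 1 / (n - lam) - (n + τ) / (n ^ 2 + 1) = _
    field_simp
    ring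
  have h4 : |1 + n * lam - τ * n + τ * lam| ≤ (1 + |lam| + |τ| + |τ| * |lam|) * (1 + n) := by
    have e1 : |n * lam| = n * |lam| := by rw [abs_mul, abs_of_nonneg h0]
    have e2 : |τ * n| = |τ| * n := by rw [abs_mul, abs_of_nonneg h0]
    have e3 : |τ * lam| = |τ| * |lam| := abs_mul _ _
    have : |1 + n * lam - τ * n + τ * lam| ≤ 1 + |n * lam| + |τ * n| + |τ * lam| := by
      rw [abs_le]
      constructor <;>
        linarith [le_abs_self (n * lam), neg_abs_le (n * lam), le_abs_self (τ * n),
          neg_abs_le (τ * n), le_abs_self (τ * lam), neg_abs_le (τ * lam)]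
    rw [e1, e2, e3] at this
    refine this.trans ?_
    have := mul_nonneg (abs_nonneg τ) (abs_nonneg lam)
    have := mul_nonneg this h0
    nlinarith [abs_nonneg lam, abs_nonneg τ]
  rw [h3, Real.norm_eq_abs, abs_div, abs_of_pos (by positivity : 0 < (n - lam) * (n ^ 2 + 1))]
  calc _ ≤ ((1 + |lam| + |τ| + |τ| * |lam|) * (1 + n)) / ((1 + n) / 2 * ((1 + n) ^ 2 / 2)) := by
        gcongr
    _ = _ := by field_simp; ring

/-- Between two consecutive values of `|ξ|²` the spectral equation has a solution. -/
lemma exists_hasSum_spectralTerm (τ : ℝ) {α β : Fin 2 → ℤ} (hab : normSq α < normSq β)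
    (hgap : ∀ ξ, normSq ξ ≤ normSq α ∨ normSq β ≤ normSq ξ) :
    ∃ lam : ℝ, (normSq α : ℝ) < lam ∧ lam < normSq β ∧ HasSum (spectralTerm τ lam) 0 := by
  have hab' : (normSq α : ℝ) < normSq β := by exact_mod_cast hab
  set a : ℝ := (normSq α : ℝ) with ha
  set b : ℝ := (normSq β : ℝ) with hb
  have ha0 : 0 ≤ a := by rw [ha]; exact_mod_cast normSq_nonneg α
  have hgap' : ∀ ξ, (normSq ξ : ℝ) ≤ a ∨ b ≤ normSq ξ := fun ξ => by
    rw [ha, hb]; exact_mod_cast hgap ξ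
  have hne : ∀ {lam : ℝ}, a < lam → lam < b → ∀ ξ, (normSq ξ : ℝ) ≠ lam := by
    rintro lam h1 h2 ξ rfl
    rcases hgap' ξ with h | h <;> linarith
  set mu : ℝ := (a + b) / 2 with hmu
  set F : ℝ → ℝ := fun lam => ∑' ξ, spectralTerm τ lam ξ with hF
  have hsub : ∀ lam, a < lam → lam < b → HasSum (fun ξ => (lam - mu) /
      (((normSq ξ : ℝ) - lam) * ((normSq ξ : ℝ) - mu))) (F lam - F mu) := by
    intro lam h1 h2
    refine ((summable_spectralTerm τ lam).hasSum.sub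
      (summable_spectralTerm τ mu).hasSum).congr_fun fun ξ => ?_
    rw [spectralTerm_sub (hne h1 h2 ξ) (hne (by linarith) (by linarith) ξ)]
  have hpos : ∀ lam, a < lam → lam < b → ∀ ξ,
      0 < ((normSq ξ : ℝ) - lam) * ((normSq ξ : ℝ) - mu) := by
    intro lam h1 h2 ξ
    rcases hgap' ξ with h | h
    · exact mul_pos_of_neg_of_neg (by linarith) (by linarith)
    · exact mul_pos (by linarith) (by linarith)
  -- Near an endpoint of the gap, the corresponding term of the series dominates.
  set t : ℝ := (|F mu| + 1 + 2 / (b - a))⁻¹ with ht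
  have hba : 0 < b - a := by linarith
  have ht0 : 0 < t := by positivity
  have htinv : t⁻¹ = |F mu| + 1 + 2 / (b - a) := by rw [ht, inv_inv]
  have ht1 : t < (b - a) / 2 := by
    rw [ht, inv_lt_comm₀ (by positivity) (by positivity), inv_div]
    linarith [abs_nonneg (F mu)]
  have hval : ((b - a) / 2 - t) / (t * ((b - a) / 2)) = |F mu| + 1 := by
    have : ((b - a) / 2 - t) / (t * ((b - a) / 2)) = t⁻¹ - 2 / (b - a) := by field_simp
    rw [this, htinv]; ring
  have hright : 0 ≤ F (b - t) := by
    have h := hsub (b - t) (by linarith) (by linarith)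
    have h2 := sum_le_hasSum {β} (fun ξ _ =>
      div_nonneg (by linarith) (hpos (b - t) (by linarith) (by linarith) ξ).le) h
    rw [Finset.sum_singleton] at h2
    have h3 : (b - t - mu) / (((normSq β : ℝ) - (b - t)) * ((normSq β : ℝ) - mu))
        = |F mu| + 1 := by
      rw [← hval, ← hb]; congr 1 <;> rw [hmu] <;> ring
    rw [h3] at h2
    linarith [neg_abs_le (F mu)]
  have hleft : F (a + t) ≤ 0 := by
    have h := (hsub (a + t) (by linarith) (by linarith)).neg
    have h2 := sum_le_hasSum {α} (fun ξ _ => by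
      rw [← neg_div]
      exact div_nonneg (by linarith) (hpos (a + t) (by linarith) (by linarith) ξ).le) h
    rw [Finset.sum_singleton] at h2
    have h3 : -((a + t - mu) / (((normSq α : ℝ) - (a + t)) * ((normSq α : ℝ) - mu)))
        = |F mu| + 1 := by
      rw [← hval, ← ha, ← neg_div]; congr 1 <;> rw [hmu] <;> ring
    rw [h3] at h2
    linarith [le_abs_self (F mu)]
  have hle : a + t ≤ b - t := by linarith
  have hcont : ContinuousOn F (Set.Icc (a + t) (b - t)) := by
    have hlow : ∀ lam ∈ Set.Icc (a + t) (b - t), ∀ ξ,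
        1 + (normSq ξ : ℝ) ≤ ((1 + b) / t + 1) * |(normSq ξ : ℝ) - lam| := by
      intro lam hlam ξ
      have h1 : t ≤ |(normSq ξ : ℝ) - lam| := by
        rcases hgap' ξ with h | h
        · rw [abs_sub_comm]; exact le_trans (by linarith [hlam.1]) (le_abs_self _)
        · exact le_trans (by linarith [hlam.2]) (le_abs_self _)
      have h2 : 1 + b ≤ (1 + b) / t * |(normSq ξ : ℝ) - lam| := by
        rw [div_mul_eq_mul_div, le_div_iff₀ ht0]
        exact mul_le_mul_of_nonneg_left h1 (by linarith)
      have h3 := le_abs_self ((normSq ξ : ℝ) - lam)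
      linarith [hlam.2]
    have hmumem : mu ∈ Set.Icc (a + t) (b - t) := ⟨by linarith, by linarith⟩
    set D : ℝ := (1 + b) / t + 1
    have hD : 0 < D := by
      have : 0 < (1 + b) / t := div_pos (by linarith) ht0
      linarith
    have hEq : Set.EqOn F (fun lam => F mu + ∑' ξ : Fin 2 → ℤ, (lam - mu) /
        (((normSq ξ : ℝ) - lam) * ((normSq ξ : ℝ) - mu))) (Set.Icc (a + t) (b - t)) := by
      intro lam hlam
      have := (hsub lam (by linarith [hlam.1]) (by linarith [hlam.2])).tsum_eq
      simp only [this]; ring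
    refine ContinuousOn.congr ?_ hEq
    refine continuousOn_const.add (continuousOn_tsum (fun ξ => ?_)
      (summable_inv_one_add_normSq_sq.mul_left ((b - a) * D ^ 2)) fun ξ lam hlam => ?_)
    · refine ContinuousOn.div (by fun_prop) (by fun_prop) fun lam hlam => ?_
      exact (hpos lam (by linarith [hlam.1]) (by linarith [hlam.2]) ξ).ne'
    · have h0 : (0 : ℝ) ≤ normSq ξ := by exact_mod_cast normSq_nonneg ξ
      have h1 := hlow lam hlam ξ
      have h2 := hlow mu hmumem ξ
      have h3 := hpos lam (by linarith [hlam.1]) (by linarith [hlam.2]) ξ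
      have h4 : |lam - mu| ≤ b - a := by
        rw [abs_le]; constructor <;> linarith [hlam.1, hlam.2]
      rw [Real.norm_eq_abs, abs_div, div_le_iff₀ (abs_pos.2 h3.ne'), abs_mul]
      refine h4.trans ?_
      have h5 : (1 + (normSq ξ : ℝ)) ^ 2
          ≤ D ^ 2 * (|(normSq ξ : ℝ) - lam| * |(normSq ξ : ℝ) - mu|) := by
        calc (1 + (normSq ξ : ℝ)) ^ 2 = (1 + (normSq ξ : ℝ)) * (1 + (normSq ξ : ℝ)) := sq _
          _ ≤ (D * |(normSq ξ : ℝ) - lam|) * (D * |(normSq ξ : ℝ) - mu|) := by gcongr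
          _ = _ := by ring
      calc b - a = (b - a) * ((1 + (normSq ξ : ℝ)) ^ 2)⁻¹ * (1 + (normSq ξ : ℝ)) ^ 2 := by
            field_simp
        _ ≤ (b - a) * ((1 + (normSq ξ : ℝ)) ^ 2)⁻¹ *
            (D ^ 2 * (|(normSq ξ : ℝ) - lam| * |(normSq ξ : ℝ) - mu|)) := by gcongr
        _ = _ := by ring
  obtain ⟨lam, hlam, hzero⟩ := intermediate_value_Icc hle hcont ⟨hleft, hright⟩
  refine ⟨lam, by linarith [hlam.1], by linarith [hlam.2], ?_⟩
  rw [← hzero]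
  exact (summable_spectralTerm τ lam).hasSum

/-! ### Counting pairs of close lattice points near a common circle -/

/-- The weight `1 / (1 + |t|)` of an integer `t`. -/
def weight (t : ℤ) : ℝ := (1 + |(t : ℝ)|)⁻¹

lemma weight_pos (t : ℤ) : 0 < weight t := by unfold weight; positivity

lemma weight_zero : weight 0 = 1 := by simp [weight]

lemma weight_neg (t : ℤ) : weight (-t) = weight t := by simp [weight]

/-- A product of two weights is controlled by the weight of the difference of their arguments;
this separates the sum over `m` in the mean of `pairSum m K` from the sum over lattice points. -/
lemma weight_mul_le (a b : ℤ) : weight a * weight b ≤ weight (b - a) * (weight a + weight b) := by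
  have h : |((b - a : ℤ) : ℝ)| ≤ |(a : ℝ)| + |(b : ℝ)| := by
    push_cast
    linarith [abs_sub (b : ℝ) (a : ℝ)]
  unfold weight
  have e : (1 + |(a : ℝ)|)⁻¹ * (1 + |(b : ℝ)|)⁻¹
      = ((1 + |(a : ℝ)|) + (1 + |(b : ℝ)|))⁻¹ * ((1 + |(a : ℝ)|)⁻¹ + (1 + |(b : ℝ)|)⁻¹) := by
    field_simp
    ring
  rw [e]
  refine mul_le_mul_of_nonneg_right (inv_anti₀ (by positivity) ?_) (by positivity)
  linarith

/-- The points of `ℤ²` of sup norm at most `K`. -/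
def box (K : ℕ) : Finset (Fin 2 → ℤ) := Fintype.piFinset fun _ => Finset.Icc (-K : ℤ) K

lemma mem_box {K : ℕ} {ξ : Fin 2 → ℤ} : ξ ∈ box K ↔ ∀ j, |ξ j| ≤ K := by
  simp [box, Fintype.mem_piFinset, abs_le]

lemma normSq_eq (ξ : Fin 2 → ℤ) : normSq ξ = ξ 0 ^ 2 + ξ 1 ^ 2 := by
  simp [normSq, Fin.sum_univ_two]

lemma normSq_add_sub (ξ ζ : Fin 2 → ℤ) : normSq (ξ + ζ) - normSq ξ
    = 2 * (ξ 0 * ζ 0 + ξ 1 * ζ 1) + normSq ζ := by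
  simp only [normSq_eq, Pi.add_apply]; ring

lemma normSq_le_of_mem_box {K : ℕ} {ξ : Fin 2 → ℤ} (h : ξ ∈ box K) : normSq ξ ≤ 2 * (K : ℤ) ^ 2 := by
  rw [mem_box] at h
  have h0 := sq_le_sq' (abs_le.1 (h 0)).1 (abs_le.1 (h 0)).2
  have h1 := sq_le_sq' (abs_le.1 (h 1)).1 (abs_le.1 (h 1)).2
  rw [normSq_eq]; linarith

/-- The points of a box on a line orthogonal to `ζ`: their `i`-th coordinates determine them and
lie in one residue class modulo `|ζ j| / gcd (ζ i, ζ j)`. -/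
lemma card_filter_normSq_add_sub_le (R : ℕ) (ζ : Fin 2 → ℤ) {i j : Fin 2} (hij : i ≠ j)
    (hj : ζ j ≠ 0) (t : ℤ) :
    (((box R).filter fun ξ => normSq (ξ + ζ) - normSq ξ = t).card : ℝ)
      ≤ (2 * R + 1) * (Int.gcd (ζ j) (ζ i) / |(ζ j : ℝ)|) + 1 := by
  have hsum : ∀ ξ : Fin 2 → ℤ, ξ 0 * ζ 0 + ξ 1 * ζ 1 = ξ i * ζ i + ξ j * ζ j := by
    intro ξ
    fin_cases i <;> fin_cases j <;> simp_all
    ring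
  set S := (box R).filter fun ξ => normSq (ξ + ζ) - normSq ξ = t with hS
  rcases S.eq_empty_or_nonempty with h | ⟨ξ₀, hξ₀⟩
  · rw [h]; simp; positivity
  have hline : ∀ ξ ∈ S, ξ i * ζ i + ξ j * ζ j = ξ₀ i * ζ i + ξ₀ j * ζ j := by
    intro ξ hξ
    have h1 := (Finset.mem_filter.1 hξ).2
    have h2 := (Finset.mem_filter.1 hξ₀).2
    rw [normSq_add_sub, hsum] at h1 h2
    linarith
  set d : ℤ := |ζ j| / Int.gcd |ζ j| (ζ i) with hd
  have hjpos : 0 < |ζ j| := abs_pos.2 hj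
  have hgdvd : (Int.gcd |ζ j| (ζ i) : ℤ) ∣ |ζ j| := Int.gcd_dvd_left _ _
  have hgpos : (0 : ℤ) < Int.gcd |ζ j| (ζ i) := by
    exact_mod_cast Int.gcd_pos_of_ne_zero_left _ hjpos.ne'
  have hdpos : 0 < d := Int.ediv_pos_of_pos_of_dvd hjpos hgpos.le hgdvd
  have hmod : ∀ ξ ∈ S, ξ i ≡ ξ₀ i [ZMOD d] := by
    intro ξ hξ
    apply Int.ModEq.cancel_left_div_gcd hjpos
    apply Int.modEq_of_dvd
    rw [abs_dvd]
    exact ⟨ξ j - ξ₀ j, by linarith [hline ξ hξ]⟩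
  have hcard : S.card ≤ ((Finset.Ioc (-R - 1 : ℤ) R).filter fun x => x ≡ ξ₀ i [ZMOD d]).card := by
    refine Finset.card_le_card_of_injOn (fun ξ => ξ i) ?_ ?_
    · intro ξ hξ
      have hb := abs_le.1 (mem_box.1 (Finset.mem_filter.1 hξ).1 i)
      simp only [Finset.coe_filter, Finset.mem_Ioc, Set.mem_ofPred_eq]
      exact ⟨⟨by linarith, hb.2⟩, hmod ξ hξ⟩
    · intro ξ hξ ξ' hξ' h
      have h1 := hline ξ hξ
      have h2 := hline ξ' hξ'
      simp only at h
      rw [h] at h1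
      have h3 : ξ j * ζ j = ξ' j * ζ j := by linarith
      have h4 := mul_right_cancel₀ hj h3
      ext k
      have hk : k = i ∨ k = j := by omega
      rcases hk with rfl | rfl
      · exact h
      · exact h4
  have hcount := Int.Ioc_filter_modEq_card (-R - 1 : ℤ) R hdpos (ξ₀ i)
  have hdQ : (0 : ℚ) < d := by exact_mod_cast hdpos
  have hle : ((((Finset.Ioc (-R - 1 : ℤ) R).filter fun x => x ≡ ξ₀ i [ZMOD d]).card : ℤ) : ℚ)
      ≤ (2 * R + 1) / d + 1 := by
    rw [hcount]
    push_cast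
    apply max_le
    · have h1 := Int.floor_le (((R : ℚ) - ξ₀ i) / d)
      have h2 := Int.lt_floor_add_one ((-(R : ℚ) - 1 - ξ₀ i) / d)
      have h3 : ((R : ℚ) - ξ₀ i) / d - (-(R : ℚ) - 1 - ξ₀ i) / d = (2 * R + 1) / d := by
        field_simp; ring
      linarith
    · positivity
  have hleR : ((((Finset.Ioc (-R - 1 : ℤ) R).filter fun x => x ≡ ξ₀ i [ZMOD d]).card : ℝ))
      ≤ (2 * R + 1) / (d : ℝ) + 1 := by exact_mod_cast hle
  have hdR : (d : ℝ) = |(ζ j : ℝ)| / Int.gcd (ζ j) (ζ i) := by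
    rw [hd, Int.cast_div hgdvd (by exact_mod_cast hgpos.ne')]
    simp [Int.gcd, Int.natAbs_abs]
  calc (S.card : ℝ) ≤ _ := by exact_mod_cast hcard
    _ ≤ _ := hleR
    _ = _ := by rw [hdR, div_div_eq_mul_div, mul_div_assoc]

/-- The sum of `weight` over the integers of absolute value at most `Y` is at most logarithmic. -/
lemma sum_weight_le (Y : ℕ) : ∑ t ∈ Finset.Icc (-Y : ℤ) Y, weight t ≤ 2 * (harmonic (Y + 1) : ℝ) := by
  have hsub : Finset.Icc (-Y : ℤ) Y ⊆ (Finset.range (Y + 1)).image (fun n : ℕ => (n : ℤ))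
      ∪ (Finset.range (Y + 1)).image (fun n : ℕ => -(n : ℤ)) := by
    intro t ht
    rw [Finset.mem_Icc] at ht
    simp only [Finset.mem_union, Finset.mem_image, Finset.mem_range]
    rcases le_total 0 t with h | h
    · exact Or.inl ⟨t.toNat, by omega, by omega⟩
    · exact Or.inr ⟨(-t).toNat, by omega, by omega⟩
  have hH : ∑ n ∈ Finset.range (Y + 1), weight (n : ℤ) = (harmonic (Y + 1) : ℝ) := by
    rw [harmonic]
    push_cast
    refine Finset.sum_congr rfl fun n _ => ?_
    rw [weight]
    simp [add_comm]
  calc _ ≤ _ := Finset.sum_le_sum_of_subset_of_nonneg hsub fun t _ _ => (weight_pos t).le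
    _ ≤ ∑ t ∈ (Finset.range (Y + 1)).image (fun n : ℕ => (n : ℤ)), weight t
        + ∑ t ∈ (Finset.range (Y + 1)).image (fun n : ℕ => -(n : ℤ)), weight t := by
        rw [← Finset.sum_union_inter]
        exact le_add_of_nonneg_right (Finset.sum_nonneg fun t _ => (weight_pos t).le)
    _ = _ := by
        rw [Finset.sum_image (by simp), Finset.sum_image (by simp)]
        simp only [weight_neg, hH]
        ring

lemma sum_weight_comp_le {ι : Type*} (s : Finset ι) (f : ι → ℤ) {Y : ℕ} {B : ℝ}
    (hf : ∀ i ∈ s, |f i| ≤ Y) (hB : ∀ t, ((s.filter fun i => f i = t).card : ℝ) ≤ B) :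
    ∑ i ∈ s, weight (f i) ≤ B * (2 * (harmonic (Y + 1) : ℝ)) := by
  have hmaps : ∀ i ∈ s, f i ∈ Finset.Icc (-Y : ℤ) Y := fun i hi =>
    Finset.mem_Icc.2 (abs_le.1 (hf i hi))
  rw [← Finset.sum_fiberwise_of_maps_to hmaps]
  have hB0 : 0 ≤ B := le_trans (Nat.cast_nonneg _) (hB 0)
  calc _ ≤ ∑ t ∈ Finset.Icc (-Y : ℤ) Y, B * weight t := by
        refine Finset.sum_le_sum fun t _ => ?_
        rw [Finset.sum_congr rfl fun i hi => by rw [(Finset.mem_filter.1 hi).2], Finset.sum_const,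
          nsmul_eq_mul]
        exact mul_le_mul_of_nonneg_right (hB t) (weight_pos t).le
    _ ≤ _ := by
        rw [← Finset.mul_sum]
        exact mul_le_mul_of_nonneg_left (sum_weight_le Y) hB0

/-- The greatest common divisor with `q` is at most the number of divisors of `q` on average. -/
lemma sum_gcd_le (q : ℕ) (hq : 1 ≤ q) :
    ∑ b ∈ Finset.Icc (-q : ℤ) q, (Int.gcd q b : ℝ) ≤ 4 * q * (q.divisors.card : ℝ) := by
  have h1 : ∀ b : ℤ, (Int.gcd q b : ℝ) ≤ ∑ d ∈ q.divisors, if (d : ℤ) ∣ b then (d : ℝ) else 0 := by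
    intro b
    have hmem : Int.gcd q b ∈ q.divisors := by
      rw [Nat.mem_divisors]
      exact ⟨by exact_mod_cast Int.gcd_dvd_left (q : ℤ) b, by omega⟩
    have := Finset.single_le_sum (f := fun d : ℕ => if (d : ℤ) ∣ b then (d : ℝ) else 0)
      (fun d _ => by split_ifs <;> positivity) hmem
    simpa [Int.gcd_dvd_right] using this
  calc _ ≤ ∑ b ∈ Finset.Icc (-q : ℤ) q, ∑ d ∈ q.divisors, if (d : ℤ) ∣ b then (d : ℝ) else 0 :=
        Finset.sum_le_sum fun b _ => h1 b
    _ = ∑ d ∈ q.divisors, ∑ b ∈ Finset.Icc (-q : ℤ) q, if (d : ℤ) ∣ b then (d : ℝ) else 0 :=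
        Finset.sum_comm
    _ ≤ ∑ d ∈ q.divisors, (4 * q : ℝ) := by
        refine Finset.sum_le_sum fun d hd => ?_
        have hdpos : 0 < d := Nat.pos_of_mem_divisors hd
        have hdq : d ≤ q := Nat.divisor_le hd
        have hdQ : (0 : ℚ) < d := by exact_mod_cast hdpos
        rw [← Finset.sum_filter, Finset.sum_const, nsmul_eq_mul]
        have hIcc : Finset.Icc (-q : ℤ) q = Finset.Ioc (-q - 1 : ℤ) q := by
          ext; simp only [Finset.mem_Icc, Finset.mem_Ioc]; omega
        have hcount := Int.Ioc_filter_modEq_card (-q - 1 : ℤ) q (r := (d : ℤ))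
          (by exact_mod_cast hdpos) 0
        simp only [Int.modEq_zero_iff_dvd] at hcount
        have hle : ((((Finset.Icc (-q : ℤ) q).filter fun x => (d : ℤ) ∣ x).card : ℤ) : ℚ)
            ≤ (2 * q + 1) / d + 1 := by
          rw [hIcc, hcount]
          push_cast
          apply max_le
          · have h1 := Int.floor_le (((q : ℚ) - 0) / d)
            have h2 := Int.lt_floor_add_one ((-(q : ℚ) - 1 - 0) / d)
            have h3 : ((q : ℚ) - 0) / d - (-(q : ℚ) - 1 - 0) / d = (2 * q + 1) / d := by
              field_simp; ring
            linarith
          · positivity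
        have hle' : (((Finset.Icc (-q : ℤ) q).filter fun x => (d : ℤ) ∣ x).card : ℝ)
            ≤ (2 * q + 1) / (d : ℝ) + 1 := by
          rw [← Rat.cast_le (K := ℝ)] at hle
          push_cast at hle
          exact hle
        have hdR : (0 : ℝ) < d := by exact_mod_cast hdpos
        have hdqR : (d : ℝ) ≤ q := by exact_mod_cast hdq
        have hqR : (1 : ℝ) ≤ q := by exact_mod_cast hq
        calc _ ≤ ((2 * q + 1) / d + 1) * (d : ℝ) := by gcongr
          _ = 2 * q + 1 + d := by field_simp
          _ ≤ _ := by linarith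
    _ = _ := by rw [Finset.sum_const, nsmul_eq_mul]; ring

lemma sum_card_divisors_le (K : ℕ) :
    ∑ q ∈ Finset.Icc 1 K, (q.divisors.card : ℝ) ≤ K * (harmonic K : ℝ) := by
  have h1 : ∀ q ∈ Finset.Icc 1 K, (q.divisors.card : ℝ)
      = ∑ d ∈ Finset.Icc 1 K, if d ∣ q then 1 else 0 := by
    intro q hq
    rw [Finset.mem_Icc] at hq
    rw [Finset.sum_boole]
    congr 2
    ext d
    simp only [Nat.mem_divisors, Finset.mem_filter, Finset.mem_Icc]
    constructor
    · rintro ⟨h, h'⟩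
      exact ⟨⟨Nat.pos_of_dvd_of_pos h (by omega), (Nat.le_of_dvd (by omega) h).trans hq.2⟩, h⟩
    · rintro ⟨_, h⟩
      exact ⟨h, by omega⟩
  rw [Finset.sum_congr rfl h1, Finset.sum_comm, harmonic_eq_sum_Icc]
  push_cast
  rw [Finset.mul_sum]
  refine Finset.sum_le_sum fun d _ => ?_
  rw [Finset.sum_boole]
  have h2 : (Finset.Icc 1 K).filter (fun q => d ∣ q) = (Finset.Ioc 0 K).filter fun q => d ∣ q := by
    ext; simp only [Finset.mem_filter, Finset.mem_Icc, Finset.mem_Ioc]; omega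
  rw [h2, Nat.Ioc_filter_dvd_card_eq_div]
  rw [← div_eq_mul_inv]
  exact Nat.cast_div_le

lemma harmonic_mono {a b : ℕ} (h : a ≤ b) : (harmonic a : ℝ) ≤ harmonic b := by
  have : harmonic a ≤ harmonic b := by
    unfold harmonic
    exact Finset.sum_le_sum_of_subset_of_nonneg (Finset.range_mono h) fun i _ _ => by positivity
  exact_mod_cast this

lemma one_le_harmonic_succ (n : ℕ) : (1 : ℝ) ≤ harmonic (n + 1) := by
  have h := harmonic_mono (Nat.le_add_left 1 n)
  simpa [harmonic] using h

lemma sum_natAbs_le (K : ℕ) {f : ℕ → ℝ} (hf : ∀ q, 0 ≤ f q) :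
    ∑ a ∈ (Finset.Icc (-K : ℤ) K).erase 0, f a.natAbs ≤ 2 * ∑ q ∈ Finset.Icc 1 K, f q := by
  have hsub : (Finset.Icc (-K : ℤ) K).erase 0 ⊆ (Finset.Icc 1 K).image (fun n : ℕ => (n : ℤ))
      ∪ (Finset.Icc 1 K).image (fun n : ℕ => -(n : ℤ)) := by
    intro t ht
    simp only [Finset.mem_erase, Finset.mem_Icc] at ht
    simp only [Finset.mem_union, Finset.mem_image, Finset.mem_Icc]
    rcases le_total 0 t with h | h
    · exact Or.inl ⟨t.toNat, by omega, by omega⟩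
    · exact Or.inr ⟨(-t).toNat, by omega, by omega⟩
  calc _ ≤ _ := Finset.sum_le_sum_of_subset_of_nonneg hsub fun t _ _ => hf _
    _ ≤ ∑ t ∈ (Finset.Icc 1 K).image (fun n : ℕ => (n : ℤ)), f t.natAbs
        + ∑ t ∈ (Finset.Icc 1 K).image (fun n : ℕ => -(n : ℤ)), f t.natAbs := by
        rw [← Finset.sum_union_inter]
        exact le_add_of_nonneg_right (Finset.sum_nonneg fun t _ => hf _)
    _ = _ := by
        rw [Finset.sum_image (by simp), Finset.sum_image (by simp)]
        simp only [Int.natAbs_neg, Int.natAbs_natCast]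
        ring

/-- The shifts `ζ` with a dominant coordinate `j` contribute `O (R K log K)`. -/
lemma sum_gcd_div_le {R K : ℕ} (hK : 1 ≤ K) (hKR : K ≤ R) {i j : Fin 2} (hij : i ≠ j) :
    ∑ ζ ∈ (box K).filter (fun ζ => ζ j ≠ 0 ∧ |ζ i| ≤ |ζ j|),
      ((2 * R + 1) * (Int.gcd (ζ j) (ζ i) / |(ζ j : ℝ)|) + 1) ≤ 30 * R * K * (harmonic K : ℝ) := by
  have hKR' : (K : ℝ) ≤ R := by exact_mod_cast hKR
  have hK' : (1 : ℝ) ≤ K := by exact_mod_cast hK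
  set G : ℤ → ℤ → ℝ := fun a b => (2 * R + 1) * (Int.gcd a b / |(a : ℝ)|) + 1 with hG
  have hG0 : ∀ a b, 0 ≤ G a b := fun a b => by simp only [hG]; positivity
  set S := (box K).filter (fun ζ => ζ j ≠ 0 ∧ |ζ i| ≤ |ζ j|) with hS
  set A := ((Finset.Icc (-K : ℤ) K).erase 0).sigma
    fun a => Finset.Icc (-(a.natAbs : ℤ)) a.natAbs with hA
  let e : (Fin 2 → ℤ) → (_ : ℤ) × ℤ := fun ζ => ⟨ζ j, ζ i⟩
  have hinj : Set.InjOn e S := by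
    intro ζ _ ζ' _ h
    have h1 : ζ j = ζ' j := congrArg Sigma.fst h
    have h2 : ζ i = ζ' i := congrArg (fun p : (_ : ℤ) × ℤ => p.2) h
    ext k
    have hk : k = i ∨ k = j := by omega
    rcases hk with rfl | rfl
    · exact h2
    · exact h1
  have hsub : S.image e ⊆ A := by
    intro p hp
    obtain ⟨ζ, hζ, rfl⟩ := Finset.mem_image.1 hp
    obtain ⟨hbox, h1, h2⟩ := Finset.mem_filter.1 hζ
    have hb := abs_le.1 (mem_box.1 hbox j)
    simp only [hA, e, Finset.mem_sigma, Finset.mem_erase, Finset.mem_Icc, Int.natCast_natAbs]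
    exact ⟨⟨h1, hb⟩, abs_le.1 h2⟩
  have hinner : ∀ a ∈ (Finset.Icc (-K : ℤ) K).erase 0,
      ∑ b ∈ Finset.Icc (-(a.natAbs : ℤ)) a.natAbs, G a b
        ≤ 12 * R * (a.natAbs.divisors.card : ℝ) + 3 * K := by
    intro a ha
    simp only [Finset.mem_erase, Finset.mem_Icc] at ha
    have hq : 1 ≤ a.natAbs := by omega
    have hqK : (a.natAbs : ℝ) ≤ K := by
      have : a.natAbs ≤ K := by omega
      exact_mod_cast this
    have hq' : (1 : ℝ) ≤ a.natAbs := by exact_mod_cast hq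
    have habs : |(a : ℝ)| = a.natAbs := by
      rw [Nat.cast_natAbs, Int.cast_abs]
    have hgcd : ∀ b : ℤ, Int.gcd a b = Int.gcd (a.natAbs : ℤ) b := fun b => by simp [Int.gcd, Int.natAbs_abs]
    have hs := sum_gcd_le a.natAbs hq
    simp only [hG, habs, hgcd]
    rw [Finset.sum_add_distrib, ← Finset.mul_sum, ← Finset.sum_div, Finset.sum_const,
      nsmul_eq_mul, mul_one, Int.card_Icc]
    have hcard : ((((a.natAbs : ℤ) + 1 - -(a.natAbs : ℤ)).toNat : ℕ) : ℝ) = 2 * a.natAbs + 1 := by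
      have : ((a.natAbs : ℤ) + 1 - -(a.natAbs : ℤ)).toNat = 2 * a.natAbs + 1 := by omega
      rw [this]; push_cast; ring
    rw [hcard]
    have h1 : (∑ b ∈ Finset.Icc (-(a.natAbs : ℤ)) a.natAbs, (Int.gcd (a.natAbs : ℤ) b : ℝ))
        / (a.natAbs : ℝ) ≤ 4 * (a.natAbs.divisors.card : ℝ) := by
      rw [div_le_iff₀ (by linarith)]
      linarith
    have h2 : (2 * (R : ℝ) + 1) * (4 * (a.natAbs.divisors.card : ℝ))
        ≤ (3 * R) * (4 * (a.natAbs.divisors.card : ℝ)) := by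
      gcongr; linarith
    have h3 := mul_le_mul_of_nonneg_left h1 (by positivity : (0 : ℝ) ≤ 2 * R + 1)
    linarith
  have hH : (1 : ℝ) ≤ harmonic K := by
    obtain ⟨k, rfl⟩ := Nat.exists_eq_add_of_le' hK
    exact one_le_harmonic_succ k
  calc ∑ ζ ∈ S, G (ζ j) (ζ i) = ∑ p ∈ S.image e, G p.1 p.2 := by rw [Finset.sum_image hinj]
    _ ≤ ∑ p ∈ A, G p.1 p.2 :=
        Finset.sum_le_sum_of_subset_of_nonneg hsub fun p _ _ => hG0 _ _
    _ = ∑ a ∈ (Finset.Icc (-K : ℤ) K).erase 0,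
          ∑ b ∈ Finset.Icc (-(a.natAbs : ℤ)) a.natAbs, G a b := by rw [hA, Finset.sum_sigma]
    _ ≤ ∑ a ∈ (Finset.Icc (-K : ℤ) K).erase 0,
          (12 * R * (a.natAbs.divisors.card : ℝ) + 3 * K) := Finset.sum_le_sum hinner
    _ ≤ 2 * ∑ q ∈ Finset.Icc 1 K, (12 * R * (q.divisors.card : ℝ) + 3 * K) :=
        sum_natAbs_le K (f := fun q => 12 * R * (q.divisors.card : ℝ) + 3 * K)
          fun q => by positivity
    _ ≤ 2 * (12 * R * (K * (harmonic K : ℝ)) + K * (3 * K)) := by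
        rw [Finset.sum_add_distrib, ← Finset.mul_sum, Finset.sum_const, nsmul_eq_mul,
          Nat.card_Icc, Nat.add_sub_cancel]
        gcongr
        exact sum_card_divisors_le K
    _ ≤ 30 * R * K * (harmonic K : ℝ) := by
        have : (K : ℝ) * K ≤ R * K * (harmonic K : ℝ) := by
          calc (K : ℝ) * K ≤ R * K := by gcongr
            _ ≤ R * K * (harmonic K : ℝ) := le_mul_of_one_le_right (by positivity) hH
        linarith

lemma abs_normSq_add_sub_le {R K : ℕ} (hKR : K ≤ R) {ξ ζ : Fin 2 → ℤ} (hξ : ξ ∈ box R)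
    (hζ : ζ ∈ box K) : |normSq (ξ + ζ) - normSq ξ| ≤ ((8 * R ^ 2 : ℕ) : ℤ) := by
  have hadd : ξ + ζ ∈ box (2 * R) := by
    rw [mem_box] at *
    intro j
    have := abs_add_le (ξ j) (ζ j)
    have h1 := hξ j
    have h2 := hζ j
    simp only [Pi.add_apply]
    push_cast
    have : (K : ℤ) ≤ R := by exact_mod_cast hKR
    linarith
  have h1 := normSq_le_of_mem_box hadd
  have h2 := normSq_le_of_mem_box hξ
  have h3 := normSq_nonneg ξ
  have h4 := normSq_nonneg (ξ + ζ)
  push_cast at *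
  rw [abs_le]
  constructor <;> nlinarith [sq_nonneg (R : ℤ)]

/-- Pairs of points `ξ, ξ + ζ` of a box of size `R`, at distance at most `K`, weighted according to
the difference of `|ξ|²` and `|ξ + ζ|²`: up to logarithms there are `R K` of them. -/
lemma sum_weight_normSq_sub_le {R K : ℕ} (hK : 1 ≤ K) (hKR : K ≤ R) :
    ∑ ζ ∈ (box K).erase 0, ∑ ξ ∈ box R, weight (normSq (ξ + ζ) - normSq ξ)
      ≤ 120 * R * K * (harmonic (8 * R ^ 2 + 1) : ℝ) ^ 2 := by
  set H : ℝ := (harmonic (8 * R ^ 2 + 1) : ℝ) with hH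
  have hH1 : 1 ≤ H := one_le_harmonic_succ _
  have hHK : (harmonic K : ℝ) ≤ H := by
    refine harmonic_mono (hKR.trans ?_)
    nlinarith [sq_nonneg (R : ℤ)]
  set g : Fin 2 → Fin 2 → (Fin 2 → ℤ) → ℝ := fun i j ζ =>
    (2 * R + 1) * (Int.gcd (ζ j) (ζ i) / |(ζ j : ℝ)|) + 1 with hg
  set S : Fin 2 → Fin 2 → Finset (Fin 2 → ℤ) := fun i j =>
    (box K).filter (fun ζ => ζ j ≠ 0 ∧ |ζ i| ≤ |ζ j|) with hS
  have hterm : ∀ i j : Fin 2, i ≠ j → ∀ ζ ∈ S i j,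
      ∑ ξ ∈ box R, weight (normSq (ξ + ζ) - normSq ξ) ≤ g i j ζ * (2 * H) := by
    intro i j hij ζ hζ
    obtain ⟨hbox, hj, -⟩ := Finset.mem_filter.1 hζ
    exact sum_weight_comp_le (box R) (fun ξ => normSq (ξ + ζ) - normSq ξ)
      (fun ξ hξ => abs_normSq_add_sub_le hKR hξ hbox)
      (fun t => card_filter_normSq_add_sub_le R ζ hij hj t)
  have hbound : ∀ i j : Fin 2, i ≠ j →
      ∑ ζ ∈ S i j, ∑ ξ ∈ box R, weight (normSq (ξ + ζ) - normSq ξ) ≤ 60 * R * K * H ^ 2 := by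
    intro i j hij
    calc _ ≤ ∑ ζ ∈ S i j, g i j ζ * (2 * H) := Finset.sum_le_sum (hterm i j hij)
      _ = (∑ ζ ∈ S i j, g i j ζ) * (2 * H) := by rw [Finset.sum_mul]
      _ ≤ (30 * R * K * (harmonic K : ℝ)) * (2 * H) := by
          gcongr
          exact sum_gcd_div_le hK hKR hij
      _ ≤ (30 * R * K * H) * (2 * H) := by gcongr
      _ = _ := by ring
  have hcover : (box K).erase 0 ⊆ S 1 0 ∪ S 0 1 := by
    intro ζ hζ
    rw [Finset.mem_erase] at hζ
    have hne : ζ 0 ≠ 0 ∨ ζ 1 ≠ 0 := by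
      by_contra! h
      exact hζ.1 (by ext k; fin_cases k; exacts [h.1, h.2])
    simp only [hS, Finset.mem_union, Finset.mem_filter, hζ.2, true_and]
    rcases le_total |ζ 1| |ζ 0| with h | h
    · refine Or.inl ⟨fun h0 => ?_, h⟩
      rw [h0, abs_zero] at h
      rcases hne with h1 | h1
      · exact h1 h0
      · exact h1 (abs_nonpos_iff.1 h)
    · refine Or.inr ⟨fun h0 => ?_, h⟩
      rw [h0, abs_zero] at h
      rcases hne with h1 | h1
      · exact h1 (abs_nonpos_iff.1 h)
      · exact h1 h0
  have hnonneg : ∀ ζ : Fin 2 → ℤ, 0 ≤ ∑ ξ ∈ box R, weight (normSq (ξ + ζ) - normSq ξ) :=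
    fun ζ => Finset.sum_nonneg fun ξ _ => (weight_pos _).le
  calc _ ≤ _ := Finset.sum_le_sum_of_subset_of_nonneg hcover fun ζ _ _ => hnonneg ζ
    _ ≤ ∑ ζ ∈ S 1 0, ∑ ξ ∈ box R, weight (normSq (ξ + ζ) - normSq ξ)
        + ∑ ζ ∈ S 0 1, ∑ ξ ∈ box R, weight (normSq (ξ + ζ) - normSq ξ) := by
        rw [← Finset.sum_union_inter]
        exact le_add_of_nonneg_right (Finset.sum_nonneg fun ζ _ => hnonneg ζ)
    _ ≤ 60 * R * K * H ^ 2 + 60 * R * K * H ^ 2 :=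
        add_le_add (hbound 1 0 (by decide)) (hbound 0 1 (by decide))
    _ = _ := by ring

/-- The number of pairs `ξ ≠ ξ'` of lattice points with `|ξ_j - ξ'_j| ≤ K`, weighted according to
the distances of `|ξ|²` and `|ξ'|²` to `m`. -/
def pairSum (m : ℤ) (K : ℕ) : ℝ :=
  ∑ ζ ∈ (box K).erase 0, ∑' ξ, weight (normSq ξ - m) * weight (normSq (ξ + ζ) - m)

lemma sum_weight_mul_weight_le {Y X : ℕ} (hXY : X ≤ Y) {a b : ℤ} (ha0 : 0 ≤ a) (haY : a ≤ Y)
    (hb0 : 0 ≤ b) (hbY : b ≤ Y) :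
    ∑ m ∈ Finset.Icc (0 : ℤ) X, weight (a - m) * weight (b - m)
      ≤ weight (b - a) * (4 * (harmonic (Y + 1) : ℝ)) := by
  have hXY' : (X : ℤ) ≤ Y := by exact_mod_cast hXY
  have h : ∀ c : ℤ, 0 ≤ c → c ≤ Y →
      ∑ m ∈ Finset.Icc (0 : ℤ) X, weight (c - m) ≤ 1 * (2 * (harmonic (Y + 1) : ℝ)) := by
    intro c hc hcY
    refine sum_weight_comp_le _ _ (fun m hm => ?_) (fun t => ?_)
    · rw [Finset.mem_Icc] at hm
      rw [abs_le]
      omega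
    · have : ((Finset.Icc (0 : ℤ) X).filter fun m => c - m = t).card ≤ 1 := by
        rw [Finset.card_le_one]
        intro m hm m' hm'
        have := (Finset.mem_filter.1 hm).2
        have := (Finset.mem_filter.1 hm').2
        omega
      exact_mod_cast this
  calc _ ≤ ∑ m ∈ Finset.Icc (0 : ℤ) X, weight (b - a) * (weight (a - m) + weight (b - m)) := by
        refine Finset.sum_le_sum fun m _ => ?_
        have := weight_mul_le (a - m) (b - m)
        rwa [sub_sub_sub_cancel_right] at this
    _ = weight (b - a) * (∑ m ∈ Finset.Icc (0 : ℤ) X, weight (a - m)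
          + ∑ m ∈ Finset.Icc (0 : ℤ) X, weight (b - m)) := by
        rw [← Finset.mul_sum, Finset.sum_add_distrib]
    _ ≤ _ := by
        refine mul_le_mul_of_nonneg_left ?_ (weight_pos _).le
        linarith [h a ha0 haY, h b hb0 hbY]

lemma box_mono {K R : ℕ} (h : K ≤ R) : box K ⊆ box R := fun ξ hξ => by
  rw [mem_box] at *
  intro j
  exact (hξ j).trans (by exact_mod_cast h)

lemma sum_near_le {R K X : ℕ} (hK : 1 ≤ K) (hKR : K ≤ R) (hX : X ≤ 8 * R ^ 2) :
    ∑ m ∈ Finset.Icc (0 : ℤ) X, ∑ ζ ∈ (box K).erase 0, ∑ ξ ∈ box R,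
      weight (normSq ξ - m) * weight (normSq (ξ + ζ) - m)
      ≤ 480 * R * K * (harmonic (8 * R ^ 2 + 1) : ℝ) ^ 3 := by
  set H : ℝ := (harmonic (8 * R ^ 2 + 1) : ℝ) with hH
  have hH1 : 1 ≤ H := one_le_harmonic_succ _
  rw [Finset.sum_comm]
  calc _ = ∑ ζ ∈ (box K).erase 0, ∑ ξ ∈ box R, ∑ m ∈ Finset.Icc (0 : ℤ) X,
        weight (normSq ξ - m) * weight (normSq (ξ + ζ) - m) := by
        refine Finset.sum_congr rfl fun ζ _ => Finset.sum_comm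
    _ ≤ ∑ ζ ∈ (box K).erase 0, ∑ ξ ∈ box R,
        weight (normSq (ξ + ζ) - normSq ξ) * (4 * H) := by
        refine Finset.sum_le_sum fun ζ hζ => Finset.sum_le_sum fun ξ hξ => ?_
        have hζ' := (Finset.mem_erase.1 hζ).2
        refine sum_weight_mul_weight_le hX (normSq_nonneg _) ?_ (normSq_nonneg _) ?_
        · have := normSq_le_of_mem_box hξ
          push_cast
          nlinarith [sq_nonneg (R : ℤ)]
        · have hadd : ξ + ζ ∈ box (2 * R) := by
            rw [mem_box] at *
            intro j
            have h1 := abs_add_le (ξ j) (ζ j)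
            have h2 := hξ j
            have h3 := hζ' j
            have h4 : (K : ℤ) ≤ R := by exact_mod_cast hKR
            simp only [Pi.add_apply]
            push_cast
            linarith
          have := normSq_le_of_mem_box hadd
          push_cast at *
          nlinarith [sq_nonneg (R : ℤ)]
    _ = (∑ ζ ∈ (box K).erase 0, ∑ ξ ∈ box R, weight (normSq (ξ + ζ) - normSq ξ)) * (4 * H) := by
        simp only [Finset.sum_mul]
    _ ≤ (120 * R * K * H ^ 2) * (4 * H) := by
        gcongr
        exact sum_weight_normSq_sub_le hK hKR
    _ = _ := by ring

lemma lt_normSq_of_notMem_box {R : ℕ} {ξ : Fin 2 → ℤ} (h : ξ ∉ box R) :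
    (R : ℤ) ^ 2 < normSq ξ := by
  rw [mem_box] at h
  push Not at h
  obtain ⟨j, hj⟩ := h
  have h1 : (R : ℤ) ^ 2 < ξ j ^ 2 := by
    rw [← sq_abs (ξ j)]
    exact pow_lt_pow_left₀ hj (by positivity) (by norm_num)
  exact h1.trans_le (Finset.single_le_sum (f := fun j => ξ j ^ 2) (fun _ _ => sq_nonneg _)
    (Finset.mem_univ j))

lemma sq_add_sq_le_eight_mul {R K a b z w : ℤ} (hKR : 2 * K ≤ R) (hba : |b| ≤ |a|) (ha : R < |a|)
    (hz : |z| ≤ K) : a ^ 2 + b ^ 2 ≤ 8 * ((a + z) ^ 2 + (b + w) ^ 2) := by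
  have h1 : |a| ≤ 2 * |a + z| := by
    have := abs_sub (a + z) z
    rw [add_sub_cancel_right] at this
    linarith
  have h2 : a ^ 2 ≤ 4 * (a + z) ^ 2 := by
    rw [← sq_abs a, ← sq_abs (a + z)]
    nlinarith [abs_nonneg a, abs_nonneg (a + z)]
  have h3 : b ^ 2 ≤ a ^ 2 := sq_le_sq.2 hba
  nlinarith [sq_nonneg (b + w)]

lemma normSq_le_eight_mul {R K : ℕ} (hKR : 2 * K ≤ R) {ξ ζ : Fin 2 → ℤ} (hξ : ξ ∉ box R)
    (hζ : ζ ∈ box K) : normSq ξ ≤ 8 * normSq (ξ + ζ) := by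
  have hKR' : 2 * (K : ℤ) ≤ R := by exact_mod_cast hKR
  rw [mem_box, Fin.forall_fin_two, not_and_or, not_le, not_le] at hξ
  rw [mem_box] at hζ
  rw [normSq_eq, normSq_eq, Pi.add_apply, Pi.add_apply]
  rcases le_total |ξ 1| |ξ 0| with h | h
  · exact sq_add_sq_le_eight_mul hKR' h (hξ.elim id h.trans_lt') (hζ 0)
  · rw [add_comm (ξ 0 ^ 2), add_comm ((ξ 0 + ζ 0) ^ 2)]
    exact sq_add_sq_le_eight_mul hKR' h (hξ.elim h.trans_lt' id) (hζ 1)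

/-- Lattice points far from the circle `|ξ|² = m`. -/
lemma weight_mul_weight_far_le {R K : ℕ} (hKR : 2 * K ≤ R) {m : ℤ} (hm : 0 ≤ m)
    (hmR : 16 * m ≤ (R : ℤ) ^ 2) {ξ ζ : Fin 2 → ℤ} (hξ : ξ ∉ box R) (hζ : ζ ∈ box K) :
    weight (normSq ξ - m) * weight (normSq (ξ + ζ) - m) ≤ 256 * ((1 + (normSq ξ : ℝ)) ^ 2)⁻¹ := by
  have h1 := lt_normSq_of_notMem_box hξ
  have h2 := normSq_le_eight_mul hKR hξ hζ
  have h0 : (0 : ℝ) ≤ normSq ξ := by exact_mod_cast normSq_nonneg ξ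
  have hw : ∀ t : ℤ, normSq ξ ≤ 16 * t → weight t ≤ 16 * (1 + (normSq ξ : ℝ))⁻¹ := by
    intro t ht
    have ht' : (normSq ξ : ℝ) ≤ 16 * t := by exact_mod_cast ht
    rw [weight, ← div_eq_mul_inv, inv_eq_one_div, div_le_div_iff₀ (by positivity) (by positivity)]
    linarith [le_abs_self (t : ℝ)]
  calc _ ≤ (16 * (1 + (normSq ξ : ℝ))⁻¹) * (16 * (1 + (normSq ξ : ℝ))⁻¹) :=
        mul_le_mul (hw _ (by linarith)) (hw _ (by linarith)) (weight_pos _).le (by positivity)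
    _ = _ := by rw [← inv_pow]; ring

lemma summable_weight_mul_weight {m : ℤ} (hm : 0 ≤ m) (ζ : Fin 2 → ℤ) :
    Summable fun ξ => weight (normSq ξ - m) * weight (normSq (ξ + ζ) - m) := by
  obtain ⟨K, hK⟩ : ∃ K : ℕ, ζ ∈ box K := ⟨(|ζ 0| + |ζ 1|).toNat, mem_box.2 fun j => by
    fin_cases j <;> simp⟩
  obtain ⟨M, rfl⟩ := Int.eq_ofNat_of_zero_le hm
  refine Summable.of_norm_bounded_eventually (summable_inv_one_add_normSq_sq.mul_left 256) ?_
  filter_upwards [(box (2 * K + 4 * M)).finite_toSet.compl_mem_cofinite] with ξ hξ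
  rw [Real.norm_of_nonneg (mul_pos (weight_pos _) (weight_pos _)).le]
  refine weight_mul_weight_far_le (R := 2 * K + 4 * M) (by omega) hm ?_ (by simpa using hξ) hK
  push_cast
  have : (M : ℤ) ≤ M ^ 2 := by
    have := Nat.le_self_pow two_ne_zero M
    exact_mod_cast this
  nlinarith [(Nat.cast_nonneg K : (0 : ℤ) ≤ K), (Nat.cast_nonneg M : (0 : ℤ) ≤ M)]

lemma card_box (K : ℕ) : (box K).card = (2 * K + 1) ^ 2 := by
  rw [box, Fintype.card_piFinset]
  simp only [Int.card_Icc, Finset.prod_const, Finset.card_univ, Fintype.card_fin]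
  congr 1
  omega

/-- Truncation of the sum over lattice points to a box. -/
lemma tsum_weight_mul_weight_le {δ : ℝ} (hδ : 0 < δ) (hδ1 : δ < 1) {R K : ℕ} (hKR : 2 * K ≤ R)
    {m : ℤ} (hm : 0 ≤ m) (hmR : 16 * m ≤ (R : ℤ) ^ 2) {ζ : Fin 2 → ℤ} (hζ : ζ ∈ box K) {T : ℝ}
    (hT : 0 < T) (hTR : T ≤ (R : ℝ) ^ 2) :
    ∑' ξ, weight (normSq ξ - m) * weight (normSq (ξ + ζ) - m)
      ≤ ∑ ξ ∈ box R, weight (normSq ξ - m) * weight (normSq (ξ + ζ) - m)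
        + 256 * (T ^ (-(1 - δ)) * ∑' ξ : Fin 2 → ℤ, (1 + (normSq ξ : ℝ)) ^ (-(1 + δ))) := by
  have hsum1 : HasSum (fun ξ => if ξ ∈ box R then
      weight (normSq ξ - m) * weight (normSq (ξ + ζ) - m) else 0)
      (∑ ξ ∈ box R, weight (normSq ξ - m) * weight (normSq (ξ + ζ) - m)) := by
    have h : HasSum (fun ξ => if ξ ∈ box R then
        weight (normSq ξ - m) * weight (normSq (ξ + ζ) - m) else 0)
        (∑ ξ ∈ box R, if ξ ∈ box R then
        weight (normSq ξ - m) * weight (normSq (ξ + ζ) - m) else 0) :=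
      hasSum_sum_of_ne_finset_zero fun ξ hξ => by simp [hξ]
    rwa [Finset.sum_congr rfl fun ξ hξ => if_pos hξ] at h
  have hsum2 := ((summable_one_add_normSq_rpow (s := 1 + δ) (by linarith)).hasSum.mul_left
    (T ^ (-(1 - δ)))).mul_left 256
  refine hasSum_le (fun ξ => ?_) (summable_weight_mul_weight hm ζ).hasSum (hsum1.add hsum2)
  have h0 : (0 : ℝ) ≤ normSq ξ := by exact_mod_cast normSq_nonneg ξ
  by_cases hξ : ξ ∈ box R
  · rw [if_pos hξ]
    exact le_add_of_nonneg_right (by positivity)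
  · rw [if_neg hξ, zero_add]
    refine (weight_mul_weight_far_le hKR hm hmR hξ hζ).trans ?_
    have h1 : T ≤ 1 + normSq ξ := by
      have e1 : (R : ℝ) ^ 2 < normSq ξ := by exact_mod_cast lt_normSq_of_notMem_box hξ
      linarith
    have h2 : ((1 + (normSq ξ : ℝ)) ^ 2)⁻¹
        = (1 + (normSq ξ : ℝ)) ^ (-(1 - δ)) * (1 + (normSq ξ : ℝ)) ^ (-(1 + δ)) := by
      rw [← Real.rpow_add (by positivity), ← Real.rpow_natCast, ← Real.rpow_neg (by positivity)]
      congr 1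
      push_cast
      ring
    have h3 : (1 + (normSq ξ : ℝ)) ^ (-(1 - δ)) ≤ T ^ (-(1 - δ)) :=
      Real.rpow_le_rpow_of_nonpos hT h1 (by linarith)
    rw [h2]
    gcongr

/-- The average of `pairSum m K` over `m ≤ X` is at most `K X ^ (-1/2 + δ)`. -/
lemma exists_sum_pairSum_le {δ : ℝ} (hδ : 0 < δ) (hδ1 : δ < 1) :
    ∃ C : ℝ, 0 < C ∧ ∀ X K : ℕ, 1 ≤ X → 1 ≤ K → K ≤ 2 * (Nat.sqrt X + 1) →
      ∑ m ∈ Finset.Icc (0 : ℤ) X, pairSum m K ≤ C * (X : ℝ) ^ (1 / 2 + δ) * K ∧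
      ∑ ζ ∈ (box K).erase 0, ∑ ξ ∈ box (Nat.sqrt X), weight (normSq (ξ + ζ) - normSq ξ)
        ≤ C * (X : ℝ) ^ (1 / 2 + δ) * K := by
  set S : ℝ := ∑' ξ : Fin 2 → ℤ, (1 + (normSq ξ : ℝ)) ^ (-(1 + δ)) with hS
  have hsumS := summable_one_add_normSq_rpow (s := 1 + δ) (by linarith)
  have hS0 : 0 ≤ S := tsum_nonneg fun ξ => by
    have h0 : (0 : ℝ) ≤ normSq ξ := by exact_mod_cast normSq_nonneg ξ
    positivity
  set A : ℝ := 1 + 576 ^ (δ / 3) / (δ / 3) with hA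
  have hA0 : 0 < A := by positivity
  refine ⟨3840 * A ^ 3 + 18432 * S, by positivity, fun X K hX hK hKX => ?_⟩
  set s := Nat.sqrt X with hs
  set R := 4 * (s + 1) with hR
  have hs1 : 1 ≤ s := Nat.sqrt_pos.2 hX
  have hsX : s ^ 2 ≤ X := Nat.sqrt_le' X
  have hXs : X < (s + 1) ^ 2 := Nat.lt_succ_sqrt' X
  have hX' : (1 : ℝ) ≤ X := by exact_mod_cast hX
  have hXpos : (0 : ℝ) < X := by linarith
  have hK' : (1 : ℝ) ≤ K := by exact_mod_cast hK
  have hsR : (s : ℝ) ≤ (X : ℝ) ^ (1 / 2 : ℝ) := by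
    rw [← Real.sqrt_eq_rpow]
    apply Real.le_sqrt_of_sq_le
    exact_mod_cast hsX
  have hRX : (R : ℝ) ≤ 8 * (X : ℝ) ^ (1 / 2 : ℝ) := by
    have : (R : ℝ) ≤ 8 * s := by
      have : R ≤ 8 * s := by omega
      exact_mod_cast this
    linarith
  have hKX' : (K : ℝ) ≤ 4 * (X : ℝ) ^ (1 / 2 : ℝ) := by
    have : (K : ℝ) ≤ 4 * s := by
      have : K ≤ 4 * s := by omega
      exact_mod_cast this
    linarith
  have hXhalf : (X : ℝ) ^ (1 / 2 : ℝ) * (X : ℝ) ^ δ = (X : ℝ) ^ (1 / 2 + δ) :=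
    (Real.rpow_add hXpos _ _).symm
  have h16 : 16 * X ≤ R ^ 2 := by
    have : R ^ 2 = 16 * (s + 1) ^ 2 := by rw [hR]; ring
    omega
  have hKR : 2 * K ≤ R := by omega
  set H : ℝ := (harmonic (8 * R ^ 2 + 1) : ℝ) with hH
  have hH1 : 1 ≤ H := one_le_harmonic_succ _
  have hHX : H ≤ A * (X : ℝ) ^ (δ / 3) := by
    have h1 : H ≤ 1 + Real.log ((8 * R ^ 2 + 1 : ℕ) : ℝ) := harmonic_le_one_add_log _
    have h2 : ((8 * R ^ 2 + 1 : ℕ) : ℝ) ≤ 576 * X := by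
      have e1 : R ≤ 8 * s := by omega
      have e2 : R ^ 2 ≤ (8 * s) ^ 2 := Nat.pow_le_pow_left e1 2
      have e3 : 1 ≤ R ^ 2 := Nat.one_le_pow _ _ (by omega)
      have e4 : 8 * R ^ 2 + 1 ≤ 576 * X := by nlinarith
      exact_mod_cast e4
    have h3 : Real.log ((8 * R ^ 2 + 1 : ℕ) : ℝ) ≤ (576 * X : ℝ) ^ (δ / 3) / (δ / 3) :=
      (Real.log_le_log (by positivity) h2).trans
        (Real.log_le_rpow_div (by positivity) (by positivity))
    have h4 : (1 : ℝ) ≤ (X : ℝ) ^ (δ / 3) := Real.one_le_rpow hX' (by positivity)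
    rw [Real.mul_rpow (by norm_num) hXpos.le] at h3
    calc H ≤ 1 * (X : ℝ) ^ (δ / 3) + 576 ^ (δ / 3) * (X : ℝ) ^ (δ / 3) / (δ / 3) := by linarith
      _ = _ := by rw [hA]; ring
  have hH3 : H ^ 3 ≤ A ^ 3 * (X : ℝ) ^ δ := by
    calc H ^ 3 ≤ (A * (X : ℝ) ^ (δ / 3)) ^ 3 := by gcongr
      _ = A ^ 3 * ((X : ℝ) ^ (δ / 3)) ^ (3 : ℝ) := by rw [mul_pow]; norm_cast
      _ = _ := by rw [← Real.rpow_mul hXpos.le]; congr 2; ring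
  have hRKH : R * K * H ^ 3 ≤ 8 * A ^ 3 * (X : ℝ) ^ (1 / 2 + δ) * K := by
    calc R * K * H ^ 3 ≤ (8 * (X : ℝ) ^ (1 / 2 : ℝ)) * K * (A ^ 3 * (X : ℝ) ^ δ) := by gcongr
      _ = 8 * A ^ 3 * ((X : ℝ) ^ (1 / 2 : ℝ) * (X : ℝ) ^ δ) * K := by ring
      _ = _ := by rw [hXhalf]
  have hXK : 0 ≤ (X : ℝ) ^ (1 / 2 + δ) * K := by positivity
  constructor
  · set near : ℤ → ℝ := fun m => ∑ ζ ∈ (box K).erase 0, ∑ ξ ∈ box R,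
      weight (normSq ξ - m) * weight (normSq (ξ + ζ) - m) with hnear
    have hpoint : ∀ m ∈ Finset.Icc (0 : ℤ) X,
        pairSum m K ≤ near m + 9 * K ^ 2 * (256 * ((X : ℝ) ^ (-(1 - δ)) * S)) := by
      intro m hm
      rw [Finset.mem_Icc] at hm
      have hmR : 16 * m ≤ (R : ℤ) ^ 2 := by
        have : (16 * X : ℤ) ≤ (R : ℤ) ^ 2 := by exact_mod_cast h16
        linarith
      have hζ : ∀ ζ ∈ (box K).erase 0,
          ∑' ξ, weight (normSq ξ - m) * weight (normSq (ξ + ζ) - m)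
            ≤ ∑ ξ ∈ box R, weight (normSq ξ - m) * weight (normSq (ξ + ζ) - m)
              + 256 * ((X : ℝ) ^ (-(1 - δ)) * S) := fun ζ hζ =>
        tsum_weight_mul_weight_le hδ hδ1 hKR hm.1 hmR (Finset.mem_erase.1 hζ).2 hXpos
          (by exact_mod_cast (by omega : X ≤ R ^ 2))
      rw [pairSum]
      refine (Finset.sum_le_sum hζ).trans ?_
      rw [Finset.sum_add_distrib, Finset.sum_const, nsmul_eq_mul]
      gcongr
      calc (((box K).erase 0).card : ℝ) ≤ ((box K).card : ℝ) := by
            exact_mod_cast Finset.card_erase_le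
        _ = (2 * K + 1) ^ 2 := by rw [card_box]; push_cast; ring
        _ ≤ 9 * (K : ℝ) ^ 2 := by nlinarith
    have hcard : ((Finset.Icc (0 : ℤ) X).card : ℝ) ≤ 2 * X := by
      rw [Int.card_Icc]
      have : ((X : ℤ) + 1 - 0).toNat = X + 1 := by omega
      rw [this]; push_cast; linarith
    calc ∑ m ∈ Finset.Icc (0 : ℤ) X, pairSum m K
        ≤ ∑ m ∈ Finset.Icc (0 : ℤ) X,
            (near m + 9 * K ^ 2 * (256 * ((X : ℝ) ^ (-(1 - δ)) * S))) := Finset.sum_le_sum hpoint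
      _ = ∑ m ∈ Finset.Icc (0 : ℤ) X, near m
            + (Finset.Icc (0 : ℤ) X).card * (9 * K ^ 2 * (256 * ((X : ℝ) ^ (-(1 - δ)) * S))) := by
          rw [Finset.sum_add_distrib, Finset.sum_const, nsmul_eq_mul]
      _ ≤ 480 * (8 * A ^ 3 * (X : ℝ) ^ (1 / 2 + δ) * K)
            + 2 * X * (9 * K ^ 2 * (256 * ((X : ℝ) ^ (-(1 - δ)) * S))) := by
          gcongr
          refine (sum_near_le hK (by omega) (by nlinarith)).trans ?_
          linarith
      _ = 3840 * A ^ 3 * (X : ℝ) ^ (1 / 2 + δ) * K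
            + 4608 * S * K * (K * ((X : ℝ) * (X : ℝ) ^ (-(1 - δ)))) := by ring
      _ = 3840 * A ^ 3 * (X : ℝ) ^ (1 / 2 + δ) * K + 4608 * S * K * (K * (X : ℝ) ^ δ) := by
          congr 3
          rw [mul_comm, ← Real.rpow_add_one hXpos.ne']
          congr 1; ring
      _ ≤ 3840 * A ^ 3 * (X : ℝ) ^ (1 / 2 + δ) * K
            + 4608 * S * K * ((4 * (X : ℝ) ^ (1 / 2 : ℝ)) * (X : ℝ) ^ δ) := by gcongr
      _ = _ := by rw [mul_assoc 4, hXhalf]; ring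
  · have hmono : box s ⊆ box R := box_mono (by omega)
    calc _ ≤ ∑ ζ ∈ (box K).erase 0, ∑ ξ ∈ box R, weight (normSq (ξ + ζ) - normSq ξ) :=
          Finset.sum_le_sum fun ζ _ => Finset.sum_le_sum_of_subset_of_nonneg hmono
            fun ξ _ _ => (weight_pos _).le
      _ ≤ 120 * R * K * H ^ 2 := sum_weight_normSq_sub_le hK (by omega)
      _ ≤ 120 * (R * K * H ^ 3) := by
          have : H ^ 2 ≤ H ^ 3 := pow_le_pow_right₀ hH1 (by norm_num)
          have := mul_le_mul_of_nonneg_left this (by positivity : (0 : ℝ) ≤ R * K)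
          linarith
      _ ≤ 120 * (8 * A ^ 3 * (X : ℝ) ^ (1 / 2 + δ) * K) := by gcongr
      _ ≤ _ := by
          have h1 : 0 ≤ A ^ 3 * ((X : ℝ) ^ (1 / 2 + δ) * K) := by positivity
          have h2 : 0 ≤ S * ((X : ℝ) ^ (1 / 2 + δ) * K) := by positivity
          nlinarith

/-- The values of `|ξ|²` up to `X`. -/
def normValues (X : ℕ) : Finset ℤ := ((box (Nat.sqrt X)).image normSq).filter fun n => n ≤ X

lemma mem_normValues {X : ℕ} {n : ℤ} : n ∈ normValues X ↔ (∃ ξ, normSq ξ = n) ∧ n ≤ X := by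
  simp only [normValues, Finset.mem_filter, Finset.mem_image]
  constructor
  · rintro ⟨⟨ξ, -, h⟩, h'⟩
    exact ⟨⟨ξ, h⟩, h'⟩
  · rintro ⟨⟨ξ, rfl⟩, h'⟩
    refine ⟨⟨ξ, ?_, rfl⟩, h'⟩
    by_contra hξ
    rw [mem_box] at hξ
    push Not at hξ
    obtain ⟨j, hj⟩ := hξ
    have h1 : ξ j ^ 2 ≤ normSq ξ := Finset.single_le_sum (f := fun j => ξ j ^ 2)
      (fun _ _ => sq_nonneg _) (Finset.mem_univ j)
    have h2 : ((Nat.sqrt X : ℤ) + 1) ^ 2 ≤ ξ j ^ 2 := by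
      rw [← sq_abs (ξ j)]
      exact pow_le_pow_left₀ (by positivity) (by omega) 2
    have h3 : (X : ℤ) < ((Nat.sqrt X : ℤ) + 1) ^ 2 := by
      exact_mod_cast Nat.lt_succ_sqrt' X
    linarith

/-- There are at least `X ^ (1 - δ)` values of `|ξ|²` up to `X`: the number of pairs of points on a
common circle is `O (X ^ (1 + δ))`, so the Cauchy–Schwarz inequality applies. -/
lemma exists_le_card_normValues {δ : ℝ} (hδ : 0 < δ) (hδ1 : δ < 1) :
    ∃ c : ℝ, 0 < c ∧ ∀ X : ℕ, 2 ≤ X → c * (X : ℝ) ^ (1 - δ) ≤ (normValues X).card := by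
  obtain ⟨C, hC, h⟩ := exists_sum_pairSum_le hδ hδ1
  refine ⟨(256 * (C + 1))⁻¹, by positivity, fun X hX => ?_⟩
  set Y := X / 2 with hY
  set s := Nat.sqrt Y with hs
  have hY1 : 1 ≤ Y := by omega
  have hs1 : 1 ≤ s := Nat.sqrt_pos.2 hY1
  have hYs : Y < (s + 1) ^ 2 := Nat.lt_succ_sqrt' Y
  have hsY : s ^ 2 ≤ Y := Nat.sqrt_le' Y
  have hmaps : ∀ ξ ∈ box s, normSq ξ ∈ normValues X := by
    intro ξ hξ
    refine mem_normValues.2 ⟨⟨ξ, rfl⟩, (normSq_le_of_mem_box hξ).trans ?_⟩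
    have : 2 * s ^ 2 ≤ X := by omega
    exact_mod_cast this
  set r : ℤ → ℝ := fun n => (((box s).filter fun ξ => normSq ξ = n).card : ℝ) with hr
  have hcount : ((box s).card : ℝ) = ∑ n ∈ normValues X, r n := by
    rw [Finset.card_eq_sum_card_fiberwise hmaps]
    push_cast
    rfl
  have hCS : ((box s).card : ℝ) ^ 2 ≤ (normValues X).card * ∑ n ∈ normValues X, r n ^ 2 := by
    rw [hcount]; exact sq_sum_le_card_mul_sum_sq
  -- The second moment counts the pairs of points with equal `|ξ|²`.
  have hsq : ∑ n ∈ normValues X, r n ^ 2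
      = ∑ ξ ∈ box s, ∑ η ∈ box s, if normSq η = normSq ξ then (1 : ℝ) else 0 := by
    rw [← Finset.sum_fiberwise_of_maps_to hmaps]
    refine Finset.sum_congr rfl fun n _ => ?_
    have : ∀ ξ ∈ (box s).filter fun ξ => normSq ξ = n,
        (∑ η ∈ box s, if normSq η = normSq ξ then (1 : ℝ) else 0) = r n := by
      intro ξ hξ
      rw [(Finset.mem_filter.1 hξ).2, Finset.sum_boole]
    rw [Finset.sum_congr rfl this, Finset.sum_const, nsmul_eq_mul, sq]
  have hpairs : ∀ ξ ∈ box s, (∑ η ∈ box s, if normSq η = normSq ξ then (1 : ℝ) else 0)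
      ≤ ∑ ζ ∈ box (2 * s), weight (normSq (ξ + ζ) - normSq ξ) := by
    intro ξ hξ
    have hinj : Set.InjOn (fun η : Fin 2 → ℤ => η - ξ) (box s) := fun a _ b _ hab =>
      sub_left_injective hab
    calc _ ≤ ∑ η ∈ box s, weight (normSq (ξ + (η - ξ)) - normSq ξ) := by
          refine Finset.sum_le_sum fun η _ => ?_
          rw [add_sub_cancel]
          split_ifs with h
          · rw [h, sub_self, weight_zero]
          · exact (weight_pos _).le
      _ = ∑ ζ ∈ (box s).image fun η => η - ξ, weight (normSq (ξ + ζ) - normSq ξ) := by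
          rw [Finset.sum_image hinj]
      _ ≤ _ := by
          refine Finset.sum_le_sum_of_subset_of_nonneg ?_ fun _ _ _ => (weight_pos _).le
          intro ζ hζ
          obtain ⟨η, hη, rfl⟩ := Finset.mem_image.1 hζ
          rw [mem_box] at *
          intro j
          have := abs_sub (η j) (ξ j)
          have := hη j
          have := hξ j
          rw [Pi.sub_apply]
          push_cast
          linarith
  have hmoment : ∑ n ∈ normValues X, r n ^ 2
      ≤ (box s).card + C * (Y : ℝ) ^ (1 / 2 + δ) * (2 * s : ℕ) := by
    rw [hsq]
    refine (Finset.sum_le_sum hpairs).trans ?_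
    rw [Finset.sum_comm, ← Finset.add_sum_erase _ _ (mem_box.2 (by simp) : (0 : Fin 2 → ℤ) ∈ _)]
    gcongr
    · simp [weight_zero]
    · exact (h Y (2 * s) hY1 (by omega) (by omega)).2
  have hX' : (0 : ℝ) < X := by exact_mod_cast (by omega : 0 < X)
  have hX1 : (1 : ℝ) ≤ X := by exact_mod_cast (by omega : 1 ≤ X)
  have hXδ : (1 : ℝ) ≤ (X : ℝ) ^ δ := Real.one_le_rpow hX1 hδ.le
  have hYX : (Y : ℝ) ≤ X := by exact_mod_cast Nat.div_le_self X 2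
  have hsX : (s : ℝ) ≤ (X : ℝ) ^ (1 / 2 : ℝ) := by
    rw [← Real.sqrt_eq_rpow]
    apply Real.le_sqrt_of_sq_le
    have : s ^ 2 ≤ X := by omega
    exact_mod_cast this
  have hbox : ((box s).card : ℝ) ≤ 16 * X := by
    rw [card_box]
    have : (2 * s + 1) ^ 2 ≤ 16 * X := by
      have : s ^ 2 ≤ X := by omega
      nlinarith
    exact_mod_cast this
  have hbox' : (X : ℝ) ≤ 4 * (box s).card := by
    rw [card_box]
    have : X ≤ 4 * (2 * s + 1) ^ 2 := by
      have : X ≤ 2 * (s + 1) ^ 2 := by omega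
      nlinarith
    exact_mod_cast this
  have hXX : (X : ℝ) ^ (1 / 2 + δ) * (X : ℝ) ^ (1 / 2 : ℝ) = X * (X : ℝ) ^ δ := by
    rw [← Real.rpow_add hX', ← Real.rpow_one_add' hX'.le (by positivity)]
    congr 1; ring
  have hmom2 : ∑ n ∈ normValues X, r n ^ 2 ≤ 16 * (C + 1) * (X * (X : ℝ) ^ δ) := by
    have e1 : C * (Y : ℝ) ^ (1 / 2 + δ) * (2 * s : ℕ)
        ≤ C * (X : ℝ) ^ (1 / 2 + δ) * (2 * (X : ℝ) ^ (1 / 2 : ℝ)) := by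
      push_cast; gcongr
    have e2 : C * (X : ℝ) ^ (1 / 2 + δ) * (2 * (X : ℝ) ^ (1 / 2 : ℝ))
        = 2 * C * (X * (X : ℝ) ^ δ) := by rw [← hXX]; ring
    have e3 : (X : ℝ) ≤ X * (X : ℝ) ^ δ := le_mul_of_one_le_right hX'.le hXδ
    have e4 : 0 ≤ C * (X * (X : ℝ) ^ δ) := by positivity
    linarith
  have hfin : (X : ℝ) ^ 2 ≤ (normValues X).card * (256 * (C + 1) * (X * (X : ℝ) ^ δ)) := by
    calc (X : ℝ) ^ 2 ≤ (4 * (box s).card) ^ 2 := by gcongr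
      _ = 16 * ((box s).card : ℝ) ^ 2 := by ring
      _ ≤ 16 * ((normValues X).card * (16 * (C + 1) * (X * (X : ℝ) ^ δ))) := by
          gcongr
          exact hCS.trans (by gcongr)
      _ = _ := by ring
  rw [Real.rpow_sub hX', Real.rpow_one, inv_mul_le_iff₀ (by positivity), div_le_iff₀ (by positivity)]
  have : (X : ℝ) * X ≤ X * (256 * (C + 1) * (normValues X).card * (X : ℝ) ^ δ) := by
    calc (X : ℝ) * X = X ^ 2 := (sq _).symm
      _ ≤ _ := hfin
      _ = _ := by ring
  exact le_of_mul_le_mul_left this hX'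

/-! ### A localized nonnegative trigonometric polynomial -/

/-- The trigonometric polynomials with frequencies in `box N`. -/
def trigPoly (N : ℕ) : Submodule ℂ (Torus → ℂ) :=
  Submodule.span ℂ ((fun ζ => ⇑(expWave 0 ζ)) '' (box N : Set (Fin 2 → ℤ)))

lemma expWave_mem_trigPoly {N : ℕ} {ζ : Fin 2 → ℤ} (h : ζ ∈ box N) : ⇑(expWave 0 ζ) ∈ trigPoly N :=
  Submodule.subset_span ⟨ζ, h, rfl⟩

lemma mul_mem_trigPoly {N N' : ℕ} {f g : Torus → ℂ} (hf : f ∈ trigPoly N) (hg : g ∈ trigPoly N') :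
    f * g ∈ trigPoly (N + N') := by
  have h : trigPoly N * trigPoly N' ≤ trigPoly (N + N') := by
    rw [trigPoly, trigPoly, Submodule.span_mul_span, Submodule.span_le]
    rintro _ ⟨_, ⟨ζ, hζ, rfl⟩, _, ⟨ζ', hζ', rfl⟩, rfl⟩
    have : ζ + ζ' ∈ box (N + N') := by
      rw [Finset.mem_coe, mem_box] at *
      intro j
      have := abs_add_le (ζ j) (ζ' j)
      have := hζ j
      have := hζ' j
      rw [Pi.add_apply]
      push_cast
      linarith
    have h2 : ⇑(expWave 0 ζ) * ⇑(expWave 0 ζ') = ⇑(expWave 0 (ζ + ζ')) := by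
      ext x
      exact (expWave_add 0 ζ ζ' x).symm
    exact (congrArg (· ∈ trigPoly (N + N')) h2).mpr (expWave_mem_trigPoly this)
  exact h (Submodule.mul_mem_mul hf hg)

lemma pow_mem_trigPoly {N : ℕ} {f : Torus → ℂ} (hf : f ∈ trigPoly N) (k : ℕ) :
    f ^ k ∈ trigPoly (k * N) := by
  induction k with
  | zero =>
    rw [pow_zero, zero_mul]
    convert expWave_mem_trigPoly (N := 0) (ζ := 0) (by simp [mem_box]) using 1
    ext x
    exact (expWave_zero 0 x).symm
  | succ k ih =>
    rw [pow_succ, Nat.succ_mul]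
    exact mul_mem_trigPoly ih hf

lemma star_mem_trigPoly {N : ℕ} {f : Torus → ℂ} (hf : f ∈ trigPoly N) : star f ∈ trigPoly N := by
  induction hf using Submodule.span_induction with
  | mem f hf =>
    obtain ⟨ζ, hζ, rfl⟩ := hf
    have : -ζ ∈ box N := by
      rw [Finset.mem_coe, mem_box] at hζ
      rw [mem_box]
      simpa using hζ
    convert expWave_mem_trigPoly this using 1
    ext x
    exact (expWave_neg 0 ζ x).symm
  | zero => rw [star_zero]; exact zero_mem _
  | add f g _ _ hf hg => rw [star_add]; exact add_mem hf hg
  | smul c f _ hf => rw [star_smul]; exact Submodule.smul_mem _ _ hf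

lemma exists_coeff_of_mem_trigPoly {N : ℕ} {f : Torus → ℂ} (hf : f ∈ trigPoly N) :
    ∃ b : (Fin 2 → ℤ) → ℂ, ∀ x, f x = ∑ ζ ∈ box N, b ζ * expWave 0 ζ x := by
  induction hf using Submodule.span_induction with
  | mem f hf =>
    obtain ⟨ζ, hζ, rfl⟩ := hf
    refine ⟨Pi.single ζ 1, fun x => ?_⟩
    rw [Finset.sum_eq_single_of_mem ζ hζ fun η _ hη => by simp [hη]]
    simp
  | zero => exact ⟨0, by simp⟩
  | add f g _ _ hf hg =>
    obtain ⟨b, hb⟩ := hf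
    obtain ⟨b', hb'⟩ := hg
    exact ⟨b + b', fun x => by simp [hb, hb', add_mul, Finset.sum_add_distrib]⟩
  | smul c f _ hf =>
    obtain ⟨b, hb⟩ := hf
    exact ⟨c • b, fun x => by simp [hb, Finset.mul_sum, mul_assoc]⟩

lemma exists_coe_eq (t : AddCircle (2 * Real.pi)) :
    ∃ y : ℝ, (y : AddCircle (2 * Real.pi)) = t ∧ |y| = ‖t‖ ∧ |y| ≤ Real.pi := by
  obtain ⟨y, hy, rfl⟩ := (AddCircle.coe_image_Ioc_eq (2 * Real.pi) (-Real.pi)).ge (Set.mem_univ t)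
  have h : |y| ≤ Real.pi := abs_le.2 ⟨hy.1.le, by linarith [hy.2]⟩
  refine ⟨y, rfl, ?_, h⟩
  rw [(AddCircle.norm_coe_eq_abs_iff _ Real.two_pi_pos.ne').2]
  rw [abs_of_pos Real.two_pi_pos]
  linarith

lemma fourier_coe_two_pi (n : ℤ) (y : ℝ) :
    (fourier n (y : AddCircle (2 * Real.pi)) : ℂ) = Complex.exp (Complex.I * (n * y : ℝ)) := by
  rw [fourier_coe_apply]
  congr 1
  push_cast
  field_simp

lemma norm_fourier_sub_one_le (n : ℤ) (t : AddCircle (2 * Real.pi)) :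
    ‖(fourier n t : ℂ) - 1‖ ≤ |(n : ℝ)| * ‖t‖ := by
  obtain ⟨y, rfl, hy, -⟩ := exists_coe_eq t
  rw [fourier_coe_two_pi, ← hy, ← abs_mul]
  exact Real.norm_exp_I_mul_ofReal_sub_one_le

lemma le_norm_fourier_one_sub_one (t : AddCircle (2 * Real.pi)) :
    2 / Real.pi * ‖t‖ ≤ ‖(fourier 1 t : ℂ) - 1‖ := by
  obtain ⟨y, rfl, hy, hy'⟩ := exists_coe_eq t
  rw [fourier_coe_two_pi, ← hy, Complex.norm_exp_I_mul_ofReal_sub_one]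
  have h := Real.mul_abs_le_abs_sin (x := y / 2) (by rw [abs_div, abs_two]; linarith)
  rw [abs_div, abs_two] at h
  rw [norm_mul, Real.norm_eq_abs, Real.norm_eq_abs, abs_two]
  push_cast
  rw [one_mul]
  linarith

/-- The Dirichlet type kernel `∑_{m < M} e^{i m t}`. -/
def dirichletSum (M : ℕ) (t : AddCircle (2 * Real.pi)) : ℂ := ∑ m ∈ Finset.range M, fourier (m : ℤ) t

lemma norm_dirichletSum_le (M : ℕ) (t : AddCircle (2 * Real.pi)) : ‖dirichletSum M t‖ ≤ M := by
  refine (norm_sum_le_of_le _ fun m _ => (Circle.norm_coe _).le).trans ?_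
  simp

lemma norm_dirichletSum_mul_norm_le (M : ℕ) (t : AddCircle (2 * Real.pi)) :
    ‖dirichletSum M t‖ * ‖t‖ ≤ Real.pi := by
  have hpow : ∀ m : ℕ, (fourier (m : ℤ) t : ℂ) = (fourier 1 t : ℂ) ^ m := by
    intro m
    rw [fourier_one, fourier_apply, AddCircle.toCircle_zsmul]
    simp
  have hgeom : dirichletSum M t * ((fourier 1 t : ℂ) - 1) = (fourier (M : ℤ) t : ℂ) - 1 := by
    rw [dirichletSum, Finset.sum_congr rfl fun m _ => hpow m, geom_sum_mul, hpow]
  have h1 : ‖(fourier (M : ℤ) t : ℂ) - 1‖ ≤ 2 := by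
    refine (norm_sub_le _ _).trans ?_
    rw [norm_one, show ‖(fourier (M : ℤ) t : ℂ)‖ = 1 from Circle.norm_coe _]
    norm_num
  rw [← hgeom, norm_mul] at h1
  have h2 := mul_le_mul_of_nonneg_left (le_norm_fourier_one_sub_one t)
    (norm_nonneg (dirichletSum M t))
  have h3 : 2 / Real.pi * (‖dirichletSum M t‖ * ‖t‖) ≤ 2 := by
    calc _ = ‖dirichletSum M t‖ * (2 / Real.pi * ‖t‖) := by ring
      _ ≤ 2 := h2.trans h1
  rw [div_mul_eq_mul_div, div_le_iff₀ Real.pi_pos] at h3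
  linarith

lemma half_le_norm_dirichletSum {M : ℕ} (hM : 1 ≤ M) {t : AddCircle (2 * Real.pi)}
    (ht : ‖t‖ ≤ (M : ℝ)⁻¹) : (M : ℝ) / 2 ≤ ‖dirichletSum M t‖ := by
  have hM' : (0 : ℝ) < M := by exact_mod_cast hM
  have h1 : ‖dirichletSum M t - M‖ ≤ M / 2 := by
    have : dirichletSum M t - M = ∑ m ∈ Finset.range M, ((fourier (m : ℤ) t : ℂ) - 1) := by
      rw [Finset.sum_sub_distrib, dirichletSum]; simp
    rw [this]
    refine (norm_sum_le _ _).trans ?_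
    calc _ ≤ ∑ m ∈ Finset.range M, (m : ℝ) * (M : ℝ)⁻¹ := by
          refine Finset.sum_le_sum fun m _ => (norm_fourier_sub_one_le m t).trans ?_
          rw [Int.cast_natCast, Nat.abs_cast]
          gcongr
      _ = (M - 1) / 2 := by
          rw [← Finset.sum_mul]
          have : (∑ m ∈ Finset.range M, (m : ℝ)) * 2 = M * (M - 1) := by
            rw [← Nat.cast_pred hM, ← Nat.cast_sum]
            exact_mod_cast Finset.sum_range_id_mul_two M
          field_simp
          linarith
      _ ≤ M / 2 := by linarith
  have h2 := norm_sub_norm_le (M : ℂ) (M - dirichletSum M t)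
  rw [sub_sub_cancel, norm_sub_rev, Complex.norm_natCast] at h2
  linarith

lemma haar_closedBall {r : ℝ} (hr : 0 ≤ r) (hr' : r ≤ Real.pi) (t : AddCircle (2 * Real.pi)) :
    (AddCircle.haarAddCircle : Measure (AddCircle (2 * Real.pi))).real (Metric.closedBall t r)
      = r / Real.pi := by
  have h := AddCircle.volume_closedBall (2 * Real.pi) (x := t) r
  rw [AddCircle.volume_eq_smul_haarAddCircle, Measure.smul_apply, min_eq_right (by linarith),
    smul_eq_mul] at h
  have h2 := congrArg ENNReal.toReal h
  rw [ENNReal.toReal_mul, ENNReal.toReal_ofReal Real.two_pi_pos.le,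
    ENNReal.toReal_ofReal (by linarith)] at h2
  rw [Measure.real, eq_div_iff Real.pi_pos.ne']
  linarith

/-- A nonnegative trigonometric polynomial of mean one and degree `2 k M` that is small
away from the origin: a normalized `2 k`-th power of a Dirichlet kernel. -/
lemma exists_kernel {M : ℕ} (hM : 1 ≤ M) (k : ℕ) : ∃ J : Torus → ℝ, Continuous J ∧ (∀ x, 0 ≤ J x) ∧
    ∫ x, J x ∂normalizedVolume = 1 ∧
    (∃ b : (Fin 2 → ℤ) → ℂ, ∀ x, (J x : ℂ) = ∑ ζ ∈ box (2 * k * M), b ζ * expWave 0 ζ x) ∧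
    ∀ s : ℝ, 0 < s → ∀ x, (∃ j, s ≤ ‖x j‖) →
      J x ≤ Real.pi ^ 2 * M ^ 2 * (4 * Real.pi / (M * s)) ^ (2 * k) := by
  have hM' : (1 : ℝ) ≤ M := by exact_mod_cast hM
  have hM0 : (0 : ℝ) < M := by linarith
  set D : Torus → ℂ := fun x => ∏ j, dirichletSum M (x j) with hD
  have hDcont : Continuous D := by
    simp only [hD, dirichletSum]
    fun_prop
  have hDT : D ∈ trigPoly M := by
    have : D = ∑ ζ ∈ Fintype.piFinset fun _ : Fin 2 => (Finset.range M).image ((↑) : ℕ → ℤ),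
        ⇑(expWave 0 ζ) := by
      ext x
      simp only [hD, dirichletSum]
      have : ∀ j, ∑ m ∈ Finset.range M, (fourier (m : ℤ) (x j) : ℂ)
          = ∑ n ∈ (Finset.range M).image ((↑) : ℕ → ℤ), fourier n (x j) := fun j =>
        (Finset.sum_image (f := fun n : ℤ => (fourier n (x j) : ℂ))
          (Nat.cast_injective.injOn)).symm
      simp only [this]
      rw [Finset.prod_univ_sum, Finset.sum_apply]
      simp [expWave_apply]
    rw [this]
    refine Submodule.sum_mem _ fun ζ hζ => expWave_mem_trigPoly (mem_box.2 fun j => ?_)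
    obtain ⟨m, hm, hmj⟩ := Finset.mem_image.1 (Fintype.mem_piFinset.1 hζ j)
    rw [← hmj, Nat.abs_cast]
    exact_mod_cast (Finset.mem_range.1 hm).le
  set P : Torus → ℝ := fun x => ‖D x‖ ^ (2 * k) with hP
  have hPcont : Continuous P := by fun_prop
  have hP0 : ∀ x, 0 ≤ P x := fun x => by positivity
  have hPT : (fun x => (P x : ℂ)) ∈ trigPoly (2 * k * M) := by
    have h := mul_mem_trigPoly (pow_mem_trigPoly hDT k) (star_mem_trigPoly (pow_mem_trigPoly hDT k))
    rw [show k * M + k * M = 2 * k * M by ring] at h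
    convert h using 1
    ext x
    simp only [hP, Pi.mul_apply, Pi.star_apply, Pi.pow_apply, RCLike.star_def]
    rw [Complex.mul_conj', norm_pow]
    push_cast
    ring
  -- Most of the mass sits where both coordinates are at most `1 / M`.
  set c : ℝ := ∫ x, P x ∂normalizedVolume with hc
  set S : Set Torus := Set.univ.pi fun _ => Metric.closedBall 0 (M : ℝ)⁻¹ with hS
  have hSvol : normalizedVolume.real S = ((M : ℝ)⁻¹ / Real.pi) ^ 2 := by
    rw [hS, normalizedVolume, Measure.real, Measure.pi_pi, ENNReal.toReal_prod]
    have : (M : ℝ)⁻¹ ≤ Real.pi := (inv_le_one_of_one_le₀ hM').trans (by linarith [Real.pi_gt_three])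
    simp only [← Measure.real_def, haar_closedBall (inv_nonneg.2 hM0.le) this]
    rw [Finset.prod_const, Finset.card_univ, Fintype.card_fin]
  have hSmeas : MeasurableSet S := (isClosed_set_pi fun _ _ => Metric.isClosed_closedBall).measurableSet
  have hlow : (M ^ 2 / 4 : ℝ) ^ (2 * k) * ((M : ℝ)⁻¹ / Real.pi) ^ 2 ≤ c := by
    have h1 : ∀ x ∈ S, (M ^ 2 / 4 : ℝ) ^ (2 * k) ≤ P x := by
      intro x hx
      have hx' : ∀ j, ‖x j‖ ≤ (M : ℝ)⁻¹ := fun j => by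
        simpa using hx j (Set.mem_univ j)
      refine pow_le_pow_left₀ (by positivity) ?_ _
      simp only [hD]
      rw [norm_prod, Fin.prod_univ_two]
      calc (M ^ 2 / 4 : ℝ) = M / 2 * (M / 2) := by ring
        _ ≤ _ := mul_le_mul (half_le_norm_dirichletSum hM (hx' 0))
          (half_le_norm_dirichletSum hM (hx' 1)) (by positivity) (norm_nonneg _)
    calc _ = ∫ x in S, (M ^ 2 / 4 : ℝ) ^ (2 * k) ∂normalizedVolume := by
          rw [setIntegral_const, hSvol, smul_eq_mul, mul_comm]
      _ ≤ ∫ x in S, P x ∂normalizedVolume :=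
          setIntegral_mono_on (by simp) (Continuous.integrable_torus hPcont).integrableOn hSmeas h1
      _ ≤ c := setIntegral_le_integral (Continuous.integrable_torus hPcont) (ae_of_all _ hP0)
  have hcpos : 0 < c := lt_of_lt_of_le (by positivity) hlow
  refine ⟨fun x => P x / c, hPcont.div_const c, fun x => div_nonneg (hP0 x) hcpos.le, ?_, ?_, ?_⟩
  · rw [integral_div, div_self hcpos.ne']
  · obtain ⟨b, hb⟩ := exists_coeff_of_mem_trigPoly hPT
    refine ⟨fun ζ => b ζ / c, fun x => ?_⟩
    push_cast
    rw [hb x, Finset.sum_div]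
    exact Finset.sum_congr rfl fun ζ _ => by ring
  · rintro s hs x ⟨i, hi⟩
    have hDx : ‖D x‖ ≤ M * Real.pi / s := by
      have h1 : ‖dirichletSum M (x i)‖ ≤ Real.pi / s := by
        rw [le_div_iff₀ hs]
        exact (mul_le_mul_of_nonneg_left hi (norm_nonneg _)).trans
          (norm_dirichletSum_mul_norm_le M (x i))
      rw [hD]
      simp only [norm_prod]
      rw [← Finset.mul_prod_erase _ _ (Finset.mem_univ i), mul_comm (M : ℝ), mul_div_right_comm]
      refine mul_le_mul h1 ?_ (Finset.prod_nonneg fun _ _ => norm_nonneg _) (by positivity)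
      refine (Finset.prod_le_prod (fun _ _ => norm_nonneg _)
        fun j _ => norm_dirichletSum_le M (x j)).trans ?_
      simp
    simp only
    rw [div_le_iff₀ hcpos]
    calc P x ≤ (M * Real.pi / s) ^ (2 * k) := pow_le_pow_left₀ (norm_nonneg _) hDx _
      _ = Real.pi ^ 2 * M ^ 2 * (4 * Real.pi / (M * s)) ^ (2 * k)
            * ((M ^ 2 / 4 : ℝ) ^ (2 * k) * ((M : ℝ)⁻¹ / Real.pi) ^ 2) := by
          have e : (M * Real.pi / s) = (4 * Real.pi / (M * s)) * (M ^ 2 / 4 : ℝ) := by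
            field_simp
          rw [e, mul_pow]
          have : Real.pi ^ 2 * (M : ℝ) ^ 2 * ((M : ℝ)⁻¹ / Real.pi) ^ 2 = 1 := by
            have := Real.pi_pos.ne'
            field_simp
          linear_combination (-(4 * Real.pi / (M * s)) ^ (2 * k) * (M ^ 2 / 4 : ℝ) ^ (2 * k)) * this
      _ ≤ _ := by gcongr

/-! ### Fourier coefficients of the mass density -/

lemma memLp_expWave_mul (x₀ : Torus) (ζ : Fin 2 → ℤ) (f : L2Torus) :
    MemLp (fun y => expWave x₀ ζ y * f y) 2 normalizedVolume := by
  refine (Lp.memLp f).of_le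
    ((expWave x₀ ζ).continuous.aestronglyMeasurable.mul (Lp.aestronglyMeasurable f))
    (ae_of_all _ fun y => ?_)
  rw [norm_mul, norm_expWave_apply, one_mul]

/-- The Fourier coefficients of `|f|²` are the autocorrelations of those of `f`. -/
lemma hasSum_integral_expWave_mul_norm_sq (x₀ : Torus) (f : L2Torus) (ζ : Fin 2 → ℤ) :
    HasSum (fun ξ => conj (inner ℂ (waveLp x₀ (ξ + ζ)) f) * inner ℂ (waveLp x₀ ξ) f)
      (∫ y, expWave x₀ ζ y * ((‖f y‖ ^ 2 : ℝ) : ℂ) ∂normalizedVolume) := by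
  set h : L2Torus := (memLp_expWave_mul x₀ ζ f).toLp _ with hh
  have hae : h =ᵐ[normalizedVolume] fun y => expWave x₀ ζ y * f y := MemLp.coeFn_toLp _
  have hcoef : ∀ ξ, inner ℂ (waveLp x₀ (ξ + ζ)) h = inner ℂ (waveLp x₀ ξ) f := by
    intro ξ
    rw [inner_wave_eq_integral x₀ _ hae, inner_wave_eq_integral x₀ ξ (ae_eq_refl _)]
    refine integral_congr_ae (ae_of_all _ fun y => ?_)
    have h1 : conj (expWave x₀ ζ y) * expWave x₀ ζ y = 1 := by
      rw [Complex.conj_mul', norm_expWave_apply]; simp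
    simp only [expWave_add, map_mul]
    linear_combination conj (expWave x₀ ξ y) * f y * h1
  have hinner : inner ℂ f h = ∫ y, expWave x₀ ζ y * ((‖f y‖ ^ 2 : ℝ) : ℂ) ∂normalizedVolume := by
    rw [L2.inner_def]
    refine integral_congr_ae ?_
    filter_upwards [hae] with y hy
    rw [hy, RCLike.inner_apply, mul_assoc, Complex.mul_conj']
    push_cast
    rfl
  rw [← hinner]
  have h2 := (Equiv.addRight ζ).hasSum_iff.2 (hasSum_conj_mul x₀ f h)
  simpa [Function.comp_def, hcoef] using h2

lemma summable_norm_inner_mul (x₀ : Torus) (f : L2Torus) (ζ : Fin 2 → ℤ) :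
    Summable fun ξ => ‖inner ℂ (waveLp x₀ ξ) f‖ * ‖inner ℂ (waveLp x₀ (ξ + ζ)) f‖ := by
  have h := summable_norm_sq_inner x₀ f
  have h' := (Equiv.addRight ζ).summable_iff.2 h
  refine Summable.of_nonneg_of_le (fun _ => by positivity) (fun ξ => ?_) (h.add h')
  simp only [Function.comp_apply, Equiv.coe_addRight]
  nlinarith [sq_nonneg (‖inner ℂ (waveLp x₀ ξ) f‖ - ‖inner ℂ (waveLp x₀ (ξ + ζ)) f‖),
    sq_nonneg ‖inner ℂ (waveLp x₀ ξ) f‖, sq_nonneg ‖inner ℂ (waveLp x₀ (ξ + ζ)) f‖]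

lemma norm_integral_expWave_mul_norm_sq_le (x₀ : Torus) (f : L2Torus) (ζ : Fin 2 → ℤ) :
    ‖∫ y, expWave x₀ ζ y * ((‖f y‖ ^ 2 : ℝ) : ℂ) ∂normalizedVolume‖
      ≤ ∑' ξ, ‖inner ℂ (waveLp x₀ ξ) f‖ * ‖inner ℂ (waveLp x₀ (ξ + ζ)) f‖ := by
  have h := hasSum_integral_expWave_mul_norm_sq x₀ f ζ
  rw [← h.tsum_eq]
  have e : ∀ ξ, ‖conj (inner ℂ (waveLp x₀ (ξ + ζ)) f) * inner ℂ (waveLp x₀ ξ) f‖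
      = ‖inner ℂ (waveLp x₀ ξ) f‖ * ‖inner ℂ (waveLp x₀ (ξ + ζ)) f‖ := fun ξ => by
    rw [norm_mul, RCLike.norm_conj, mul_comm]
  simp only [← e]
  exact norm_tsum_le_tsum_norm ((summable_norm_inner_mul x₀ f ζ).congr fun ξ => (e ξ).symm)

lemma integral_norm_sq (f : L2Torus) : ∫ y, ‖f y‖ ^ 2 ∂normalizedVolume = ‖f‖ ^ 2 := by
  have h := inner_self_eq_norm_sq_to_K (𝕜 := ℂ) f
  rw [L2.inner_def] at h
  have h2 : ∀ y, (inner ℂ (f y) (f y) : ℂ) = ((‖f y‖ ^ 2 : ℝ) : ℂ) := fun y => by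
    rw [inner_self_eq_norm_sq_to_K]; push_cast; rfl
  simp only [h2] at h
  rw [integral_complex_ofReal] at h
  refine Complex.ofReal_injective (h.trans ?_)
  push_cast
  rfl

lemma integrable_norm_sq (f : L2Torus) : Integrable (fun y => ‖f y‖ ^ 2) normalizedVolume :=
  (memLp_two_iff_integrable_sq_norm (Lp.aestronglyMeasurable f)).1 (Lp.memLp f)

lemma expWave_sub_center (x x₀ : Torus) (ζ : Fin 2 → ℤ) (y : Torus) :
    expWave x ζ y = expWave 0 ζ (x₀ - x) * expWave x₀ ζ y := by
  refine Eq.trans ?_ ((expWave_translate x₀ ζ y (x₀ - x)).trans (mul_comm _ _))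
  simp only [expWave_apply, Pi.add_apply, Pi.sub_apply]
  refine Finset.prod_congr rfl fun j _ => ?_
  congr 1
  abel

/-- If `|f|²` is smoothed by a nonnegative trigonometric polynomial of mean one, it differs from
its mean by at most the sum of the autocorrelations of the Fourier coefficients of `f`. -/
lemma abs_integral_kernel_sub_le (x₀ x : Torus) {f : L2Torus} (hf : ‖f‖ = 1) {J : Torus → ℝ}
    (hJ0 : ∀ x, 0 ≤ J x) (hJ1 : ∫ x, J x ∂normalizedVolume = 1) {N : ℕ}
    {b : (Fin 2 → ℤ) → ℂ} (hb : ∀ x, (J x : ℂ) = ∑ ζ ∈ box N, b ζ * expWave 0 ζ x) :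
    |∫ y, J (x - y) * ‖f y‖ ^ 2 ∂normalizedVolume - 1| ≤ ∑ ζ ∈ (box N).erase 0,
      ∑' ξ, ‖inner ℂ (waveLp x₀ ξ) f‖ * ‖inner ℂ (waveLp x₀ (ξ + ζ)) f‖ := by
  have hcoef : ∀ η ∈ box N, b η = ∫ y, (J y : ℂ) * expWave 0 (-η) y ∂normalizedVolume := by
    intro η hη
    simp only [hb, Finset.sum_mul, mul_assoc, ← expWave_add]
    rw [integral_finsetSum _ fun ζ _ => Continuous.integrable_torus (by fun_prop)]
    simp only [integral_const_mul, integral_expWave]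
    rw [Finset.sum_eq_single_of_mem η hη fun ζ _ hζ => by
      rw [if_neg (by rwa [← sub_eq_add_neg, sub_eq_zero]), mul_zero]]
    simp
  have h0 : (0 : Fin 2 → ℤ) ∈ box N := by simp [mem_box]
  have hb0 : b 0 = 1 := by
    rw [hcoef 0 h0]
    simp only [neg_zero, expWave_zero, mul_one]
    rw [integral_complex_ofReal, hJ1, Complex.ofReal_one]
  have hb1 : ∀ η ∈ box N, ‖b η‖ ≤ 1 := by
    intro η hη
    rw [hcoef η hη]
    refine (norm_integral_le_integral_norm _).trans_eq ?_
    rw [← hJ1]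
    refine integral_congr_ae (ae_of_all _ fun y => ?_)
    simp only [norm_mul, norm_expWave_apply, mul_one, Complex.norm_real, Real.norm_eq_abs,
      abs_of_nonneg (hJ0 y)]
  set w : Torus → ℂ := fun y => ((‖f y‖ ^ 2 : ℝ) : ℂ) with hw
  have hwint : Integrable w normalizedVolume := (integrable_norm_sq f).ofReal
  have hint : ∀ ζ, Integrable (fun y => expWave x ζ y * w y) normalizedVolume := fun ζ =>
    hwint.bdd_mul (expWave x ζ).continuous.aestronglyMeasurable
      (ae_of_all _ fun y => (norm_expWave_apply x ζ y).le)
  have hrefl : ∀ ζ y, expWave 0 ζ (x - y) = expWave x (-ζ) y := by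
    intro ζ y
    simp only [expWave_apply, Pi.sub_apply, Pi.zero_apply, Pi.neg_apply, sub_zero]
    refine Finset.prod_congr rfl fun j _ => ?_
    rw [fourier_apply, fourier_apply, ← neg_sub (y j) (x j), smul_neg, neg_smul]
  have hsum : ((∫ y, J (x - y) * ‖f y‖ ^ 2 ∂normalizedVolume : ℝ) : ℂ)
      = ∑ ζ ∈ box N, b ζ * ∫ y, expWave x (-ζ) y * w y ∂normalizedVolume := by
    rw [← integral_complex_ofReal]
    simp only [← integral_const_mul]
    rw [← integral_finsetSum _ fun ζ _ => (hint (-ζ)).const_mul _]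
    refine integral_congr_ae (ae_of_all _ fun y => ?_)
    simp only [Complex.ofReal_mul, hb, hrefl, Finset.sum_mul, hw, mul_assoc]
  have hmean : ∫ y, expWave x (-0) y * w y ∂normalizedVolume = 1 := by
    simp only [neg_zero, expWave_zero, one_mul, hw]
    rw [integral_complex_ofReal, integral_norm_sq, hf]
    norm_num
  have hdiff : ((∫ y, J (x - y) * ‖f y‖ ^ 2 ∂normalizedVolume - 1 : ℝ) : ℂ)
      = ∑ ζ ∈ (box N).erase 0, b ζ * ∫ y, expWave x (-ζ) y * w y ∂normalizedVolume := by
    rw [Complex.ofReal_sub, hsum, ← Finset.add_sum_erase _ _ h0, hmean, hb0]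
    simp
  have hneg : ∑ ζ ∈ (box N).erase 0,
        ∑' ξ, ‖inner ℂ (waveLp x₀ ξ) f‖ * ‖inner ℂ (waveLp x₀ (ξ + ζ)) f‖
      = ∑ ζ ∈ (box N).erase 0,
        ∑' ξ, ‖inner ℂ (waveLp x₀ ξ) f‖ * ‖inner ℂ (waveLp x₀ (ξ + -ζ)) f‖ := by
    refine Finset.sum_nbij' (fun ζ => -ζ) (fun ζ => -ζ) ?_ ?_ ?_ ?_ ?_ <;> simp [mem_box]
  rw [← Real.norm_eq_abs, ← Complex.norm_real, hdiff, hneg]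
  refine norm_sum_le_of_le _ fun ζ hζ => ?_
  rw [norm_mul]
  calc _ ≤ 1 * ‖∫ y, expWave x (-ζ) y * w y ∂normalizedVolume‖ := by
        gcongr
        exact hb1 ζ (Finset.mem_erase.1 hζ).2
    _ = ‖∫ y, expWave x₀ (-ζ) y * w y ∂normalizedVolume‖ := by
        simp only [expWave_sub_center x x₀, mul_assoc, integral_const_mul]
        rw [norm_mul, norm_expWave_apply, one_mul, one_mul]
    _ ≤ _ := norm_integral_expWave_mul_norm_sq_le x₀ f (-ζ)

/-! ### Geodesic balls -/

lemma mem_geodesicBall {x y : Torus} {r : ℝ} :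
    y ∈ geodesicBall x r ↔ ‖WithLp.toLp 2 (y - x)‖ < r := by
  rw [PiLp.norm_eq_of_L2]
  rfl

lemma isOpen_geodesicBall (x : Torus) (r : ℝ) : IsOpen (geodesicBall x r) :=
  isOpen_lt (by fun_prop) continuous_const

lemma volume_torus_eq : (volume : Measure Torus)
    = ENNReal.ofReal (4 * Real.pi ^ 2) • normalizedVolume := by
  refine Measure.pi_eq fun s _ => ?_
  simp only [normalizedVolume, Measure.smul_apply, Measure.pi_pi, AddCircle.volume_eq_smul_haarAddCircle,
    Fin.prod_univ_two, smul_eq_mul]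
  rw [show 4 * Real.pi ^ 2 = (2 * Real.pi) * (2 * Real.pi) by ring,
    ENNReal.ofReal_mul Real.two_pi_pos.le]
  ring

lemma volume_geodesicBall_zero (r : ℝ) : volume (geodesicBall 0 r)
    = volume ({y : Fin 2 → ℝ | √(∑ j, ‖y j‖ ^ 2) < r} ∩
        Set.univ.pi fun _ => Set.Ioc (-Real.pi) (-Real.pi + 2 * Real.pi)) := by
  have h : MeasurePreserving (fun (y : Fin 2 → ℝ) (j : Fin 2) => (y j : AddCircle (2 * Real.pi)))
      (Measure.pi fun _ => volume.restrict (Set.Ioc (-Real.pi) (-Real.pi + 2 * Real.pi)))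
      (volume : Measure Torus) :=
    measurePreserving_pi _ _ fun _ => AddCircle.measurePreserving_mk (2 * Real.pi) (-Real.pi)
  have hm : MeasurableSet {y : Fin 2 → ℝ | √(∑ j, ‖y j‖ ^ 2) < r} :=
    (isOpen_lt (by fun_prop) continuous_const).measurableSet
  rw [← h.measure_preimage (isOpen_geodesicBall 0 r).measurableSet.nullMeasurableSet,
    ← Measure.restrict_pi_pi, ← volume_pi, ← Measure.restrict_apply hm]
  refine measure_congr ?_
  filter_upwards [ae_restrict_mem (MeasurableSet.univ_pi fun _ => measurableSet_Ioc)] with y hy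
  have : ∀ j, ‖(y j : AddCircle (2 * Real.pi))‖ = ‖y j‖ := by
    intro j
    have hj := hy j (Set.mem_univ j)
    rw [(AddCircle.norm_coe_eq_abs_iff _ Real.two_pi_pos.ne').2, Real.norm_eq_abs]
    rw [abs_of_pos Real.two_pi_pos, abs_le]
    constructor <;> linarith [hj.1, hj.2]
  refine propext ?_
  simp only [geodesicBall]
  change √(∑ j, ‖(y j : AddCircle (2 * Real.pi)) - 0‖ ^ 2) < r ↔ √(∑ j, ‖y j‖ ^ 2) < r
  simp only [sub_zero, this]

lemma volume_euclidean_ball {r : ℝ} : volume {y : Fin 2 → ℝ | √(∑ j, ‖y j‖ ^ 2) < r}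
    = ENNReal.ofReal r ^ 2 * ENNReal.ofReal Real.pi := by
  rw [← EuclideanSpace.volume_ball_fin_two 0 r, ← (PiLp.volume_preserving_toLp (Fin 2)).measure_preimage
    measurableSet_ball.nullMeasurableSet]
  congr 1
  ext y
  simp [EuclideanSpace.norm_eq]

lemma volume_geodesicBall_eq (x : Torus) (r : ℝ) :
    volume (geodesicBall x r) = volume (geodesicBall 0 r) := by
  rw [volume_torus_eq, Measure.smul_apply, Measure.smul_apply,
    ← measure_preimage_add_right normalizedVolume (-x) (geodesicBall 0 r)]
  congr 2
  ext y
  simp [mem_geodesicBall, sub_eq_add_neg]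

lemma volume_geodesicBall_le (x : Torus) {r : ℝ} (hr : 0 ≤ r) :
    volume.real (geodesicBall x r) ≤ Real.pi * r ^ 2 := by
  rw [Measure.real, volume_geodesicBall_eq, volume_geodesicBall_zero]
  refine (ENNReal.toReal_mono ?_ (measure_mono Set.inter_subset_left)).trans_eq ?_
  · rw [volume_euclidean_ball]
    finiteness
  · rw [volume_euclidean_ball, ENNReal.toReal_mul, ENNReal.toReal_pow, ENNReal.toReal_ofReal hr,
      ENNReal.toReal_ofReal Real.pi_pos.le, mul_comm]

lemma volume_geodesicBall (x : Torus) {r : ℝ} (hr : 0 ≤ r) (hr' : r ≤ Real.pi) :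
    volume.real (geodesicBall x r) = Real.pi * r ^ 2 := by
  rw [Measure.real, volume_geodesicBall_eq, volume_geodesicBall_zero, Set.inter_eq_left.2,
    volume_euclidean_ball, ENNReal.toReal_mul, ENNReal.toReal_pow, ENNReal.toReal_ofReal hr,
      ENNReal.toReal_ofReal Real.pi_pos.le, mul_comm]
  · intro y hy j _
    have h1 : ‖y j‖ < Real.pi := by
      refine lt_of_le_of_lt ?_ (lt_of_lt_of_le hy hr')
      apply Real.le_sqrt_of_sq_le
      exact Finset.single_le_sum (f := fun j => ‖y j‖ ^ 2) (fun _ _ => sq_nonneg _)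
        (Finset.mem_univ j)
    rw [Real.norm_eq_abs, abs_lt] at h1
    constructor <;> linarith

/-! ### From smoothed masses to the mass of balls -/

lemma toLp_norm_triangle (x y z : Torus) : ‖WithLp.toLp 2 (z - x)‖
    ≤ ‖WithLp.toLp 2 (y - x)‖ + ‖WithLp.toLp 2 (z - y)‖ := by
  have := norm_add_le (WithLp.toLp 2 (y - x)) (WithLp.toLp 2 (z - y))
  rwa [← WithLp.toLp_add, add_comm (y - x), sub_add_sub_cancel] at this

lemma exists_le_norm_coord {s : ℝ} {x : Torus} (h : 2 * s ≤ ‖WithLp.toLp 2 x‖) :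
    ∃ j, s ≤ ‖x j‖ := by
  by_contra! hx
  have hle : √(∑ j, ‖x j‖ ^ 2) ≤ √(2 * s ^ 2) := by
    apply Real.sqrt_le_sqrt
    rw [Fin.sum_univ_two]
    have h0 := pow_le_pow_left₀ (norm_nonneg (x 0)) (hx 0).le 2
    have h1 := pow_le_pow_left₀ (norm_nonneg (x 1)) (hx 1).le 2
    linarith
  rw [PiLp.norm_eq_of_L2] at h
  have hpos : 0 < s := (norm_nonneg (x 0)).trans_lt (hx 0)
  have h4 : √(2 * s ^ 2) < 2 * s := by
    rw [Real.sqrt_lt' (by linarith)]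
    nlinarith
  exact absurd (h.trans hle) (not_le.2 h4)

/-- A mass density `w` smoothed by a kernel `J`, integrated over a ball of radius `R`, is at least
the mass of a smaller ball and at most that of a larger one, up to the tail `T` of `J`. -/
lemma integral_ball_integral_kernel {w J : Torus → ℝ} (hw : Integrable w normalizedVolume)
    (hw0 : ∀ y, 0 ≤ w y) (hw1 : ∫ y, w y ∂normalizedVolume = 1)
    (hJ : Continuous J) (hJ0 : ∀ x, 0 ≤ J x) (hJ1 : ∫ x, J x ∂normalizedVolume = 1)
    {s T : ℝ} (hT0 : 0 ≤ T) (hT : ∀ x, (∃ j, s ≤ ‖x j‖) → J x ≤ T) (x : Torus)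
    (R : ℝ) :
    (∫ y in geodesicBall x (R - 2 * s), w y ∂normalizedVolume) * (1 - T)
      ≤ ∫ z in geodesicBall x R, ∫ y, J (z - y) * w y ∂normalizedVolume ∂normalizedVolume ∧
    ∫ z in geodesicBall x R, ∫ y, J (z - y) * w y ∂normalizedVolume ∂normalizedVolume
      ≤ (∫ y in geodesicBall x (R + 2 * s), w y ∂normalizedVolume) + T := by
  have hmeas : ∀ r, MeasurableSet (geodesicBall x r) := fun r =>
    (isOpen_geodesicBall x r).measurableSet
  have htrans : ∀ y, ∫ z, J (z - y) ∂normalizedVolume = 1 := fun y =>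
    (integral_sub_right_eq_self J y).trans hJ1
  have hJint : ∀ y, Integrable (fun z => J (z - y)) normalizedVolume := fun y =>
    Continuous.integrable_torus (by fun_prop)
  set q : Torus → ℝ := fun y => ∫ z in geodesicBall x R, J (z - y) ∂normalizedVolume with hq
  obtain ⟨C, hC⟩ : ∃ C, ∀ x, ‖J x‖ ≤ C := by
    obtain ⟨C, hC⟩ := isCompact_univ.exists_bound_of_continuousOn hJ.continuousOn
    exact ⟨C, fun x => hC x (Set.mem_univ x)⟩
  have hprod : Integrable (Function.uncurry fun z y => J (z - y) * w y)
      ((normalizedVolume.restrict (geodesicBall x R)).prod normalizedVolume) := by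
    refine (hw.comp_snd (normalizedVolume.restrict (geodesicBall x R))).bdd_mul (c := C) ?_
      (ae_of_all _ fun p => hC _)
    exact (hJ.comp (by fun_prop)).aestronglyMeasurable
  have hswap : ∫ z in geodesicBall x R, ∫ y, J (z - y) * w y ∂normalizedVolume ∂normalizedVolume
      = ∫ y, q y * w y ∂normalizedVolume := by
    rw [integral_integral_swap hprod]
    simp only [integral_mul_const, hq]
  have hqw : Integrable (fun y => q y * w y) normalizedVolume := by
    simpa only [integral_mul_const, Function.uncurry] using hprod.integral_prod_right
  have hq0 : ∀ y, 0 ≤ q y := fun y => setIntegral_nonneg (hmeas R) fun z _ => hJ0 _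
  have hq1 : ∀ y, q y ≤ 1 := fun y => by
    rw [← htrans y]
    exact setIntegral_le_integral (hJint y) (ae_of_all _ fun z => hJ0 _)
  have htail : ∀ y (S : Set Torus), MeasurableSet S → (∀ z ∈ S, 2 * s ≤ ‖WithLp.toLp 2 (z - y)‖) →
      ∫ z in S, J (z - y) ∂normalizedVolume ≤ T := by
    intro y S hS h
    calc _ ≤ ∫ z in S, T ∂normalizedVolume :=
          setIntegral_mono_on (hJint y).integrableOn (by simp) hS
            fun z hz => hT _ (exists_le_norm_coord (h z hz))
      _ = normalizedVolume.real S * T := by rw [setIntegral_const, smul_eq_mul]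
      _ ≤ 1 * T := by
          gcongr
          exact measureReal_le_one
      _ = T := one_mul T
  rw [hswap]
  constructor
  · rw [← integral_mul_const]
    calc _ ≤ ∫ y in geodesicBall x (R - 2 * s), q y * w y ∂normalizedVolume := by
          refine setIntegral_mono_on (hw.mul_const _).integrableOn hqw.integrableOn (hmeas _) ?_
          intro y hy
          rw [mul_comm]
          refine mul_le_mul_of_nonneg_right ?_ (hw0 y)
          have h := htail y (geodesicBall x R)ᶜ (hmeas R).compl fun z hz => by
            rw [Set.mem_compl_iff, mem_geodesicBall, not_lt] at hz
            rw [mem_geodesicBall] at hy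
            linarith [toLp_norm_triangle x y z]
          have h2 := integral_add_compl (hmeas R) (hJint y)
          rw [htrans y] at h2
          simp only [hq]
          linarith
      _ ≤ _ := setIntegral_le_integral hqw (ae_of_all _ fun y => mul_nonneg (hq0 y) (hw0 y))
  · rw [← integral_add_compl (hmeas (R + 2 * s)) hqw]
    refine add_le_add ?_ ?_
    · exact setIntegral_mono_on hqw.integrableOn hw.integrableOn (hmeas _)
        fun y _ => mul_le_of_le_one_left (hw0 y) (hq1 y)
    · calc _ ≤ ∫ y in (geodesicBall x (R + 2 * s))ᶜ, T * w y ∂normalizedVolume := by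
            refine setIntegral_mono_on hqw.integrableOn (hw.const_mul _).integrableOn
              (hmeas _).compl fun y hy => ?_
            refine mul_le_mul_of_nonneg_right (htail y _ (hmeas R) fun z hz => ?_) (hw0 y)
            rw [Set.mem_compl_iff, mem_geodesicBall, not_lt] at hy
            rw [mem_geodesicBall] at hz
            have := toLp_norm_triangle x z y
            have h3 : ‖WithLp.toLp 2 (y - z)‖ = ‖WithLp.toLp 2 (z - y)‖ := by
              rw [← norm_neg, ← WithLp.toLp_neg, neg_sub]
            linarith
        _ ≤ ∫ y, T * w y ∂normalizedVolume :=
            setIntegral_le_integral (hw.const_mul _) (ae_of_all _ fun y => mul_nonneg hT0 (hw0 y))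
        _ = T := by rw [integral_const_mul, hw1, mul_one]

lemma continuous_integral_kernel {w J : Torus → ℝ} (hw : Integrable w normalizedVolume)
    (hJ : Continuous J) :
    Continuous fun z => ∫ y, J (z - y) * w y ∂normalizedVolume := by
  obtain ⟨C, hC⟩ := isCompact_univ.exists_bound_of_continuousOn hJ.continuousOn
  refine continuous_of_dominated (bound := fun y => C * ‖w y‖) (fun z => ?_) (fun z => ?_)
    (hw.norm.const_mul C) (ae_of_all _ fun y => by fun_prop)
  · exact (hJ.comp (by fun_prop)).aestronglyMeasurable.mul hw.aestronglyMeasurable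
  · refine ae_of_all _ fun y => ?_
    rw [norm_mul]
    gcongr
    exact hC _ (Set.mem_univ _)

lemma setIntegral_volume_eq (w : Torus → ℝ) (S : Set Torus) :
    ∫ y in S, w y = 4 * Real.pi ^ 2 * ∫ y in S, w y ∂normalizedVolume := by
  rw [volume_torus_eq, Measure.restrict_smul, integral_smul_measure,
    ENNReal.toReal_ofReal (by positivity), smul_eq_mul]

/-- If all averages of a probability density `w` against translates of `J` are within `E` of one,
the mass of a geodesic ball is close to its area. -/
lemma mass_geodesicBall_bounds {w J : Torus → ℝ} (hw : Integrable w normalizedVolume)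
    (hw0 : ∀ y, 0 ≤ w y) (hw1 : ∫ y, w y ∂normalizedVolume = 1)
    (hJ : Continuous J) (hJ0 : ∀ x, 0 ≤ J x) (hJ1 : ∫ x, J x ∂normalizedVolume = 1)
    {δ r T E : ℝ} (hδ : 0 < δ) (hδ1 : δ < 1) (hr : 0 < r) (hrπ : r ≤ Real.pi) (hT0 : 0 ≤ T)
    (hT : ∀ x, (∃ j, δ * r / 2 ≤ ‖x j‖) → J x ≤ T)
    (hE : ∀ x, |∫ y, J (x - y) * w y ∂normalizedVolume - 1| ≤ E) (x : Torus) :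
    (∫ y in geodesicBall x r, w y) * (1 - T) ≤ (1 + E) * (Real.pi * ((1 + δ) * r) ^ 2) ∧
    (1 - E) * (Real.pi * ((1 - δ) * r) ^ 2)
      ≤ (∫ y in geodesicBall x r, w y) + 4 * Real.pi ^ 2 * T := by
  have hE0 : 0 ≤ E := (abs_nonneg _).trans (hE 0)
  set A : Torus → ℝ := fun z => ∫ y, J (z - y) * w y ∂normalizedVolume with hA
  have hAint : Integrable A normalizedVolume :=
    Continuous.integrable_torus (continuous_integral_kernel hw hJ)
  have hconst : ∀ (c : ℝ) (S : Set Torus), 4 * Real.pi ^ 2 * ∫ z in S, c ∂normalizedVolume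
      = c * volume.real S := by
    intro c S
    rw [← setIntegral_volume_eq, setIntegral_const, smul_eq_mul, mul_comm]
  have hmeas : ∀ r, MeasurableSet (geodesicBall x r) := fun r =>
    (isOpen_geodesicBall x r).measurableSet
  have h1 := (integral_ball_integral_kernel hw hw0 hw1 hJ hJ0 hJ1 hT0 hT x
    ((1 + δ) * r)).1
  have h2 := (integral_ball_integral_kernel hw hw0 hw1 hJ hJ0 hJ1 hT0 hT x
    ((1 - δ) * r)).2
  rw [show (1 + δ) * r - 2 * (δ * r / 2) = r by ring] at h1
  rw [show (1 - δ) * r + 2 * (δ * r / 2) = r by ring] at h2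
  have hpi : 0 ≤ 4 * Real.pi ^ 2 := by positivity
  rw [setIntegral_volume_eq]
  constructor
  · have h3 : ∫ z in geodesicBall x ((1 + δ) * r), A z ∂normalizedVolume
        ≤ ∫ z in geodesicBall x ((1 + δ) * r), (1 + E) ∂normalizedVolume :=
      setIntegral_mono_on hAint.integrableOn (by simp) (hmeas _)
        fun z _ => by linarith [(abs_le.1 (hE z)).2]
    calc _ = 4 * Real.pi ^ 2 * ((∫ y in geodesicBall x r, w y ∂normalizedVolume) * (1 - T)) := by
          ring
      _ ≤ 4 * Real.pi ^ 2 * ∫ z in geodesicBall x ((1 + δ) * r), (1 + E) ∂normalizedVolume := by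
          gcongr
          exact h1.trans h3
      _ = (1 + E) * volume.real (geodesicBall x ((1 + δ) * r)) := hconst _ _
      _ ≤ _ := by
          gcongr
          exact volume_geodesicBall_le x (by positivity)
  · have h3 : ∫ z in geodesicBall x ((1 - δ) * r), (1 - E) ∂normalizedVolume
        ≤ ∫ z in geodesicBall x ((1 - δ) * r), A z ∂normalizedVolume :=
      setIntegral_mono_on (by simp) hAint.integrableOn (hmeas _)
        fun z _ => by linarith [(abs_le.1 (hE z)).1]
    have h4 : (1 - δ) * r ≤ Real.pi := by nlinarith
    rw [← volume_geodesicBall x (mul_nonneg (by linarith) hr.le) h4, ← hconst, ← mul_add]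
    gcongr
    exact h3.trans h2

/-! ### Equidistribution for a single eigenvalue -/

/-- The sum of the autocorrelations, at nonzero shifts in `box K`, of the absolute values of the
Fourier coefficients of `G_lam`, relative to `‖G_lam‖²`. -/
def massError (lam : ℝ) (K : ℕ) : ℝ :=
  (∑ ζ ∈ (box K).erase 0, ∑' ξ, |((normSq ξ : ℝ) - lam)⁻¹| * |((normSq (ξ + ζ) : ℝ) - lam)⁻¹|)
    / ∑' ξ, (((normSq ξ : ℝ) - lam)⁻¹) ^ 2

lemma massError_mono (lam : ℝ) {K K' : ℕ} (h : K ≤ K') : massError lam K ≤ massError lam K' := by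
  unfold massError
  refine div_le_div_of_nonneg_right ?_ (tsum_nonneg fun _ => sq_nonneg _)
  exact Finset.sum_le_sum_of_subset_of_nonneg (Finset.erase_subset_erase _ (box_mono h))
    fun _ _ _ => tsum_nonneg fun _ => by positivity

lemma norm_inner_wave_green (x₀ : Torus) (lam : ℝ) (ξ : Fin 2 → ℤ) :
    ‖inner ℂ (waveLp x₀ ξ) (green x₀ lam)‖ = |((normSq ξ : ℝ) - lam)⁻¹| := by
  rw [inner_wave_green, one_div, ← Real.norm_eq_abs, ← Complex.norm_real]
  push_cast
  rfl

lemma hasSum_norm_sq_green (x₀ : Torus) (lam : ℝ) :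
    HasSum (fun ξ : Fin 2 → ℤ => (((normSq ξ : ℝ) - lam)⁻¹) ^ 2) (‖green x₀ lam‖ ^ 2) := by
  have h := hasSum_conj_mul x₀ (green x₀ lam) (green x₀ lam)
  rw [inner_self_eq_norm_sq_to_K] at h
  have e : ∀ ξ, conj (inner ℂ (waveLp x₀ ξ) (green x₀ lam)) * inner ℂ (waveLp x₀ ξ) (green x₀ lam)
      = (((((normSq ξ : ℝ) - lam)⁻¹) ^ 2 : ℝ) : ℂ) := fun ξ => by
    rw [Complex.conj_mul', norm_inner_wave_green, ← Complex.ofReal_pow, sq_abs]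
  simp only [e] at h
  refine Complex.hasSum_ofReal.1 ?_
  push_cast at h ⊢
  exact h

lemma norm_green_pos (x₀ : Torus) {lam : ℝ} (hlam : ∀ ξ, (normSq ξ : ℝ) ≠ lam) :
    0 < ‖green x₀ lam‖ := by
  rw [norm_pos_iff]
  intro h
  have h2 := norm_inner_wave_green x₀ lam 0
  rw [h, inner_zero_right, norm_zero, eq_comm, abs_eq_zero, inv_eq_zero, sub_eq_zero] at h2
  exact hlam 0 h2

lemma norm_normalizedGreen (x₀ : Torus) {lam : ℝ} (hlam : ∀ ξ, (normSq ξ : ℝ) ≠ lam) :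
    ‖normalizedGreen x₀ lam‖ = 1 := by
  have := norm_green_pos x₀ hlam
  rw [normalizedGreen, norm_smul, norm_inv, Complex.norm_real, norm_norm, inv_mul_cancel₀ this.ne']

lemma sum_autocorrelation_normalizedGreen (x₀ : Torus) (lam : ℝ) (K : ℕ) :
    ∑ ζ ∈ (box K).erase 0, ∑' ξ, ‖inner ℂ (waveLp x₀ ξ) (normalizedGreen x₀ lam)‖
      * ‖inner ℂ (waveLp x₀ (ξ + ζ)) (normalizedGreen x₀ lam)‖ = massError lam K := by
  have h : ∀ ξ, ‖inner ℂ (waveLp x₀ ξ) (normalizedGreen x₀ lam)‖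
      = ‖green x₀ lam‖⁻¹ * |((normSq ξ : ℝ) - lam)⁻¹| := fun ξ => by
    rw [normalizedGreen, inner_smul_right, norm_mul, norm_inner_wave_green, norm_inv,
      Complex.norm_real, norm_norm]
  rw [massError, (hasSum_norm_sq_green x₀ lam).tsum_eq, Finset.sum_div]
  refine Finset.sum_congr rfl fun ζ _ => ?_
  rw [← tsum_div_const]
  refine tsum_congr fun ξ => ?_
  rw [h, h]
  ring

/-- The kernel adapted to `lam`: its degree is at most `lam ^ (1/2 - a)`, and at distances
comparable to `lam ^ (-1/2 + 2 a)` it is at most a small multiple of `lam⁻¹`. -/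
lemma eventually_exists_kernel {a e : ℝ} (ha : 0 < a) (ha' : a < 1 / 2) (he0 : 0 < e) :
    ∀ᶠ lam : ℝ in atTop, ∃ (J : Torus → ℝ) (T : ℝ) (N : ℕ) (b : (Fin 2 → ℤ) → ℂ),
      Continuous J ∧ (∀ x, 0 ≤ J x) ∧ ∫ x, J x ∂normalizedVolume = 1 ∧
      N ≤ ⌊lam ^ (1 / 2 - a)⌋₊ ∧ (∀ x, (J x : ℂ) = ∑ ζ ∈ box N, b ζ * expWave 0 ζ x) ∧
      0 ≤ T ∧ (∀ x, (∃ j, e * lam ^ (-(1 / 2) + 2 * a) / 2 ≤ ‖x j‖) → J x ≤ T) ∧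
      T ≤ e ∧ 4 * Real.pi * T ≤ e * lam⁻¹ := by
  -- The tail is governed by the `2 k`-th power of `lam ^ (-a)`.
  obtain ⟨k, hk⟩ := exists_nat_ge (3 / (2 * a) + 1)
  have hk1 : 1 ≤ k := by
    have : (0 : ℝ) < 3 / (2 * a) := by positivity
    exact_mod_cast (by linarith : (1 : ℝ) ≤ k)
  have hk0 : (0 : ℝ) < k := by exact_mod_cast hk1
  have hak : 3 ≤ a * (2 * k : ℕ) := by
    have : 3 / (2 * a) ≤ k := by linarith
    rw [div_le_iff₀ (by positivity)] at this
    push_cast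
    linarith
  set C : ℝ := Real.pi ^ 2 * (64 * Real.pi * k / e) ^ (2 * k) with hC
  have hC0 : 0 < C := by positivity
  filter_upwards [eventually_ge_atTop (1 : ℝ), eventually_ge_atTop (C / e),
    eventually_ge_atTop (4 * Real.pi * C / e),
    (tendsto_rpow_atTop (by linarith : 0 < 1 / 2 - a)).eventually_ge_atTop (4 * k + 1 : ℝ)]
    with lam h1 h2 h3 h4
  have hl0 : 0 < lam := by linarith
  set N := ⌊lam ^ (1 / 2 - a)⌋₊ with hN
  set M := N / (2 * k) with hM
  set ρ : ℝ := lam ^ (-(1 / 2) + 2 * a) with hρ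
  have hρ0 : 0 < ρ := by positivity
  have hNle : (N : ℝ) ≤ lam ^ (1 / 2 - a) := Nat.floor_le (by positivity)
  have hNlt : lam ^ (1 / 2 - a) < N + 1 := Nat.lt_floor_add_one _
  have hN4 : 4 * k ≤ N := by
    have : (4 * k : ℝ) ≤ N := by linarith
    exact_mod_cast this
  have hMN : 2 * k * M ≤ N := Nat.mul_div_le N (2 * k)
  have hM1 : 1 ≤ M := (Nat.one_le_div_iff (by omega)).2 (by omega)
  have hMbig : lam ^ (1 / 2 - a) ≤ 8 * k * M := by
    have e1 : N < 2 * k * (M + 1) := by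
      rw [mul_add, mul_one, hM]
      have := Nat.div_add_mod N (2 * k)
      have := Nat.mod_lt N (by omega : 0 < 2 * k)
      omega
    have e2 : N + 1 ≤ 8 * k * M := by nlinarith
    have : (N + 1 : ℝ) ≤ 8 * k * M := by exact_mod_cast e2
    linarith
  have hMle : (M : ℝ) ^ 2 ≤ lam := by
    have e1 : (M : ℝ) ≤ lam ^ (1 / 2 : ℝ) := by
      calc (M : ℝ) ≤ N := by exact_mod_cast Nat.div_le_self _ _
        _ ≤ lam ^ (1 / 2 - a) := hNle
        _ ≤ _ := Real.rpow_le_rpow_of_exponent_le h1 (by linarith)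
    rw [← Real.sqrt_eq_rpow] at e1
    exact (Real.le_sqrt (by positivity) hl0.le).1 e1
  have hM0 : (0 : ℝ) < M := by exact_mod_cast hM1
  have hlam2 : lam ^ (-2 : ℝ) = lam⁻¹ * lam⁻¹ := by
    rw [← Real.rpow_neg_one, ← Real.rpow_add hl0]; norm_num
  have hinv : lam⁻¹ ≤ 1 := inv_le_one_of_one_le₀ h1
  have hinv0 : 0 < lam⁻¹ := inv_pos.2 hl0
  obtain ⟨J, hJ, hJ0, hJ1, ⟨b, hb⟩, hJT⟩ := exists_kernel hM1 k
  refine ⟨J, C * lam ^ (-2 : ℝ), 2 * k * M, b, hJ, hJ0, hJ1, hMN, hb, by positivity, ?_, ?_, ?_⟩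
  · intro x hx
    refine (hJT (e * ρ / 2) (by positivity) x hx).trans ?_
    have e1 : 4 * Real.pi / (M * (e * ρ / 2)) ≤ 64 * Real.pi * k / e * lam ^ (-a) := by
      have e2 : lam ^ a ≤ 8 * k * M * ρ := by
        calc lam ^ a = lam ^ (1 / 2 - a) * ρ := by
              rw [hρ, ← Real.rpow_add hl0]; congr 1; ring
          _ ≤ _ := by gcongr
      rw [Real.rpow_neg hl0.le, ← div_eq_mul_inv, div_div,
        div_le_div_iff₀ (by positivity) (by positivity)]
      have := mul_le_mul_of_nonneg_left e2 (by positivity : 0 ≤ 4 * Real.pi * e)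
      linarith
    calc _ ≤ Real.pi ^ 2 * lam * (64 * Real.pi * k / e * lam ^ (-a)) ^ (2 * k) := by gcongr
      _ = C * (lam * lam ^ (-(a * (2 * k : ℕ)))) := by
          rw [mul_pow, ← Real.rpow_mul_natCast hl0.le, neg_mul, hC]
          ring
      _ ≤ C * lam ^ (-2 : ℝ) := by
          gcongr
          rw [← Real.rpow_one_add' hl0.le (by linarith)]
          exact Real.rpow_le_rpow_of_exponent_le h1 (by linarith)
  · rw [hlam2]
    calc C * (lam⁻¹ * lam⁻¹) ≤ C * (lam⁻¹ * 1) := by gcongr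
      _ ≤ e := by
          rw [mul_one, ← div_eq_mul_inv, div_le_iff₀ hl0]
          rw [div_le_iff₀ he0] at h2
          linarith
  · rw [hlam2]
    calc _ = (4 * Real.pi * C * lam⁻¹) * lam⁻¹ := by ring
      _ ≤ e * lam⁻¹ := by
          gcongr
          rw [← div_eq_mul_inv, div_le_iff₀ hl0]
          rw [div_le_iff₀ he0] at h3
          linarith

lemma abs_div_sub_one_le {I A T e : ℝ} (hA : 0 < A) (hI : 0 ≤ I) (he0 : 0 < e) (he1 : 16 * e ≤ 1)
    (hT : T ≤ e) (hup : I * (1 - T) ≤ (1 + e) ^ 3 * A) (hlow : (1 - e) ^ 3 * A ≤ I + e * A) :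
    |I / A - 1| ≤ 16 * e := by
  rw [abs_le, le_sub_iff_add_le, sub_le_iff_le_add, le_div_iff₀ hA, div_le_iff₀ hA]
  constructor
  · have e2 : 1 - 16 * e ≤ (1 - e) ^ 3 - e := by nlinarith [sq_nonneg e]
    have := mul_le_mul_of_nonneg_right e2 hA.le
    linarith
  · have e2 : I * (1 - e) ≤ (1 + e) ^ 3 * A :=
      (mul_le_mul_of_nonneg_left (by linarith) hI).trans hup
    have e3 : (1 + e) ^ 3 ≤ (16 * e + 1) * (1 - e) := by nlinarith [sq_nonneg e, mul_pos he0 he0]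
    have e4 := mul_le_mul_of_nonneg_right e3 hA.le
    have e5 : I * (1 - e) ≤ (16 * e + 1) * A * (1 - e) := by linarith
    exact le_of_mul_le_mul_right e5 (by linarith)

/-- At scales `r > lam ^ (-1/2 + 2 a)` the mass of `g_lam` in balls is controlled by the
autocorrelations of its Fourier coefficients at shifts below `lam ^ (1/2 - a)`. -/
lemma exists_massDiscrepancy_le {a η : ℝ} (ha : 0 < a) (ha' : a < 1 / 2) (hη : 0 < η) :
    ∃ e : ℝ, 0 < e ∧ ∀ᶠ lam : ℝ in atTop, ∀ x₀ : Torus, (∀ ξ, (normSq ξ : ℝ) ≠ lam) →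
      massError lam ⌊lam ^ (1 / 2 - a)⌋₊ ≤ e →
      massDiscrepancy x₀ lam (lam ^ (-(1 / 2) + 2 * a)) ≤ ENNReal.ofReal η := by
  set e : ℝ := min η 1 / 16 with he
  have he0 : 0 < e := by positivity
  have heη : 16 * e ≤ η := by rw [he]; linarith [min_le_left η 1]
  have he1 : 16 * e ≤ 1 := by rw [he]; linarith [min_le_right η 1]
  refine ⟨e, he0, ?_⟩
  filter_upwards [eventually_ge_atTop (1 : ℝ), eventually_exists_kernel ha ha' he0]
    with lam h1 hker x₀ hlam hE
  obtain ⟨J, T, N, b, hJ, hJ0, hJ1, hN, hb, hT0, hJT, hTe, hTlam⟩ := hker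
  have hl0 : 0 < lam := by linarith
  set ρ : ℝ := lam ^ (-(1 / 2) + 2 * a) with hρ
  have hρ0 : 0 < ρ := by positivity
  set g := normalizedGreen x₀ lam with hg
  have hgnorm : ‖g‖ = 1 := norm_normalizedGreen x₀ hlam
  have hE' : ∀ x, |∫ y, J (x - y) * ‖g y‖ ^ 2 ∂normalizedVolume - 1| ≤ e := by
    intro x
    refine (abs_integral_kernel_sub_le x₀ x hgnorm hJ0 hJ1 hb).trans ?_
    rw [sum_autocorrelation_normalizedGreen]
    exact (massError_mono lam hN).trans hE
  refine iSup_le fun x => iSup_le fun r => iSup_le fun hr => ENNReal.ofReal_le_ofReal ?_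
  have hr0 : 0 < r := hρ0.trans hr.1
  have hJT' : ∀ y, (∃ j, e * r / 2 ≤ ‖y j‖) → J y ≤ T := fun y ⟨j, hj⟩ =>
    hJT y ⟨j, le_trans (by gcongr; exact hr.1.le) hj⟩
  obtain ⟨hup, hlow⟩ := mass_geodesicBall_bounds (integrable_norm_sq g)
    (fun y => sq_nonneg ‖g y‖) ((integral_norm_sq g).trans (by rw [hgnorm, one_pow])) hJ hJ0 hJ1
    he0 (by linarith) hr0 hr.2 hT0 hJT' hE' x
  have hpr : 0 < Real.pi * r ^ 2 := by positivity
  -- The tail is small even compared with the area of the smallest balls.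
  have hTr : 4 * Real.pi ^ 2 * T ≤ e * (Real.pi * r ^ 2) := by
    have e1 : lam⁻¹ ≤ r ^ 2 := by
      calc lam⁻¹ = lam ^ (-1 : ℝ) := (Real.rpow_neg_one lam).symm
        _ ≤ lam ^ ((-(1 / 2) + 2 * a) * (2 : ℕ)) :=
            Real.rpow_le_rpow_of_exponent_le h1 (by push_cast; linarith)
        _ = ρ ^ 2 := Real.rpow_mul_natCast hl0.le _ _
        _ ≤ r ^ 2 := by gcongr; exact hr.1.le
    calc 4 * Real.pi ^ 2 * T = Real.pi * (4 * Real.pi * T) := by ring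
      _ ≤ Real.pi * (e * r ^ 2) :=
          mul_le_mul_of_nonneg_left (hTlam.trans (by gcongr)) Real.pi_pos.le
      _ = _ := by ring
  refine (abs_div_sub_one_le hpr (integral_nonneg fun y => sq_nonneg ‖g y‖) he0 he1 hTe
    (hup.trans_eq (by ring)) ?_).trans heη
  calc _ = (1 - e) * (Real.pi * ((1 - e) * r) ^ 2) := by ring
    _ ≤ _ := hlow
    _ ≤ _ := by gcongr

/-! ### New eigenvalues and gaps between values of `|ξ|²` -/

lemma pairSum_nonneg (m : ℤ) (K : ℕ) : 0 ≤ pairSum m K :=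
  Finset.sum_nonneg fun _ _ => tsum_nonneg fun _ => mul_nonneg (weight_pos _).le (weight_pos _).le

lemma pairSum_mono (m : ℤ) {K K' : ℕ} (h : K ≤ K') : pairSum m K ≤ pairSum m K' :=
  Finset.sum_le_sum_of_subset_of_nonneg (Finset.erase_subset_erase _ (box_mono h))
    fun _ _ _ => tsum_nonneg fun _ => mul_nonneg (weight_pos _).le (weight_pos _).le

/-- If `lam` lies in the gap `(|α|², |β|²)`, its distance to any `|ξ|²` is comparable to that of
`|α|²`, up to the length of the gap; so `massError` is controlled by `pairSum`. -/
lemma massError_le {lam : ℝ} {α β : Fin 2 → ℤ} (h1 : (normSq α : ℝ) < lam)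
    (h2 : lam < normSq β) (hgap : ∀ ξ, normSq ξ ≤ normSq α ∨ normSq β ≤ normSq ξ) (K : ℕ) :
    massError lam K ≤ 4 * ((normSq β : ℝ) - normSq α) ^ 2 * pairSum (normSq α) K := by
  set m : ℤ := normSq α with hm
  set h : ℝ := (normSq β : ℝ) - m with hh
  have hh1 : 1 ≤ h := by
    have h3 : m < normSq β := by exact_mod_cast h1.trans h2
    have h4 : ((m + 1 : ℤ) : ℝ) ≤ normSq β := by exact_mod_cast h3
    push_cast at h4
    linarith
  -- `d` is the distance from `lam` to the nearest value of `|ξ|²`.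
  set d : ℝ := min (lam - m) (normSq β - lam) with hd
  have hd0 : 0 < d := lt_min (by linarith) (by linarith)
  have hd1 : d ≤ lam - m := min_le_left _ _
  have hd2 : d ≤ normSq β - lam := min_le_right _ _
  have hweight : ∀ ξ, |((normSq ξ : ℝ) - lam)⁻¹| ≤ 2 * h / d * weight (normSq ξ - m) := by
    intro ξ
    have hpos : (0 : ℝ) < 1 + |((normSq ξ - m : ℤ) : ℝ)| := by positivity
    have hne : 0 < |(normSq ξ : ℝ) - lam| := by
      rw [abs_pos, sub_ne_zero]
      rcases hgap ξ with h3 | h3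
      · have : (normSq ξ : ℝ) ≤ m := by exact_mod_cast h3
        linarith
      · have : (normSq β : ℝ) ≤ normSq ξ := by exact_mod_cast h3
        linarith
    rw [weight, abs_inv, ← div_eq_mul_inv, div_div, ← one_div,
      div_le_div_iff₀ hne (by positivity), one_mul]
    push_cast
    rcases hgap ξ with h3 | h3
    · have h4 : (normSq ξ : ℝ) ≤ m := by exact_mod_cast h3
      rw [abs_of_nonpos (by linarith), abs_of_neg (by linarith)]
      nlinarith
    · have h4 : (normSq β : ℝ) ≤ normSq ξ := by exact_mod_cast h3
      rw [abs_of_nonneg (by linarith), abs_of_pos (by linarith)]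
      nlinarith
  have hsum : Summable fun ξ : Fin 2 → ℤ => (((normSq ξ : ℝ) - lam)⁻¹) ^ 2 :=
    (hasSum_norm_sq_green 0 lam).summable
  have hden : (d ^ 2)⁻¹ ≤ ∑' ξ : Fin 2 → ℤ, (((normSq ξ : ℝ) - lam)⁻¹) ^ 2 := by
    rcases min_choice (lam - m) (normSq β - lam) with h3 | h3
    · refine le_trans (le_of_eq ?_) (hsum.le_tsum α fun _ _ => sq_nonneg _)
      rw [hd, h3, inv_pow, ← neg_sub, neg_sq]
    · refine le_trans (le_of_eq ?_) (hsum.le_tsum β fun _ _ => sq_nonneg _)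
      rw [hd, h3, inv_pow]
  have hnum : ∑ ζ ∈ (box K).erase 0,
      ∑' ξ, |((normSq ξ : ℝ) - lam)⁻¹| * |((normSq (ξ + ζ) : ℝ) - lam)⁻¹|
      ≤ (2 * h / d) ^ 2 * pairSum m K := by
    rw [pairSum, Finset.mul_sum]
    refine Finset.sum_le_sum fun ζ _ => ?_
    have hs := (summable_weight_mul_weight (normSq_nonneg α) ζ).mul_left ((2 * h / d) ^ 2)
    have hle : ∀ ξ, |((normSq ξ : ℝ) - lam)⁻¹| * |((normSq (ξ + ζ) : ℝ) - lam)⁻¹|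
        ≤ (2 * h / d) ^ 2 * (weight (normSq ξ - m) * weight (normSq (ξ + ζ) - m)) := by
      intro ξ
      calc _ ≤ (2 * h / d * weight (normSq ξ - m)) * (2 * h / d * weight (normSq (ξ + ζ) - m)) :=
            mul_le_mul (hweight ξ) (hweight (ξ + ζ)) (abs_nonneg _)
              (mul_nonneg (by positivity) (weight_pos _).le)
        _ = _ := by ring
    rw [← tsum_mul_left]
    exact (Summable.of_nonneg_of_le (fun _ => by positivity) hle hs).tsum_le_tsum hle hs
  have hp : 0 ≤ pairSum m K := pairSum_nonneg m K
  rw [massError, div_le_iff₀ (lt_of_lt_of_le (by positivity) hden)]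
  calc _ ≤ (2 * h / d) ^ 2 * pairSum m K := hnum
    _ = 4 * h ^ 2 * pairSum m K * (d ^ 2)⁻¹ := by field_simp; ring
    _ ≤ _ := by gcongr

lemma exists_lt_normSq (x : ℝ) : ∃ ξ, x < normSq ξ := by
  obtain ⟨n, hn⟩ := exists_nat_gt x
  refine ⟨fun _ => n, hn.trans_le ?_⟩
  rw [normSq_eq]
  push_cast
  have : (n : ℝ) ≤ (n : ℝ) ^ 2 := by exact_mod_cast Nat.le_self_pow two_ne_zero n
  nlinarith [sq_nonneg (n : ℝ)]

lemma exists_least_normSq_gt (m : ℤ) :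
    ∃ β, m < normSq β ∧ ∀ ξ, normSq ξ ≤ m ∨ normSq β ≤ normSq ξ := by
  obtain ⟨ξ, hξ⟩ := exists_lt_normSq m
  obtain ⟨_, ⟨⟨β, rfl⟩, hβ⟩, hmin⟩ := Int.exists_least_of_bdd
    (P := fun n => (∃ ξ, normSq ξ = n) ∧ m < n) ⟨m, fun z hz => hz.2.le⟩
    ⟨normSq ξ, ⟨ξ, rfl⟩, by exact_mod_cast hξ⟩
  refine ⟨β, hβ, fun ξ => ?_⟩
  rw [or_iff_not_imp_left, not_le]
  exact fun h => hmin _ ⟨⟨ξ, rfl⟩, h⟩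

lemma exists_gap {lam : ℝ} (h0 : 0 ≤ lam) (hlam : ∀ ξ, (normSq ξ : ℝ) ≠ lam) : ∃ α β,
    (normSq α : ℝ) < lam ∧ lam < normSq β ∧
      ∀ ξ, normSq ξ ≤ normSq α ∨ normSq β ≤ normSq ξ := by
  obtain ⟨_, ⟨⟨α, rfl⟩, hα⟩, hmax⟩ := Int.exists_greatest_of_bdd
    (P := fun n => (∃ ξ, normSq ξ = n) ∧ (n : ℝ) ≤ lam)
    ⟨⌊lam⌋, fun z hz => Int.le_floor.2 hz.2⟩ ⟨0, ⟨0, normSq_zero⟩, by simpa using h0⟩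
  obtain ⟨β, hβ, hgap⟩ := exists_least_normSq_gt (normSq α)
  refine ⟨α, β, lt_of_le_of_ne hα (hlam α), ?_, hgap⟩
  by_contra hle
  exact absurd (hmax _ ⟨⟨β, rfl⟩, not_lt.1 hle⟩) (not_le.2 hβ)

/-- The largest value of `|ξ|²` not exceeding `lam`. -/
def prevNorm (lam : ℝ) : ℤ := sSup {n : ℤ | (∃ ξ, normSq ξ = n) ∧ (n : ℝ) ≤ lam}

lemma prevNorm_eq {lam : ℝ} {α β : Fin 2 → ℤ} (h1 : (normSq α : ℝ) < lam)
    (h2 : lam < normSq β) (hgap : ∀ ξ, normSq ξ ≤ normSq α ∨ normSq β ≤ normSq ξ) :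
    prevNorm lam = normSq α := by
  refine IsGreatest.csSup_eq ⟨⟨⟨α, rfl⟩, h1.le⟩, ?_⟩
  rintro _ ⟨⟨ξ, rfl⟩, hξ⟩
  refine (hgap ξ).resolve_right fun h => ?_
  have : (normSq β : ℝ) ≤ normSq ξ := by exact_mod_cast h
  linarith

variable {x₀ : Torus} {φ : ℝ}

/-- There is at most one new eigenvalue in each gap between values of `|ξ|²`. -/
lemma injOn_prevNorm (hφ : φ ∈ Set.Ioo (-Real.pi) Real.pi) :
    Set.InjOn prevNorm {lam ∈ newEigenvalues x₀ φ | 0 ≤ lam} := by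
  have key : ∀ lam mu, lam ∈ newEigenvalues x₀ φ → 0 ≤ lam → mu ∈ newEigenvalues x₀ φ → 0 ≤ mu →
      prevNorm lam = prevNorm mu → lam ≤ mu → lam = mu := by
    intro lam mu hl hl0 hm hm0 heq hle
    obtain ⟨α, β, h1, h2, h3⟩ := exists_gap hl0 hl.2
    obtain ⟨α', β', h1', h2', h3'⟩ := exists_gap hm0 hm.2
    rw [prevNorm_eq h1 h2 h3, prevNorm_eq h1' h2' h3'] at heq
    refine eq_of_hasSum_spectralTerm (hasSum_spectralTerm_of_mem hφ hl)
      (hasSum_spectralTerm_of_mem hφ hm) hle fun ξ => ?_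
    rcases h3' ξ with h | h
    · left
      rw [← heq] at h
      have : (normSq ξ : ℝ) ≤ normSq α := by exact_mod_cast h
      linarith
    · right
      have : (normSq β' : ℝ) ≤ normSq ξ := by exact_mod_cast h
      linarith
  rintro lam ⟨hl, hl0⟩ mu ⟨hm, hm0⟩ heq
  rcases le_total lam mu with h | h
  · exact key lam mu hl hl0 hm hm0 heq h
  · exact (key mu lam hm hm0 hl hl0 heq.symm h).symm

lemma subsingleton_neg_newEigenvalues (hφ : φ ∈ Set.Ioo (-Real.pi) Real.pi) :
    {lam ∈ newEigenvalues x₀ φ | lam < 0}.Subsingleton := by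
  have key : ∀ lam mu, lam ∈ newEigenvalues x₀ φ → mu ∈ newEigenvalues x₀ φ → mu < 0 →
      lam ≤ mu → lam = mu := fun lam mu hl hm hm0 hle =>
    eq_of_hasSum_spectralTerm (hasSum_spectralTerm_of_mem hφ hl)
      (hasSum_spectralTerm_of_mem hφ hm) hle fun ξ => Or.inr
        (hm0.trans_le (by exact_mod_cast normSq_nonneg ξ))
  rintro lam ⟨hl, hl0⟩ mu ⟨hm, hm0⟩
  rcases le_total lam mu with h | h
  · exact key lam mu hl hm hm0 h
  · exact (key mu lam hm hl hl0 h).symm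

lemma prevNorm_mem_normValues {lam X : ℝ} (h0 : 0 ≤ lam) (hlam : ∀ ξ, (normSq ξ : ℝ) ≠ lam)
    (hX : lam ≤ X) : prevNorm lam ∈ normValues ⌊X⌋₊ := by
  obtain ⟨α, β, h1, h2, h3⟩ := exists_gap h0 hlam
  rw [prevNorm_eq h1 h2 h3, mem_normValues]
  refine ⟨⟨α, rfl⟩, ?_⟩
  rw [Int.natCast_floor_eq_floor (h0.trans hX), Int.le_floor]
  linarith

lemma finite_newEigenvalues_le (hφ : φ ∈ Set.Ioo (-Real.pi) Real.pi) (X : ℝ) :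
    {lam ∈ newEigenvalues x₀ φ | lam ≤ X}.Finite := by
  have h1 : {lam ∈ newEigenvalues x₀ φ | 0 ≤ lam ∧ lam ≤ X}.Finite := by
    refine Set.Finite.of_injOn (f := prevNorm) (t := (normValues ⌊X⌋₊ : Set ℤ)) ?_ ?_
      (Finset.finite_toSet _)
    · rintro lam ⟨hl, h0, hX⟩
      exact prevNorm_mem_normValues h0 hl.2 hX
    · refine (injOn_prevNorm (x₀ := x₀) hφ).mono ?_
      exact fun lam h => ⟨h.1, h.2.1⟩
  refine ((subsingleton_neg_newEigenvalues (x₀ := x₀) hφ).finite.union h1).subset ?_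
  rintro lam ⟨hl, hX⟩
  rcases lt_or_ge lam 0 with h | h
  · exact Or.inl ⟨hl, h⟩
  · exact Or.inr ⟨hl, h, hX⟩

/-- Every bounded gap between values of `|ξ|²` contains a new eigenvalue. -/
lemma card_normValues_le (hφ : φ ∈ Set.Ioo (-Real.pi) Real.pi) (X : ℕ) :
    (normValues X).card ≤ {lam ∈ newEigenvalues x₀ φ | lam ≤ X}.ncard + 1 := by
  have hne : (normValues X).Nonempty := ⟨0, mem_normValues.2 ⟨⟨0, normSq_zero⟩, by simp⟩⟩
  set M := (normValues X).max' hne with hM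
  have hMmem : M ∈ normValues X := Finset.max'_mem _ _
  have hsub : (((normValues X).erase M : Finset ℤ) : Set ℤ)
      ⊆ prevNorm '' {lam ∈ newEigenvalues x₀ φ | lam ≤ X} := by
    intro n hn
    obtain ⟨hnM, hn⟩ := Finset.mem_erase.1 hn
    obtain ⟨⟨α, rfl⟩, hαX⟩ := mem_normValues.1 hn
    obtain ⟨⟨γ, hγ⟩, hMX⟩ := mem_normValues.1 hMmem
    obtain ⟨β, hβ, hgap⟩ := exists_least_normSq_gt (normSq α)
    have hlt : normSq α < M := lt_of_le_of_ne (Finset.le_max' _ _ hn) hnM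
    have hβM : normSq β ≤ M := by
      rcases hgap γ with h | h
      · omega
      · omega
    obtain ⟨lam, h1, h2, hs⟩ := exists_hasSum_spectralTerm (Real.tan (φ / 2)) hβ hgap
    refine ⟨lam, ⟨mem_newEigenvalues_of_hasSum x₀ hφ (fun ξ hξ => ?_) hs, ?_⟩,
      prevNorm_eq h1 h2 hgap⟩
    · rcases hgap ξ with h | h
      · have : (normSq ξ : ℝ) ≤ normSq α := by exact_mod_cast h
        linarith
      · have : (normSq β : ℝ) ≤ normSq ξ := by exact_mod_cast h
        linarith
    · have : (normSq β : ℝ) ≤ X := by exact_mod_cast hβM.trans hMX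
      linarith
  have hfin := finite_newEigenvalues_le (x₀ := x₀) hφ X
  have h1 := Set.ncard_le_ncard hsub (hfin.image _)
  rw [Set.ncard_coe_finset, Finset.card_erase_of_mem hMmem] at h1
  have h2 := Set.ncard_image_le (f := prevNorm) hfin
  omega

/-! ### Exceptional eigenvalues are sparse -/

/-- The new eigenvalues `lam ≥ 1` whose `massError` at frequency `lam ^ (1/2 - a)` exceeds `a`. -/
def badEigenvalues (x₀ : Torus) (φ a : ℝ) : Set ℝ :=
  {lam ∈ newEigenvalues x₀ φ | 1 ≤ lam ∧ a < massError lam ⌊lam ^ (1 / 2 - a)⌋₊}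

lemma badEigenvalues_anti {a a' : ℝ} (h : a ≤ a') :
    badEigenvalues x₀ φ a' ⊆ badEigenvalues x₀ φ a := by
  rintro lam ⟨hl, h1, hb⟩
  refine ⟨hl, h1, h.trans_lt (hb.trans_le (massError_mono _ (Nat.floor_mono ?_)))⟩
  exact Real.rpow_le_rpow_of_exponent_le h1 (by linarith)

open Classical in
/-- Values of `|ξ|²` followed by a gap of length at least `H` are rare. -/
lemma card_large_gaps_le (X : ℕ) {H : ℕ} (hH : 1 ≤ H) :
    ((normValues X).filter fun m => ∀ ξ, normSq ξ ≤ m ∨ m + H ≤ normSq ξ).card ≤ X / H + 1 := by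
  have hH0 : (0 : ℤ) < H := by exact_mod_cast hH
  have hmaps : Set.MapsTo (fun m : ℤ => m / H)
      ((normValues X).filter fun m => ∀ ξ, normSq ξ ≤ m ∨ m + H ≤ normSq ξ : Finset ℤ)
      (Finset.Icc (0 : ℤ) (X / H : ℕ) : Finset ℤ) := by
    intro m hm
    obtain ⟨⟨ξ, rfl⟩, hX⟩ := mem_normValues.1 (Finset.mem_filter.1 hm).1
    rw [Finset.mem_coe, Finset.mem_Icc]
    refine ⟨Int.ediv_nonneg (normSq_nonneg ξ) hH0.le, ?_⟩
    push_cast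
    exact Int.ediv_le_ediv hH0 hX
  have key : ∀ m m' : ℤ, (∀ ξ, normSq ξ ≤ m ∨ m + H ≤ normSq ξ) → (∃ ξ, normSq ξ = m') → m < m' →
      m / H < m' / H := by
    rintro m _ h ⟨ξ, rfl⟩ hlt
    have h1 : m + H ≤ normSq ξ := (h ξ).resolve_left (not_le.2 hlt)
    have h2 := Int.ediv_le_ediv hH0 h1
    rw [Int.add_ediv_of_dvd_right (dvd_refl _), Int.ediv_self hH0.ne'] at h2
    omega
  have hinj : Set.InjOn (fun m : ℤ => m / H)
      ((normValues X).filter fun m => ∀ ξ, normSq ξ ≤ m ∨ m + H ≤ normSq ξ : Finset ℤ) := by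
    intro m hm m' hm' heq
    obtain ⟨h1, h2⟩ := Finset.mem_filter.1 hm
    obtain ⟨h1', h2'⟩ := Finset.mem_filter.1 hm'
    rcases lt_trichotomy m m' with h | h | h
    · exact absurd heq (key m m' h2 (mem_normValues.1 h1').1 h).ne
    · exact h
    · exact absurd heq (key m' m h2' (mem_normValues.1 h1).1 h).ne'
  have h := Finset.card_le_card_of_injOn _ hmaps hinj
  rwa [Int.card_Icc, show ((X / H : ℕ) : ℤ) + 1 - 0 = ((X / H + 1 : ℕ) : ℤ) by push_cast; ring,
    Int.toNat_natCast] at h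

open Classical in
lemma ncard_badEigenvalues_le (hφ : φ ∈ Set.Ioo (-Real.pi) Real.pi) {a : ℝ} (ha' : a < 1 / 2)
    (X : ℕ) {H : ℕ} (hH : 1 ≤ H) :
    {lam ∈ badEigenvalues x₀ φ a | lam ≤ X}.ncard ≤ X / H + 1 +
      ((Finset.Icc (0 : ℤ) X).filter fun m =>
        a < 4 * (H : ℝ) ^ 2 * pairSum m ⌊(X : ℝ) ^ (1 / 2 - a)⌋₊).card := by
  refine le_trans ?_ (add_le_add_left (card_large_gaps_le X hH) _)
  refine le_trans ?_ (Finset.card_union_le _ _)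
  rw [← Set.ncard_coe_finset]
  refine Set.ncard_le_ncard_of_injOn prevNorm ?_ ?_ (Finset.finite_toSet _)
  · rintro lam ⟨⟨hl, h1, hb⟩, hX⟩
    have h0 : 0 ≤ lam := by linarith
    obtain ⟨α, β, hα, hβ, hgap⟩ := exists_gap h0 hl.2
    have hmem : normSq α ∈ normValues X := by
      have := prevNorm_mem_normValues h0 hl.2 hX
      rwa [prevNorm_eq hα hβ hgap, Nat.floor_natCast] at this
    rw [prevNorm_eq hα hβ hgap, Finset.mem_coe, Finset.mem_union, Finset.mem_filter,
      Finset.mem_filter, Finset.mem_Icc]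
    by_cases hH' : normSq α + H ≤ normSq β
    · exact Or.inl ⟨hmem, fun ξ => (hgap ξ).imp_right hH'.trans⟩
    · refine Or.inr ⟨⟨normSq_nonneg α, (mem_normValues.1 hmem).2⟩, hb.trans_le ?_⟩
      refine (massError_le hα hβ hgap _).trans ?_
      have h2 : (normSq β : ℝ) - normSq α ≤ H := by
        have : (normSq β : ℝ) ≤ normSq α + H := by exact_mod_cast (not_le.1 hH').le
        linarith
      have h3 : 0 ≤ (normSq β : ℝ) - normSq α := by linarith
      have := pairSum_nonneg (normSq α) ⌊lam ^ (1 / 2 - a)⌋₊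
      have hK : ⌊lam ^ (1 / 2 - a)⌋₊ ≤ ⌊(X : ℝ) ^ (1 / 2 - a)⌋₊ :=
        Nat.floor_mono (Real.rpow_le_rpow h0 hX (by linarith))
      gcongr
      exact pairSum_mono _ hK
  · refine (injOn_prevNorm (x₀ := x₀) hφ).mono ?_
    exact fun lam h => ⟨h.1.1, by linarith [h.1.2.1]⟩

lemma exists_ncard_badEigenvalues_le (hφ : φ ∈ Set.Ioo (-Real.pi) Real.pi) {a : ℝ} (ha : 0 < a)
    (ha' : a < 1 / 2) : ∃ C : ℝ, 0 < C ∧ ∀ X : ℕ, 1 ≤ X →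
      ({lam ∈ badEigenvalues x₀ φ a | lam ≤ X}.ncard : ℝ) ≤ C * (X : ℝ) ^ (1 - a / 4) := by
  classical
  obtain ⟨C, hC, h⟩ := exists_sum_pairSum_le (δ := a / 4) (by positivity) (by linarith)
  refine ⟨2 + 16 * C / a, by positivity, fun X hX => ?_⟩
  have hX1 : (1 : ℝ) ≤ X := by exact_mod_cast hX
  have hX0 : (0 : ℝ) < X := by linarith
  -- The threshold for long gaps.
  set H := ⌈(X : ℝ) ^ (a / 4)⌉₊ with hH
  have hXa : (1 : ℝ) ≤ (X : ℝ) ^ (a / 4) := Real.one_le_rpow hX1 (by positivity)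
  have hHge : (X : ℝ) ^ (a / 4) ≤ H := Nat.le_ceil _
  have hHle : (H : ℝ) ≤ 2 * (X : ℝ) ^ (a / 4) := by
    have := Nat.ceil_lt_add_one (by positivity : 0 ≤ (X : ℝ) ^ (a / 4))
    linarith
  have hH1 : 1 ≤ H := by exact_mod_cast hXa.trans hHge
  have hH0 : (0 : ℝ) < H := by linarith
  set K := ⌊(X : ℝ) ^ (1 / 2 - a)⌋₊ with hK
  have hK1 : 1 ≤ K := Nat.le_floor (by exact_mod_cast Real.one_le_rpow hX1 (by linarith))
  have hKle : (K : ℝ) ≤ (X : ℝ) ^ (1 / 2 - a) := Nat.floor_le (by positivity)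
  have hKX : K ≤ 2 * (Nat.sqrt X + 1) := by
    have h1 : (K : ℝ) ≤ √X := by
      rw [Real.sqrt_eq_rpow]
      exact hKle.trans (Real.rpow_le_rpow_of_exponent_le hX1 (by linarith))
    have h2 : √(X : ℝ) ≤ Nat.sqrt X + 1 := by
      rw [Real.sqrt_le_left (by positivity)]
      exact_mod_cast (Nat.lt_succ_sqrt' X).le
    have h3 : K ≤ Nat.sqrt X + 1 := by exact_mod_cast h1.trans h2
    omega
  set F := (Finset.Icc (0 : ℤ) X).filter fun m => a < 4 * (H : ℝ) ^ 2 * pairSum m K with hF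
  have hFcard : (F.card : ℝ) ≤ 16 * C / a * (X : ℝ) ^ (1 - a / 4) := by
    have h1 : (F.card : ℝ) * a ≤ 4 * (H : ℝ) ^ 2 * ∑ m ∈ Finset.Icc (0 : ℤ) X, pairSum m K := by
      rw [← nsmul_eq_mul, ← Finset.sum_const, Finset.mul_sum]
      calc _ ≤ ∑ m ∈ F, 4 * (H : ℝ) ^ 2 * pairSum m K :=
            Finset.sum_le_sum fun m hm => (Finset.mem_filter.1 hm).2.le
        _ ≤ _ := Finset.sum_le_sum_of_subset_of_nonneg (Finset.filter_subset _ _)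
            fun m _ _ => mul_nonneg (by positivity) (pairSum_nonneg m K)
    rw [div_mul_eq_mul_div, le_div_iff₀ ha]
    calc (F.card : ℝ) * a ≤ 4 * (H : ℝ) ^ 2 * ∑ m ∈ Finset.Icc (0 : ℤ) X, pairSum m K := h1
      _ ≤ 4 * (2 * (X : ℝ) ^ (a / 4)) ^ 2
            * (C * (X : ℝ) ^ (1 / 2 + a / 4) * (X : ℝ) ^ (1 / 2 - a)) := by
          have h2 := (h X K hX hK1 hKX).1.trans
            (mul_le_mul_of_nonneg_left hKle (by positivity))
          gcongr
          exact Finset.sum_nonneg fun m _ => pairSum_nonneg m K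
      _ = 16 * C * ((X : ℝ) ^ (a / 4) * (X : ℝ) ^ (a / 4)
            * (X : ℝ) ^ (1 / 2 + a / 4) * (X : ℝ) ^ (1 / 2 - a)) := by ring
      _ = 16 * C * (X : ℝ) ^ (1 - a / 4) := by
          rw [← Real.rpow_add hX0, ← Real.rpow_add hX0, ← Real.rpow_add hX0]
          congr 2; ring
  have hgaps : ((X / H : ℕ) : ℝ) ≤ (X : ℝ) ^ (1 - a / 4) := by
    rw [Real.rpow_sub hX0, Real.rpow_one]
    exact Nat.cast_div_le.trans (by gcongr)
  have hone : (1 : ℝ) ≤ (X : ℝ) ^ (1 - a / 4) := Real.one_le_rpow hX1 (by linarith)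
  have hmain : ({lam ∈ badEigenvalues x₀ φ a | lam ≤ X}.ncard : ℝ) ≤ (X / H : ℕ) + 1 + F.card := by
    have := ncard_badEigenvalues_le (x₀ := x₀) hφ ha' X hH1
    rw [← hK, ← hF] at this
    exact_mod_cast this
  linarith

/-- The bad eigenvalues have density zero, and there are infinitely many new eigenvalues. -/
lemma eventually_ncard_badEigenvalues_le (hφ : φ ∈ Set.Ioo (-Real.pi) Real.pi) {a η : ℝ}
    (ha : 0 < a) (ha' : a < 1 / 2) (hη : 0 < η) : ∀ᶠ X : ℝ in atTop,
      0 < {lam ∈ newEigenvalues x₀ φ | lam ≤ X}.ncard ∧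
      ({lam ∈ badEigenvalues x₀ φ a | lam ≤ X}.ncard : ℝ)
        ≤ η * {lam ∈ newEigenvalues x₀ φ | lam ≤ X}.ncard := by
  obtain ⟨C, hC, hbad⟩ := exists_ncard_badEigenvalues_le (x₀ := x₀) hφ ha ha'
  obtain ⟨c, hc, hnorm⟩ := exists_le_card_normValues (δ := a / 8) (by positivity) (by linarith)
  have hnat : Tendsto (fun X : ℝ => ((⌊X⌋₊ : ℕ) : ℝ)) atTop atTop :=
    tendsto_natCast_atTop_atTop.comp tendsto_nat_floor_atTop
  have e1 := ((tendsto_rpow_atTop (by linarith : 0 < 1 - a / 8)).comp hnat).eventually_ge_atTop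
    (2 / c)
  have e2 := ((tendsto_rpow_atTop (by positivity : 0 < a / 8)).comp hnat).eventually_ge_atTop
    (4 * C / (η * c))
  filter_upwards [e1, e2, eventually_ge_atTop (2 : ℝ)] with X h1 h2 hX
  simp only [Function.comp_apply] at h1 h2
  set n := ⌊X⌋₊ with hn
  have hn2 : 2 ≤ n := Nat.le_floor (by exact_mod_cast hX)
  have hn0 : (0 : ℝ) < n := by exact_mod_cast (by omega : 0 < n)
  have hn1 : (1 : ℝ) ≤ n := by exact_mod_cast (by omega : 1 ≤ n)
  have hnX : (n : ℝ) ≤ X := Nat.floor_le (by linarith)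
  have hXn : X ≤ (n + 1 : ℕ) := by exact_mod_cast (Nat.lt_floor_add_one X).le
  have hcount : ({lam ∈ newEigenvalues x₀ φ | lam ≤ n}.ncard : ℝ)
      ≤ {lam ∈ newEigenvalues x₀ φ | lam ≤ X}.ncard := by
    have hsub : {lam ∈ newEigenvalues x₀ φ | lam ≤ n} ⊆ {lam ∈ newEigenvalues x₀ φ | lam ≤ X} :=
      fun lam h => ⟨h.1, h.2.trans hnX⟩
    exact_mod_cast Set.ncard_le_ncard hsub (finite_newEigenvalues_le hφ X)
  have hlow : c * (n : ℝ) ^ (1 - a / 8) - 1 ≤ {lam ∈ newEigenvalues x₀ φ | lam ≤ n}.ncard := by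
    have : ((normValues n).card : ℝ) ≤ {lam ∈ newEigenvalues x₀ φ | lam ≤ n}.ncard + 1 := by
      exact_mod_cast card_normValues_le hφ n
    linarith [hnorm n hn2]
  rw [div_le_iff₀ hc] at h1
  have hlow2 : c / 2 * (n : ℝ) ^ (1 - a / 8) ≤ {lam ∈ newEigenvalues x₀ φ | lam ≤ X}.ncard := by
    linarith
  constructor
  · have : (0 : ℝ) < {lam ∈ newEigenvalues x₀ φ | lam ≤ X}.ncard :=
      lt_of_lt_of_le (by positivity) hlow2
    exact_mod_cast this
  · have hfin : {lam ∈ badEigenvalues x₀ φ a | lam ≤ (n + 1 : ℕ)}.Finite :=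
      (finite_newEigenvalues_le (x₀ := x₀) hφ (n + 1 : ℕ)).subset fun lam h => ⟨h.1.1, h.2⟩
    have h3 : ({lam ∈ badEigenvalues x₀ φ a | lam ≤ X}.ncard : ℝ)
        ≤ {lam ∈ badEigenvalues x₀ φ a | lam ≤ (n + 1 : ℕ)}.ncard := by
      have hsub : {lam ∈ badEigenvalues x₀ φ a | lam ≤ X}
          ⊆ {lam ∈ badEigenvalues x₀ φ a | lam ≤ (n + 1 : ℕ)} := fun lam h => ⟨h.1, h.2.trans hXn⟩
      exact_mod_cast Set.ncard_le_ncard hsub hfin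
    have h4 : ((n + 1 : ℕ) : ℝ) ^ (1 - a / 4) ≤ 2 * (n : ℝ) ^ (1 - a / 4) := by
      calc _ ≤ (2 * n : ℝ) ^ (1 - a / 4) := by
            refine Real.rpow_le_rpow (by positivity) ?_ (by linarith)
            push_cast; linarith
        _ = 2 ^ (1 - a / 4) * (n : ℝ) ^ (1 - a / 4) := Real.mul_rpow (by norm_num) hn0.le
        _ ≤ 2 ^ (1 : ℝ) * (n : ℝ) ^ (1 - a / 4) := by
            gcongr
            · norm_num
            · linarith
        _ = _ := by rw [Real.rpow_one]
    have h5 : (n : ℝ) ^ (1 - a / 8) = (n : ℝ) ^ (1 - a / 4) * (n : ℝ) ^ (a / 8) := by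
      rw [← Real.rpow_add hn0]; congr 1; ring
    rw [div_le_iff₀ (by positivity)] at h2
    calc _ ≤ C * ((n + 1 : ℕ) : ℝ) ^ (1 - a / 4) := h3.trans (hbad (n + 1) (by omega))
      _ ≤ C * (2 * (n : ℝ) ^ (1 - a / 4)) := by gcongr
      _ = 1 / 2 * (n : ℝ) ^ (1 - a / 4) * (4 * C) := by ring
      _ ≤ 1 / 2 * (n : ℝ) ^ (1 - a / 4) * ((n : ℝ) ^ (a / 8) * (η * c)) := by gcongr
      _ = η * (c / 2 * (n : ℝ) ^ (1 - a / 8)) := by rw [h5]; ring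
      _ ≤ _ := by gcongr

/-- An increasing sequence of density zero subsets can be removed up to bounded sets, leaving a
subset of density one. -/
lemma exists_isDensityOneSubset {S : Set ℝ} {B : ℕ → Set ℝ} (hfin : ∀ X, {s ∈ S | s ≤ X}.Finite)
    (hBS : ∀ j, B j ⊆ S) (hB : Monotone B)
    (h : ∀ j, ∀ η : ℝ, 0 < η → ∀ᶠ X : ℝ in atTop, 0 < {s ∈ S | s ≤ X}.ncard ∧
      ({s ∈ B j | s ≤ X}.ncard : ℝ) ≤ η * {s ∈ S | s ≤ X}.ncard) :
    ∃ S', IsDensityOneSubset S' S ∧ ∀ j, ∀ᶠ s in atTop, s ∈ S' → s ∉ B j := by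
  have h' : ∀ j : ℕ, ∃ t : ℝ, j ≤ t ∧ ∀ X, t ≤ X → 0 < {s ∈ S | s ≤ X}.ncard ∧
      ({s ∈ B j | s ≤ X}.ncard : ℝ) ≤ ((j : ℝ) + 1)⁻¹ * {s ∈ S | s ≤ X}.ncard := by
    intro j
    obtain ⟨t, ht⟩ := eventually_atTop.1 (h j ((j : ℝ) + 1)⁻¹ (by positivity))
    exact ⟨max t j, le_max_right _ _, fun X hX => ht X ((le_max_left _ _).trans hX)⟩
  choose t htj ht using h'
  set Z : Set ℝ := {s | ∃ j, t j ≤ s ∧ s ∈ B j} with hZ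
  have hZS : Z ⊆ S := fun s ⟨j, _, hs⟩ => hBS j hs
  refine ⟨S \ Z, ⟨Set.sdiff_subset, ?_⟩, fun j => ?_⟩
  · -- Up to `X` only those `B j` with `t j ≤ X` matter, and the last of them contains the others.
    have hZcount : ∀ J X, t J ≤ X →
        ({s ∈ Z | s ≤ X}.ncard : ℝ) ≤ ((J : ℝ) + 1)⁻¹ * {s ∈ S | s ≤ X}.ncard := by
      intro J X hJX
      obtain ⟨n, hn⟩ := exists_nat_gt X
      have hbdd : ∀ j, t j ≤ X → j ≤ n := fun j hj => by
        exact_mod_cast ((htj j).trans hj).trans hn.le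
      classical
      set J' := Nat.findGreatest (fun j => t j ≤ X) n with hJ'
      have hJ'X : t J' ≤ X := Nat.findGreatest_spec (P := fun j => t j ≤ X) (hbdd J hJX) hJX
      have hJJ' : J ≤ J' := Nat.le_findGreatest (hbdd J hJX) hJX
      have hsub : {s ∈ Z | s ≤ X} ⊆ {s ∈ B J' | s ≤ X} := by
        rintro s ⟨⟨j, hj, hs⟩, hsX⟩
        exact ⟨hB (Nat.le_findGreatest (hbdd j (hj.trans hsX)) (hj.trans hsX)) hs, hsX⟩
      have hfinB : {s ∈ B J' | s ≤ X}.Finite := (hfin X).subset fun s hs => ⟨hBS J' hs.1, hs.2⟩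
      calc ({s ∈ Z | s ≤ X}.ncard : ℝ) ≤ {s ∈ B J' | s ≤ X}.ncard := by
            exact_mod_cast Set.ncard_le_ncard hsub hfinB
        _ ≤ ((J' : ℝ) + 1)⁻¹ * {s ∈ S | s ≤ X}.ncard := (ht J' X hJ'X).2
        _ ≤ _ := by
            gcongr
    rw [Metric.tendsto_atTop]
    intro ε hε
    obtain ⟨J, hJ⟩ := exists_nat_one_div_lt hε
    refine ⟨t J, fun X hX => ?_⟩
    have hpos : (0 : ℝ) < {s ∈ S | s ≤ X}.ncard := by exact_mod_cast (ht J X hX).1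
    have hsplit : {s ∈ S \ Z | s ≤ X} = {s ∈ S | s ≤ X} \ {s ∈ Z | s ≤ X} := by
      ext s
      simp only [Set.mem_ofPred_eq, Set.mem_sdiff]
      tauto
    have hcard : ({s ∈ S \ Z | s ≤ X}.ncard : ℝ)
        = {s ∈ S | s ≤ X}.ncard - {s ∈ Z | s ≤ X}.ncard := by
      have hsub : {s ∈ Z | s ≤ X} ⊆ {s ∈ S | s ≤ X} := fun s hs => ⟨hZS hs.1, hs.2⟩
      rw [hsplit, eq_sub_iff_add_eq]
      exact_mod_cast Set.ncard_sdiff_add_ncard_of_subset hsub (hfin X)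
    rw [hcard, Real.dist_eq, sub_div, div_self hpos.ne', sub_sub_cancel_left, abs_neg,
      abs_of_nonneg (by positivity)]
    refine lt_of_le_of_lt ?_ hJ
    rw [div_le_iff₀ hpos, one_div]
    exact hZcount J X hX
  · filter_upwards [eventually_ge_atTop (t j)] with s hs hs' hsB
    exact hs'.2 ⟨j, hs, hsB⟩

/-- The equidistribution of the new eigenfunctions along the eigenvalues that are not bad. -/
lemma exists_tendsto_massDiscrepancy (x₀ : Torus) (hφ : φ ∈ Set.Ioo (-Real.pi) Real.pi) :
    ∃ Λ' : Set ℝ, IsDensityOneSubset Λ' (newEigenvalues x₀ φ) ∧ ∀ ε : ℝ, 0 < ε →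
      Tendsto (fun lam : ℝ => massDiscrepancy x₀ lam (lam ^ (-(1 / 2) + ε))) (atTop ⊓ 𝓟 Λ')
        (𝓝 0) := by
  set a : ℕ → ℝ := fun j => 1 / ((j + 2 : ℕ) + 1) with ha
  have ha0 : ∀ j, 0 < a j := fun j => by positivity
  have ha1 : ∀ j, a j < 1 / 2 := fun j => by
    refine one_div_lt_one_div_of_lt (by norm_num) ?_
    push_cast
    linarith [(Nat.cast_nonneg j : (0 : ℝ) ≤ j)]
  have hanti : Antitone a := fun i j hij => by
    refine one_div_le_one_div_of_le (by positivity) ?_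
    push_cast
    have : (i : ℝ) ≤ j := by exact_mod_cast hij
    linarith
  have hlim : Tendsto a atTop (nhds 0) :=
    tendsto_one_div_add_atTop_nhds_zero_nat.comp (tendsto_add_atTop_nat 2)
  obtain ⟨Λ', hΛ', hgood⟩ := exists_isDensityOneSubset (S := newEigenvalues x₀ φ)
    (B := fun j => badEigenvalues x₀ φ (a j)) (finite_newEigenvalues_le hφ) (fun j lam h => h.1)
    (fun i j hij => badEigenvalues_anti (hanti hij))
    (fun j η hη => eventually_ncard_badEigenvalues_le hφ (ha0 j) (ha1 j) hη)
  refine ⟨Λ', hΛ', fun ε hε => ENNReal.tendsto_nhds_zero.2 fun η hη => ?_⟩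
  -- A finite positive real number below `η`.
  obtain ⟨η', hη'0, hη'⟩ : ∃ η' : ℝ, 0 < η' ∧ ENNReal.ofReal η' ≤ η := by
    obtain ⟨q, hq0, hq⟩ := ENNReal.lt_iff_exists_nnreal_btwn.1 hη
    exact ⟨q, by exact_mod_cast hq0, by rw [ENNReal.ofReal_coe_nnreal]; exact hq.le⟩
  obtain ⟨j, hj⟩ := (hlim.eventually (gt_mem_nhds (half_pos hε))).exists
  obtain ⟨e, he0, he⟩ := exists_massDiscrepancy_le (ha0 j) (ha1 j) hη'0
  obtain ⟨i, hij, hi⟩ := ((eventually_ge_atTop j).and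
    (hlim.eventually (gt_mem_nhds he0))).exists
  rw [eventually_inf_principal]
  filter_upwards [he, hgood i, eventually_ge_atTop (1 : ℝ)] with lam h1 h2 h3 hmem
  have hnew := hΛ'.1 hmem
  have hmass : massError lam ⌊lam ^ (1 / 2 - a i)⌋₊ ≤ a i := by
    by_contra h
    exact h2 hmem ⟨hnew, h3, not_le.1 h⟩
  have hfloor : ⌊lam ^ (1 / 2 - a j)⌋₊ ≤ ⌊lam ^ (1 / 2 - a i)⌋₊ :=
    Nat.floor_mono (Real.rpow_le_rpow_of_exponent_le h3 (by linarith [hanti hij]))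
  refine le_trans ?_ ((h1 x₀ hnew.2 ((massError_mono lam hfloor).trans
    (hmass.trans hi.le))).trans hη')
  -- Fewer radii enter the supremum for larger `ε`.
  have hρ : lam ^ (-(1 / 2) + 2 * a j) ≤ lam ^ (-(1 / 2) + ε) :=
    Real.rpow_le_rpow_of_exponent_le h3 (by linarith)
  exact iSup_le fun x => iSup_le fun r => iSup_le fun hr =>
    le_iSup_of_le x (le_iSup_of_le r (le_iSup_of_le ⟨hρ.trans_lt hr.1, hr.2⟩ le_rfl))

end

end PointScatterer

theorem theorem1p1 (x₀ : PointScatterer.Torus) (φ : ℝ) (hφ : φ ∈ Set.Ioo (-Real.pi) Real.pi) :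
    ∃ Λ' : Set ℝ,
      PointScatterer.IsDensityOneSubset Λ' (PointScatterer.newEigenvalues x₀ φ) ∧
      ∀ ε : ℝ, 0 < ε →
        Filter.Tendsto
          (fun lam : ℝ => PointScatterer.massDiscrepancy x₀ lam (lam ^ (-(1 / 2) + ε)))
          (Filter.atTop ⊓ Filter.principal Λ') (nhds 0) := 
  PointScatterer.exists_tendsto_massDiscrepancy x₀ hφ
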